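/- Theorem 5.3 (Kähler identity of Minkowski type). Let $X$ be a complex manifold of dimension $n$ (Hausdorff, second countable), let $\omega=i\sum\omega_{j\bar k}\,dz^j\wedge d\bar z^k$ be a symplectic form of type $(1,1)$ on $X$ (a smooth real closed nondegenerate $(1,1)$-form), and let $\omega_g=i\sum g_{j\bar k}\,dz^j\wedge d\bar z^k$ be the fundamental form of a smooth Hermitian metric on $X$. For $\eta=\omega$ or $\eta=\omega_g$ and $(p,q)$-forms $\varphi,\psi$ put $$\eta^{-1}(\varphi,\psi)=\frac1{p!\,q!}\sum(\eta^{-1})^{\bar r_1j_1}\cdots(\eta^{-1})^{\bar r_pj_p}(\eta^{-1})^{\bar k_1s_1}\cdots(\eta^{-1})^{\bar k_qs_q}\,\varphi_{j_1\cdots j_p\bar k_1\cdots\bar k_q}\,\overline{\psi_{r_1\cdots r_p\bar s_1\cdots\bar s_q}},$$ where $(\eta^{-1})^{\bar rj}$ is the inverse matrix of $(\eta_{j\bar k})$, forms of different types being orthogonal. The symplectic star operator $*_s$ is the $\mathbb C$-linear operator with $*_s\overline\psi$ of type $(n-p,n-q)$ and $i^{q-p}\varphi\wedge *_s\overline\psi=\omega^{-1}(\varphi,\psi)\,\omega^n/n!$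 for all $\varphi,\psi$ of type $(p,q)$. Put $L=\omega\wedge\cdot$, $\Lambda=*_sL*_s$, and $\overline\partial^\Lambda=(-1)^{k+1}*_s\overline\partial *_s$ on $k$-forms. For an operator $P$ on smooth complex forms let $P^*$ be its formal adjoint for $\ll u,v\gg=\int_X\omega_g^{-1}(u,v)\,\omega_g^n/n!$: for smooth $v$, the form $P^*v$ is smooth and $\ll Pu,v\gg=\ll u,P^*v\gg$ for all smooth compactly supported $u$. Suppose that $\omega_g$ is admissible for $\omega$, i.e. at each point all eigenvalues of $\omega$ with respect to $\omega_g$ lie in $\{1,-1\}$. Then the formal adjoints of $\overline\partial$, $\overline\partial^\Lambda$ and $\Lambda$ exist and are unique, and on smooth complex forms $$\Lambda^*=L,\qquad(\overline\partial^\Lambda)^*=[L,\overline\partial^*],\qquad[(\overline\partial^\Lambda)^*,L]=0,$$ where $[A,B]=AB-BA$. -/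

import Mathlib

open scoped Manifold ContDiff ComplexConjugate ComplexOrder

noncomputable section

namespace MinkowskiKahler

/-! ### Exterior algebra of the complexified cotangent space of `ℂⁿ` -/

/-- Complex-valued real-linear forms on `ℂⁿ`, i.e. `T* ⊗ ℂ = Λ^{1,0} ⊕ Λ^{0,1}`. -/
abbrev Covec (n : ℕ) : Type := (Fin n → ℂ) →L[ℝ] ℂ

/-- The complex exterior algebra `⨁ₖ Λᵏ (T* ⊗ ℂ)`; the wedge product is its multiplication. -/
abbrev Ext (n : ℕ) : Type := ExteriorAlgebra ℂ (Covec n)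

/-- The real tangent vector `∂/∂xⱼ`. -/
def ex {n : ℕ} (j : Fin n) : Fin n → ℂ := Pi.single j 1

/-- The real tangent vector `∂/∂yⱼ = J ∂/∂xⱼ`. -/
def ey {n : ℕ} (j : Fin n) : Fin n → ℂ := Pi.single j Complex.I

/-- The covector `dzⱼ`. -/
def dz {n : ℕ} (j : Fin n) : Covec n := ContinuousLinearMap.proj j

/-- The covector `dz̄ⱼ`. -/
def dzbar {n : ℕ} (j : Fin n) : Covec n :=
  (Complex.conjCLE : ℂ →L[ℝ] ℂ).comp (ContinuousLinearMap.proj j)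

/-- A real tangent vector, as a functional on complex covectors. -/
def evalVec {n : ℕ} (v : Fin n → ℂ) : Module.Dual ℂ (Covec n) where
  toFun α := α v
  map_add' _ _ := rfl
  map_smul' _ _ := rfl

/-- The complex tangent vector `∂/∂zⱼ = (∂/∂xⱼ - i ∂/∂yⱼ) / 2`. -/
def delVec {n : ℕ} (j : Fin n) : Module.Dual ℂ (Covec n) :=
  (1 / 2 : ℂ) • (evalVec (ex j) - Complex.I • evalVec (ey j))

/-- The complex tangent vector `∂/∂z̄ⱼ = (∂/∂xⱼ + i ∂/∂yⱼ) / 2`. -/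
def delbarVec {n : ℕ} (j : Fin n) : Module.Dual ℂ (Covec n) :=
  (1 / 2 : ℂ) • (evalVec (ex j) + Complex.I • evalVec (ey j))

/-- `φ(v₁, …, vₖ)`, the value of the degree `k` part of `φ` on `k` complex tangent vectors:
contract `φ` with `v₁`, then with `v₂`, and so on, and take the scalar part. -/
def evalOn {n : ℕ} (φ : Ext n) (l : List (Module.Dual ℂ (Covec n))) : ℂ :=
  ExteriorAlgebra.algebraMapInv
    (l.foldl (fun a d => CliffordAlgebra.contractLeft d a) φ)

/-- The component `φ_{j₁ … jₚ k̄₁ … k̄_q}`. -/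
def component {n : ℕ} (φ : Ext n) {p q : ℕ} (J : Fin p → Fin n) (K : Fin q → Fin n) : ℂ :=
  evalOn φ (List.ofFn (fun a => delVec (J a)) ++ List.ofFn (fun b => delbarVec (K b)))

/-- The monomial `dz_{j₁} ∧ … ∧ dz_{jₚ} ∧ dz̄_{k₁} ∧ … ∧ dz̄_{k_q}`. -/
def monomial {n p q : ℕ} (J : Fin p → Fin n) (K : Fin q → Fin n) : Ext n :=
  (List.ofFn (fun a => ExteriorAlgebra.ι ℂ (dz (J a)))).prod *
    (List.ofFn (fun b => ExteriorAlgebra.ι ℂ (dzbar (K b)))).prod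

/-- The monomial `dz̄_{j₁} ∧ … ∧ dz̄_{jₚ} ∧ dz_{k₁} ∧ … ∧ dz_{k_q}`. -/
def monomialConj {n p q : ℕ} (J : Fin p → Fin n) (K : Fin q → Fin n) : Ext n :=
  (List.ofFn (fun a => ExteriorAlgebra.ι ℂ (dzbar (J a)))).prod *
    (List.ofFn (fun b => ExteriorAlgebra.ι ℂ (dz (K b)))).prod

/-- The forms of type `(p, q)`. -/
def typeSub (n p q : ℕ) : Submodule ℂ (Ext n) :=
  Submodule.span ℂ
    (Set.range fun JK : (Fin p → Fin n) × (Fin q → Fin n) => monomial JK.1 JK.2)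

/-- Complex conjugation of forms. -/
def conjForm {n : ℕ} (φ : Ext n) : Ext n :=
  ∑ p ∈ Finset.range (n + 1), ∑ q ∈ Finset.range (n + 1), ((p.factorial * q.factorial : ℂ)⁻¹) •
    ∑ J : Fin p → Fin n, ∑ K : Fin q → Fin n, conj (component φ J K) • monomialConj J K

/-- The matrix `(η_{j k̄})` of the `(1,1)` part `i ∑ η_{j k̄} dzⱼ ∧ dz̄ₖ` of `η`. -/
def matrixOf {n : ℕ} (η : Ext n) : Matrix (Fin n) (Fin n) ℂ :=
  Matrix.of fun j k => -Complex.I * component η ![j] ![k]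

/-- `η` is a real form of type `(1,1)`: it is `i ∑ η_{j k̄} dzⱼ ∧ dz̄ₖ`, with `(η_{j k̄})`
Hermitian. -/
def IsRealOneOne {n : ℕ} (η : Ext n) : Prop :=
  η = Complex.I • ∑ j : Fin n, ∑ k : Fin n, matrixOf η j k •
      (ExteriorAlgebra.ι ℂ (dz j) * ExteriorAlgebra.ι ℂ (dzbar k)) ∧
    (matrixOf η).IsHermitian

/-- The sesquilinear pairing `η⁻¹(φ, ψ)` that a nondegenerate real `(1,1)`-form `η` induces on
forms; forms of different types are orthogonal. For the fundamental form of a Hermitian metric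
this is the pointwise Hermitian product. -/
def pairing {n : ℕ} (η φ ψ : Ext n) : ℂ :=
  ∑ p ∈ Finset.range (n + 1), ∑ q ∈ Finset.range (n + 1), (p.factorial * q.factorial : ℂ)⁻¹ *
    ∑ J : Fin p → Fin n, ∑ R : Fin p → Fin n, ∑ K : Fin q → Fin n, ∑ S : Fin q → Fin n,
      (∏ a, (matrixOf η)⁻¹ (R a) (J a)) * (∏ b, (matrixOf η)⁻¹ (K b) (S b)) *
        component φ J K * conj (component ψ R S)

/-- `ηⁿ / n!`. -/
def volForm {n : ℕ} (η : Ext n) : Ext n := ((n.factorial : ℂ)⁻¹) • η ^ n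

/-- `S` is the symplectic star operator of `η`: it is complex linear, and for `φ, ψ` of type
`(p, q)` the form `S ψ̄` has type `(n - p, n - q)` and
`i^{q-p} φ ∧ S ψ̄ = η⁻¹(φ, ψ) ηⁿ / n!`. -/
def IsSymplStar {n : ℕ} (η : Ext n) (S : Ext n →ₗ[ℂ] Ext n) : Prop :=
  ∀ p q : ℕ, p ≤ n → q ≤ n → ∀ φ ∈ typeSub n p q, ∀ ψ ∈ typeSub n p q,
    S (conjForm ψ) ∈ typeSub n (n - p) (n - q) ∧
      (Complex.I ^ ((q : ℤ) - (p : ℤ))) • (φ * S (conjForm ψ)) = pairing η φ ψ • volForm η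

open Classical in
/-- The symplectic star operator of a nondegenerate real `(1,1)`-form `η`. -/
def symplStar {n : ℕ} (η : Ext n) : Ext n →ₗ[ℂ] Ext n :=
  if h : ∃ S : Ext n →ₗ[ℂ] Ext n, IsSymplStar η S then h.choose else 0

/-! ### `∂` and `∂̄` on an open set of `ℂⁿ` -/

/-- `∂f/∂z_l` of a form-valued function, taken component by component. -/
def partialZ {n : ℕ} (f : (Fin n → ℂ) → Ext n) (l : Fin n) (y : Fin n → ℂ) : Ext n :=
  ∑ p ∈ Finset.range (n + 1), ∑ q ∈ Finset.range (n + 1), ((p.factorial * q.factorial : ℂ)⁻¹) •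
    ∑ J : Fin p → Fin n, ∑ K : Fin q → Fin n,
      ((1 / 2 : ℂ) * (fderiv ℝ (fun y' => component (f y') J K) y (ex l) -
        Complex.I * fderiv ℝ (fun y' => component (f y') J K) y (ey l))) • monomial J K

/-- `∂f/∂z̄_l` of a form-valued function, taken component by component. -/
def partialZbar {n : ℕ} (f : (Fin n → ℂ) → Ext n) (l : Fin n) (y : Fin n → ℂ) : Ext n :=
  ∑ p ∈ Finset.range (n + 1), ∑ q ∈ Finset.range (n + 1), ((p.factorial * q.factorial : ℂ)⁻¹) •
    ∑ J : Fin p → Fin n, ∑ K : Fin q → Fin n,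
      ((1 / 2 : ℂ) * (fderiv ℝ (fun y' => component (f y') J K) y (ex l) +
        Complex.I * fderiv ℝ (fun y' => component (f y') J K) y (ey l))) • monomial J K

/-- `∂f = ∑ dz_l ∧ ∂f/∂z_l`. -/
def localDel {n : ℕ} (f : (Fin n → ℂ) → Ext n) (y : Fin n → ℂ) : Ext n :=
  ∑ l : Fin n, ExteriorAlgebra.ι ℂ (dz l) * partialZ f l y

/-- `∂̄f = ∑ dz̄_l ∧ ∂f/∂z̄_l`. -/
def localDbar {n : ℕ} (f : (Fin n → ℂ) → Ext n) (y : Fin n → ℂ) : Ext n :=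
  ∑ l : Fin n, ExteriorAlgebra.ι ℂ (dzbar l) * partialZbar f l y

/-! ### Differential forms on a complex manifold -/

/-- Complex differential forms (of mixed degree, not necessarily smooth) on a manifold `X` modelled
on `ℂⁿ`. In Mathlib the tangent space at `x` is `ℂⁿ` itself, through the preferred chart at `x`,
so that the value of a form at `x` is an element of the exterior algebra `Ext n`. -/
abbrev Form (n : ℕ) (X : Type*) : Type _ := X → Ext n

section Manifold

variable {n : ℕ} {X : Type*} [TopologicalSpace X] [ChartedSpace (Fin n → ℂ) X]

/-- The form `u` in the coordinates of the chart at `c`: its pullback under the inverse chart. -/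
def inChart (c : X) (u : Form n X) (y : Fin n → ℂ) : Ext n :=
  ExteriorAlgebra.map
    ({ toFun := fun α : Covec n => α.comp
          (mfderiv 𝓘(ℝ, Fin n → ℂ) 𝓘(ℝ, Fin n → ℂ) (chartAt (Fin n → ℂ) c).symm y :
            (Fin n → ℂ) →L[ℝ] (Fin n → ℂ))
       map_add' := fun _ _ => rfl
       map_smul' := fun _ _ => rfl } : Covec n →ₗ[ℂ] Covec n)
    (u ((chartAt (Fin n → ℂ) c).symm y))

/-- Smooth forms: all coefficients in all charts are smooth. -/
def IsSmooth (u : Form n X) : Prop :=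
  ∀ (c : X) (ℓ : Module.Dual ℂ (Ext n)),
    ContDiffOn ℝ ∞ (fun y => ℓ (inChart c u y)) (chartAt (Fin n → ℂ) c).target

/-- The operator `∂`. -/
def del (u : Form n X) : Form n X := fun x =>
  localDel (inChart x u) (chartAt (Fin n → ℂ) x x)

/-- The operator `∂̄`. -/
def dbar (u : Form n X) : Form n X := fun x =>
  localDbar (inChart x u) (chartAt (Fin n → ℂ) x x)

/-- The exterior derivative `d = ∂ + ∂̄`. -/
def extD (u : Form n X) : Form n X := del u + dbar u

/-- Symplectic forms of type `(1,1)`: smooth, real, of type `(1,1)`, nondegenerate and closed. -/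
structure IsSymplecticOneOne (om : Form n X) : Prop where
  smooth : IsSmooth om
  real_one_one : ∀ x, IsRealOneOne (om x)
  nondegenerate : ∀ x, (matrixOf (om x)).det ≠ 0
  closed : extD om = 0

/-- `ωg` is the fundamental form `i ∑ g_{j k̄} dzⱼ ∧ dz̄ₖ` of a (smooth) Hermitian metric. -/
structure IsHermitianMetric (ωg : Form n X) : Prop where
  smooth : IsSmooth ωg
  real_one_one : ∀ x, IsRealOneOne (ωg x)
  posDef : ∀ x, (matrixOf (ωg x)).PosDef

/-- The metric `ωg` is admissible for `om`: at each point every eigenvalue of `om` with respect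
to `ωg` is `1` or `-1`. -/
def IsAdmissible (om ωg : Form n X) : Prop :=
  ∀ (x : X) (μ : ℂ) (v : Fin n → ℂ), v ≠ 0 →
    (matrixOf (om x)).mulVec v = μ • (matrixOf (ωg x)).mulVec v → μ = 1 ∨ μ = -1

/-- The symplectic star operator on forms. -/
def starS (om : Form n X) (u : Form n X) : Form n X := fun x => symplStar (om x) (u x)

/-- The Lefschetz operator `L = om ∧ ·`. -/
def lefschetz (om : Form n X) (u : Form n X) : Form n X := fun x => om x * u x

/-- The dual Lefschetz operator `Λ = *ₛ L *ₛ`. -/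
def dualLefschetz (om : Form n X) (u : Form n X) : Form n X :=
  starS om (lefschetz om (starS om u))

/-- The symplectic adjoint `∂̄^Λ`, which is `(-1)^{k+1} *ₛ ∂̄ *ₛ` in degree `k`
(`CliffordAlgebra.involute` is multiplication by `(-1)^k` in degree `k`). -/
def dbarLam (om : Form n X) (u : Form n X) : Form n X :=
  -starS om (dbar (starS om fun x => CliffordAlgebra.involute (u x)))

/-- The coefficient of a top degree form with respect to `dx₁ ∧ dy₁ ∧ … ∧ dxₙ ∧ dyₙ`. -/
def topCoeff (η : Ext n) : ℂ :=
  evalOn η ((List.finRange n).flatMap fun j => [evalVec (ex j), evalVec (ey j)])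

open Classical in
/-- The integral over `X` (with its complex orientation) of a compactly supported top degree form,
through a smooth partition of unity subordinate to the cover by the coordinate charts. -/
def integralForm (η : Form n X) : ℂ :=
  if h : ∃ ρ : SmoothPartitionOfUnity X 𝓘(ℝ, Fin n → ℂ) X Set.univ,
      ρ.IsSubordinate fun c => (chartAt (Fin n → ℂ) c).source then
    ∑ᶠ c : X, ∫ y in (chartAt (Fin n → ℂ) c).target,
      ((h.choose c ((chartAt (Fin n → ℂ) c).symm y) : ℝ) : ℂ) * topCoeff (inChart c η y)
  else 0

/-- The `L²` Hermitian product `∫_X (u, v) ωgⁿ / n!`. -/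
def l2 (ωg : Form n X) (u v : Form n X) : ℂ :=
  integralForm fun x => pairing (ωg x) (u x) (v x) • volForm (ωg x)

/-- `w` is the value at `v` of the formal `L²` adjoint of `P`: it is smooth, and
`⟪P u, v⟫ = ⟪u, w⟫` for all smooth compactly supported `u`. -/
def IsAdjointAt (ωg : Form n X) (P : Form n X → Form n X) (v w : Form n X) : Prop :=
  IsSmooth w ∧ ∀ u : Form n X, IsSmooth u → HasCompactSupport u → l2 ωg (P u) v = l2 ωg u w

open Classical in
/-- The formal adjoint `P*` of `P` with respect to the `L²` product of `ωg`. -/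
def formalAdjoint (ωg : Form n X) (P : Form n X → Form n X) (v : Form n X) : Form n X :=
  if h : ∃ w : Form n X, IsAdjointAt ωg P v w then h.choose else 0

end Manifold

end MinkowskiKahler

end

open MinkowskiKahler

open scoped Manifold ContDiff ComplexConjugate ComplexOrder

open MinkowskiKahler

noncomputable section

namespace MinkowskiKahler

variable {n : ℕ}

/-! ### Wedge products and contractions -/

/-! Pointwise, a nondegenerate (1,1)-form η makes the exterior algebra a representation of sl₂: L is
the product with η, Λ is contraction with the inverse of η, and [L, Λ] = deg − n (`lef_lam`). Let W
= e^L e^{−Λ} e^L be the Weyl element. An operator A that commutes with L and raises the degree by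
one is, under the adjoint action, a highest weight vector of weight one. As Λ is nilpotent, A and B
= [Λ, A] span a representation of dimension at most two, so [Λ, B] = 0, W A W⁻¹ = −B and W B W⁻¹ = A
(`lie_lie_eq_zero_of_weight_one`, `weylElement_mul_of_weight_one`). This fact is used twice.

With A = α ∧ · it shows that `starOp`, which is W composed with the anti-involution `antiInv`,
exchanges exterior products and contractions. Hence `starOp` is an involution (`starOp_starOp`),
intertwines L and Λ (`starOp_lef`), and, combined with conjugation and the factor i^{q−p},
represents the pairing η⁻¹ (`topFunctional_mul_hodge`). So it is a symplectic star operator, and the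
only one because the wedge product is nondegenerate (`isSymplStar_starOp`, `IsSymplStar.eq_starOp`).
In particular *ₛ L *ₛ is the contraction Λ. The same construction for the metric form gives its
conjugate-linear Hodge star.

With A = ∂̄ acting on smooth forms: closedness of ω gives ∂̄ω = 0 by comparing types, so ∂̄ commutes
with L. The same fact then yields ∂̄^Λ = ∂̄Λ − Λ∂̄ (`dbarLam_eq`) and [Λ, ∂̄^Λ] = 0 (`lam_dbarLam`).
Up to here everything is algebra.

Admissibility enters through linear algebra: g⁻¹ω is self-adjoint for g with eigenvalues ±1, so its
square is 1 (`admissible_mul_self`), that is ω⁻¹ = g⁻¹ωg⁻¹. This says that Λ is the pointwise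
adjoint of L (`pairing_lef_left`), whence Λ* = L. The adjoint of ∂̄ comes from Stokes' theorem and
the Hodge star of g (`isAdjointAt_dbar`). Taking adjoints of ∂̄Λ − Λ∂̄ gives L∂̄* − ∂̄*L, and taking
adjoints of [Λ, ∂̄^Λ] = 0 gives the last identity. Adjoints are unique because the L² product is
definite, tested with bump functions (`eq_zero_of_l2`).

The remaining work connects this to definitions by components and preferred charts: the expansion of
forms and pairings in components, naturality under complex-linear pullback, and the independence of
charts of ∂̄ and of the integral. -/

/-- The exterior product with a covector. -/
abbrev wedge (α : Covec n) : Module.End ℂ (Ext n) :=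
  LinearMap.mulLeft ℂ (ExteriorAlgebra.ι ℂ α)

/-- The contraction with a complex tangent vector. -/
abbrev contract (d : Module.Dual ℂ (Covec n)) : Module.End ℂ (Ext n) :=
  CliffordAlgebra.contractLeft d

/-- The scalar part of a form. -/
abbrev scalarPart : Ext n →ₐ[ℂ] ℂ := ExteriorAlgebra.algebraMapInv

lemma contract_wedge (d : Module.Dual ℂ (Covec n)) (α : Covec n) (x : Ext n) :
    contract d (wedge α x) = d α • x - wedge α (contract d x) :=
  CliffordAlgebra.contractLeft_ι_mul d α x

lemma contract_one (d : Module.Dual ℂ (Covec n)) : contract d (1 : Ext n) = 0 :=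
  CliffordAlgebra.contractLeft_one _ d

lemma contract_comm (d d' : Module.Dual ℂ (Covec n)) (x : Ext n) :
    contract d (contract d' x) = -contract d' (contract d x) :=
  CliffordAlgebra.contractLeft_comm _ _ x

lemma contract_contract (d : Module.Dual ℂ (Covec n)) (x : Ext n) :
    contract d (contract d x) = 0 :=
  CliffordAlgebra.contractLeft_contractLeft _ x

lemma wedge_comm (α β : Covec n) (x : Ext n) : wedge α (wedge β x) = -wedge β (wedge α x) := by
  have h := ExteriorAlgebra.ι_add_mul_swap (R := ℂ) α β
  have h' : ExteriorAlgebra.ι ℂ α * ExteriorAlgebra.ι ℂ β =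
    -(ExteriorAlgebra.ι ℂ β * ExteriorAlgebra.ι ℂ α) := eq_neg_of_add_eq_zero_left h
  simp [← mul_assoc, h']

lemma scalarPart_wedge (α : Covec n) (x : Ext n) : scalarPart (wedge α x) = 0 := by
  simp [scalarPart, ExteriorAlgebra.algebraMapInv]

lemma delVec_apply (j : Fin n) (α : Covec n) :
    delVec j α = (1 / 2 : ℂ) * (α (ex j) - Complex.I * α (ey j)) := rfl

lemma delbarVec_apply (j : Fin n) (α : Covec n) :
    delbarVec j α = (1 / 2 : ℂ) * (α (ex j) + Complex.I * α (ey j)) := rfl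

lemma delVec_dz (j k : Fin n) : delVec j (dz k) = if j = k then 1 else 0 := by
  rw [delVec_apply]
  by_cases h : j = k
  · subst h
    simp [dz, ex, ey]
    norm_num
  · simp [dz, ex, ey, Pi.single_apply, h, Ne.symm h]

lemma delVec_dzbar (j k : Fin n) : delVec j (dzbar k) = 0 := by
  rw [delVec_apply]
  by_cases h : k = j
  · subst h
    simp [dzbar, ex, ey]
  · simp [dzbar, ex, ey, Pi.single_apply, h]

lemma delbarVec_dz (j k : Fin n) : delbarVec j (dz k) = 0 := by
  rw [delbarVec_apply]
  by_cases h : k = j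
  · subst h
    simp [dz, ex, ey]
  · simp [dz, ex, ey, Pi.single_apply, h]

lemma delbarVec_dzbar (j k : Fin n) : delbarVec j (dzbar k) = if j = k then 1 else 0 := by
  rw [delbarVec_apply]
  by_cases h : j = k
  · subst h
    simp [dzbar, ex, ey]
    norm_num
  · simp [dzbar, ex, ey, Pi.single_apply, h, Ne.symm h]

lemma vector_eq_sum (v : Fin n → ℂ) :
    v = ∑ j, ((v j).re • ex j + (v j).im • ey j) := by
  ext k
  simp only [Finset.sum_apply, Pi.add_apply, Pi.smul_apply, ex, ey]
  rw [Finset.sum_eq_single k]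
  · simp
  · intro j _ hj
    simp [Pi.single_apply, Ne.symm hj]
  · simp

lemma covec_apply (α : Covec n) (v : Fin n → ℂ) :
    α v = ∑ j, (delVec j α * v j + delbarVec j α * conj (v j)) := by
  conv_lhs => rw [vector_eq_sum v]
  simp only [map_sum, map_add, map_smul]
  refine Finset.sum_congr rfl fun j _ => ?_
  rw [delVec_apply, delbarVec_apply]
  apply Complex.ext
  · simp; ring
  · simp; ring

/-- A real-linear functional is the sum of a complex-linear and a conjugate-linear one; `delVec` and
`delbarVec` are the basis dual to `dz`, `dzbar`. -/
lemma covec_eq_sum (α : Covec n) :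
    α = ∑ j, delVec j α • dz j + ∑ j, delbarVec j α • dzbar j := by
  ext v
  rw [covec_apply α v, Finset.sum_add_distrib]
  simp [dz, dzbar]

lemma covec_dual_eq_sum (d : Module.Dual ℂ (Covec n)) :
    d = ∑ j, d (dz j) • delVec j + ∑ j, d (dzbar j) • delbarVec j := by
  ext α
  conv_lhs => rw [covec_eq_sum α]
  simp [mul_comm]

lemma wedge_eq_sum (α : Covec n) :
    wedge α = ∑ j, delVec j α • wedge (dz j) + ∑ j, delbarVec j α • wedge (dzbar j) := by
  refine LinearMap.ext fun x => ?_
  conv_lhs => rw [covec_eq_sum α]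
  simp [Finset.sum_mul, add_mul]

/-- Induction on forms, by multiplication with `dz` and `dz̄` from the left. -/
lemma form_induction {P : Ext n → Prop} (one : P 1) (add : ∀ x y, P x → P y → P (x + y))
    (smul : ∀ (c : ℂ) x, P x → P (c • x)) (hz : ∀ j x, P x → P (wedge (dz j) x))
    (hzb : ∀ j x, P x → P (wedge (dzbar j) x)) (x : Ext n) : P x := by
  have zero : P 0 := by simpa using smul 0 1 one
  have sum : ∀ (f : Fin n → Ext n), (∀ j, P (f j)) → P (∑ j, f j) := fun f hf =>
    Finset.sum_induction _ P add zero (fun j _ => hf j)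
  refine CliffordAlgebra.left_induction _ (fun r => ?_) add (fun x m hx => ?_) x
  · rw [Algebra.algebraMap_eq_smul_one]
    exact smul r 1 one
  · change P (wedge m x)
    rw [wedge_eq_sum]
    simp only [LinearMap.add_apply, LinearMap.sum_apply, LinearMap.smul_apply]
    exact add _ _ (sum _ fun j => smul _ _ (hz j x hx)) (sum _ fun j => smul _ _ (hzb j x hx))

lemma form_induction_wedge {P : Ext n → Prop} (one : P 1) (add : ∀ x y, P x → P y → P (x + y))
    (smul : ∀ (c : ℂ) x, P x → P (c • x)) (hw : ∀ α x, P x → P (wedge α x)) (x : Ext n) : P x :=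
  form_induction one add smul (fun j => hw _) (fun j => hw _) x

/-! ### Iterated contractions -/

/-- Contraction with several vectors, the first vector of the list first. -/
abbrev contractList (φ : Ext n) (l : List (Module.Dual ℂ (Covec n))) : Ext n :=
  l.foldl (fun a d => CliffordAlgebra.contractLeft d a) φ

lemma contractList_zero (l : List (Module.Dual ℂ (Covec n))) : contractList 0 l = 0 := by
  induction l with
  | nil => rfl
  | cons d l ih => simpa [contractList] using ih

lemma contractList_add (x y : Ext n) (l : List (Module.Dual ℂ (Covec n))) :
    contractList (x + y) l = contractList x l + contractList y l := by
  induction l generalizing x y with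
  | nil => rfl
  | cons d l ih => simpa [contractList] using ih (contract d x) (contract d y)

lemma contractList_smul (c : ℂ) (x : Ext n) (l : List (Module.Dual ℂ (Covec n))) :
    contractList (c • x) l = c • contractList x l := by
  induction l generalizing x with
  | nil => rfl
  | cons d l ih => simpa [contractList] using ih (contract d x)

lemma contractList_neg (x : Ext n) (l : List (Module.Dual ℂ (Covec n))) :
    contractList (-x) l = -contractList x l := by
  simpa using contractList_smul (-1) x l

lemma contractList_cons (d : Module.Dual ℂ (Covec n)) (x : Ext n)
    (l : List (Module.Dual ℂ (Covec n))) :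
    contractList x (d :: l) = contractList (contract d x) l := rfl

/-- Contractions anticommute, so the repeated vector can be moved next to its copy, where the two
give zero. -/
lemma contractList_contract_of_mem {d : Module.Dual ℂ (Covec n)}
    {l : List (Module.Dual ℂ (Covec n))} (h : d ∈ l) (x : Ext n) :
    contractList (contract d x) l = 0 := by
  induction l generalizing x with
  | nil => simp at h
  | cons d' l ih =>
    rw [contractList_cons]
    rcases List.mem_cons.1 h with rfl | h
    · rw [contract_contract, contractList_zero]
    · rw [contract_comm, contractList_neg, ih h, neg_zero]

lemma contractList_of_not_nodup {l : List (Module.Dual ℂ (Covec n))} (h : ¬ l.Nodup) (x : Ext n) :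
    contractList x l = 0 := by
  induction l generalizing x with
  | nil => simp at h
  | cons d l ih =>
    rw [contractList_cons]
    by_cases hd : d ∈ l
    · exact contractList_contract_of_mem hd x
    · exact ih (fun h' => h (List.nodup_cons.2 ⟨hd, h'⟩)) _

/-- The value on a list of tangent vectors, as a linear functional. -/
def evalOnₗ (l : List (Module.Dual ℂ (Covec n))) : Ext n →ₗ[ℂ] ℂ where
  toFun φ := evalOn φ l
  map_add' x y := by
    rw [evalOn, evalOn, evalOn, ← map_add]; exact congrArg _ (contractList_add x y l)
  map_smul' c x := by
    rw [evalOn, evalOn, RingHom.id_apply, ← map_smul]; exact congrArg _ (contractList_smul c x l)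

lemma evalOnₗ_apply (l : List (Module.Dual ℂ (Covec n))) (φ : Ext n) :
    evalOnₗ l φ = evalOn φ l := rfl

/-- A component, as a linear functional. -/
def componentₗ {p q : ℕ} (J : Fin p → Fin n) (K : Fin q → Fin n) : Ext n →ₗ[ℂ] ℂ :=
  evalOnₗ (List.ofFn (fun a => delVec (J a)) ++ List.ofFn (fun b => delbarVec (K b)))

lemma componentₗ_apply {p q : ℕ} (J : Fin p → Fin n) (K : Fin q → Fin n) (φ : Ext n) :
    componentₗ J K φ = component φ J K := rfl

lemma component_cons_left {p q : ℕ} (φ : Ext n) (j : Fin n) (J : Fin p → Fin n)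
    (K : Fin q → Fin n) :
    component φ (Fin.cons j J : Fin (p + 1) → Fin n) K = component (contract (delVec j) φ) J K := by
  simp [component, evalOn, List.ofFn_succ]

lemma component_cons_right {q : ℕ} (φ : Ext n) (J : Fin 0 → Fin n) (k : Fin n)
    (K : Fin q → Fin n) :
    component φ J (Fin.cons k K : Fin (q + 1) → Fin n) =
      component (contract (delbarVec k) φ) J K := by
  simp [component, evalOn, List.ofFn_succ]

lemma component_empty (φ : Ext n) (J : Fin 0 → Fin n) (K : Fin 0 → Fin n) :
    component φ J K = scalarPart φ := by
  simp [component, evalOn]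

/-- By the pigeonhole principle an index repeats. This is why sums over p, q ≤ n lose nothing. -/
lemma component_eq_zero_of_lt_left {p q : ℕ} (hp : n < p) (φ : Ext n) (J : Fin p → Fin n)
    (K : Fin q → Fin n) : component φ J K = 0 := by
  rw [component, evalOn]
  have h : contractList φ (List.ofFn (fun a => delVec (J a)) ++
      List.ofFn (fun b => delbarVec (K b))) = 0 := by
    refine contractList_of_not_nodup (fun h => ?_) φ
    have h2 := List.nodup_ofFn.1 (List.Nodup.of_append_left h)
    have h3 : Function.Injective J := fun a b hab => h2 (by simp [hab])
    have := Fintype.card_le_of_injective J h3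
    simp at this
    omega
  rw [contractList] at h
  rw [h, map_zero]

lemma component_eq_zero_of_lt_right {p q : ℕ} (hq : n < q) (φ : Ext n) (J : Fin p → Fin n)
    (K : Fin q → Fin n) : component φ J K = 0 := by
  rw [component, evalOn]
  have h : contractList φ (List.ofFn (fun a => delVec (J a)) ++
      List.ofFn (fun b => delbarVec (K b))) = 0 := by
    refine contractList_of_not_nodup (fun h => ?_) φ
    have h2 := List.nodup_ofFn.1 (List.Nodup.of_append_right h)
    have h3 : Function.Injective K := fun a b hab => h2 (by simp [hab])
    have := Fintype.card_le_of_injective K h3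
    simp at this
    omega
  rw [contractList] at h
  rw [h, map_zero]

/-! ### Sums over components -/

section ComponentSum

variable {V W : Type*} [AddCommGroup V] [AddCommGroup W] [Module ℂ W]

/-- The sum over all components of type `(p, q)`, paired with a family of operators. -/
def typedSum (X Y : Fin n → V →+ V) (w : V →+ W) (p q : ℕ) (φ : Ext n) (v : V) : W :=
  ((p.factorial * q.factorial : ℂ)⁻¹) • ∑ J : Fin p → Fin n, ∑ K : Fin q → Fin n,
    component φ J K • w ((List.ofFn K).foldl (fun v k => Y k v)
      ((List.ofFn J).foldl (fun v j => X j v) v))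

/-- The sum over all components, paired with a family of operators. -/
def totalSum (X Y : Fin n → V →+ V) (w : V →+ W) (φ : Ext n) (v : V) : W :=
  ∑ p ∈ Finset.range (n + 1), ∑ q ∈ Finset.range (n + 1), typedSum X Y w p q φ v

variable (X Y : Fin n → V →+ V) (w : V →+ W)

lemma foldl_addHom_add {ι : Type*} (Z : ι → V →+ V) (l : List ι) (u v : V) :
    l.foldl (fun v k => Z k v) (u + v) =
      l.foldl (fun v k => Z k v) u + l.foldl (fun v k => Z k v) v := by
  induction l generalizing u v with
  | nil => rfl
  | cons i l ih => simp [ih]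

lemma typedSum_add_left (p q : ℕ) (φ ψ : Ext n) (v : V) :
    typedSum X Y w p q (φ + ψ) v = typedSum X Y w p q φ v + typedSum X Y w p q ψ v := by
  simp only [typedSum, ← componentₗ_apply, map_add, add_smul, Finset.sum_add_distrib, smul_add]

lemma typedSum_smul_left (p q : ℕ) (c : ℂ) (φ : Ext n) (v : V) :
    typedSum X Y w p q (c • φ) v = c • typedSum X Y w p q φ v := by
  simp only [typedSum, ← componentₗ_apply, map_smul, smul_eq_mul, mul_smul, Finset.smul_sum]
  simp only [smul_smul]
  refine Finset.sum_congr rfl fun J _ => Finset.sum_congr rfl fun K _ => ?_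
  congr 1
  ring

lemma typedSum_zero_left (p q : ℕ) (v : V) : typedSum X Y w p q 0 v = 0 := by
  simpa using typedSum_smul_left X Y w p q 0 0 v

lemma typedSum_neg_left (p q : ℕ) (φ : Ext n) (v : V) :
    typedSum X Y w p q (-φ) v = -typedSum X Y w p q φ v := by
  simpa using typedSum_smul_left X Y w p q (-1) φ v

lemma typedSum_add_right (p q : ℕ) (φ : Ext n) (u v : V) :
    typedSum X Y w p q φ (u + v) = typedSum X Y w p q φ u + typedSum X Y w p q φ v := by
  simp only [typedSum, foldl_addHom_add, map_add, Finset.sum_add_distrib, smul_add]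

lemma typedSum_neg_right (p q : ℕ) (φ : Ext n) (v : V) :
    typedSum X Y w p q φ (-v) = -typedSum X Y w p q φ v :=
  map_neg (⟨⟨fun v => typedSum X Y w p q φ v, by simpa using typedSum_add_right X Y w p q φ 0 0⟩,
    typedSum_add_right X Y w p q φ⟩ : V →+ W) v

lemma typedSum_succ_left (p q : ℕ) (φ : Ext n) (v : V) :
    typedSum X Y w (p + 1) q φ v =
      ((p + 1 : ℂ)⁻¹) • ∑ j, typedSum X Y w p q (contract (delVec j) φ) (X j v) := by
  simp only [typedSum]
  rw [← (Fin.consEquiv (fun _ => Fin n)).sum_comp, Fintype.sum_prod_type, ← Finset.smul_sum,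
    smul_smul]
  congr 1
  · rw [Nat.factorial_succ]; push_cast; simp only [mul_inv]; ring
  · refine Finset.sum_congr rfl fun j _ => Finset.sum_congr rfl fun J _ =>
      Finset.sum_congr rfl fun K _ => ?_
    simp only [Fin.consEquiv, Equiv.coe_fn_mk]
    rw [component_cons_left]
    simp [List.ofFn_succ]

lemma typedSum_succ_right (q : ℕ) (φ : Ext n) (v : V) :
    typedSum X Y w 0 (q + 1) φ v =
      ((q + 1 : ℂ)⁻¹) • ∑ k, typedSum X Y w 0 q (contract (delbarVec k) φ) (Y k v) := by
  simp only [typedSum, Finset.univ_unique, Finset.sum_singleton]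
  rw [← (Fin.consEquiv (fun _ => Fin n)).sum_comp, Fintype.sum_prod_type, ← Finset.smul_sum,
    smul_smul]
  congr 1
  · rw [Nat.factorial_succ]; push_cast; simp only [mul_inv]; ring
  · refine Finset.sum_congr rfl fun j _ => Finset.sum_congr rfl fun K _ => ?_
    simp only [Fin.consEquiv, Equiv.coe_fn_mk]
    rw [component_cons_right]
    simp [List.ofFn_succ]

lemma typedSum_zero_zero (φ : Ext n) (v : V) :
    typedSum X Y w 0 0 φ v = scalarPart φ • w v := by
  simp [typedSum, component_empty]

lemma typedSum_wedge_dz_zero (j : Fin n) (q : ℕ) (φ : Ext n) (v : V) :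
    typedSum X Y w 0 q (wedge (dz j) φ) v = 0 := by
  induction q generalizing φ v with
  | zero => rw [typedSum_zero_zero, scalarPart_wedge, zero_smul]
  | succ q ih =>
    rw [typedSum_succ_right]
    simp only [contract_wedge, delbarVec_dz, zero_smul, zero_sub, typedSum_neg_left, ih, neg_zero,
      Finset.sum_const_zero, smul_zero]

lemma typedSum_wedge_dzbar_zero (j : Fin n) (p : ℕ) (φ : Ext n) (v : V) :
    typedSum X Y w p 0 (wedge (dzbar j) φ) v = 0 := by
  induction p generalizing φ v with
  | zero => rw [typedSum_zero_zero, scalarPart_wedge, zero_smul]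
  | succ q ih =>
    rw [typedSum_succ_left]
    simp only [contract_wedge, delVec_dzbar, zero_smul, zero_sub, typedSum_neg_left, ih, neg_zero,
      Finset.sum_const_zero, smul_zero]

/-- The index j can sit in any of the p + 1 holomorphic places. Since the X anticommute, just as
contractions do, each place contributes the same, and their number cancels the extra factor in (p +
1)!. Both the monomial expansion of a form and the pairing are sums of this kind, so this one shift
rule serves for both. -/
lemma typedSum_wedge_dz (hX : ∀ i j v, X i (X j v) = -X j (X i v)) (j : Fin n) (p q : ℕ)
    (φ : Ext n) (v : V) :
    typedSum X Y w (p + 1) q (wedge (dz j) φ) v = typedSum X Y w p q φ (X j v) := by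
  induction p generalizing φ v with
  | zero =>
    rw [typedSum_succ_left]
    simp only [contract_wedge, delVec_dz, sub_eq_add_neg, typedSum_add_left, typedSum_neg_left,
      typedSum_wedge_dz_zero, neg_zero, add_zero, typedSum_smul_left]
    simp
  | succ p ih =>
    rw [typedSum_succ_left]
    simp only [contract_wedge, delVec_dz, sub_eq_add_neg, typedSum_add_left, typedSum_neg_left,
      typedSum_smul_left, ih, Finset.sum_add_distrib]
    simp only [ite_smul, zero_smul, one_smul, Finset.sum_ite_eq', Finset.mem_univ, if_true, hX j, ← typedSum_neg_right]
    -- One term comes from contracting dzⱼ itself; these are the other p + 1, reassembled by the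
    -- recursion for the sum.
    have h : ∑ i, typedSum X Y w p q (contract (delVec i) φ) (- -(X i) (X j v)) =
        (p + 1 : ℂ) • typedSum X Y w (p + 1) q φ (X j v) := by
      rw [typedSum_succ_left, smul_smul, mul_inv_cancel₀ (by positivity), one_smul]
      simp only [neg_neg]
    rw [h, ← one_smul ℂ (typedSum X Y w (p + 1) q φ (X j v)), smul_smul, ← add_smul, smul_smul]
    congr 1
    have : ((p : ℂ) + 1 + 1) ≠ 0 := by positivity
    push_cast
    field_simp
    ring

lemma typedSum_wedge_dzbar (hY : ∀ i j v, Y i (Y j v) = -Y j (Y i v))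
    (hXY : ∀ i j v, X i (Y j v) = -Y j (X i v)) (j : Fin n) (p q : ℕ)
    (φ : Ext n) (v : V) :
    typedSum X Y w p (q + 1) (wedge (dzbar j) φ) v = typedSum X Y w p q φ (Y j v) := by
  induction p generalizing φ v with
  | zero =>
    induction q generalizing φ v with
    | zero =>
      rw [typedSum_succ_right]
      simp only [contract_wedge, delbarVec_dzbar, sub_eq_add_neg, typedSum_add_left,
        typedSum_neg_left, typedSum_wedge_dzbar_zero, neg_zero, add_zero, typedSum_smul_left]
      simp
    | succ p ih =>
      rw [typedSum_succ_right]
      simp only [contract_wedge, delbarVec_dzbar, sub_eq_add_neg, typedSum_add_left,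
        typedSum_neg_left, typedSum_smul_left, ih,
        Finset.sum_add_distrib]
      simp only [ite_smul, zero_smul, one_smul, Finset.sum_ite_eq', Finset.mem_univ, if_true, hY j, ← typedSum_neg_right]
      have h : ∑ i, typedSum X Y w 0 p (contract (delbarVec i) φ) (- -(Y i) (Y j v)) =
          (p + 1 : ℂ) • typedSum X Y w 0 (p + 1) φ (Y j v) := by
        rw [typedSum_succ_right, smul_smul, mul_inv_cancel₀ (by positivity), one_smul]
        simp only [neg_neg]
      rw [h, ← one_smul ℂ (typedSum X Y w 0 (p + 1) φ (Y j v)), smul_smul, ← add_smul, smul_smul]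
      congr 1
      have : ((p : ℂ) + 1 + 1) ≠ 0 := by positivity
      push_cast
      field_simp
      ring
  | succ p ih =>
    -- Passing a holomorphic index over dz̄ⱼ costs one sign in the contraction and one in exchanging
    -- X with Y; the two cancel.
    rw [typedSum_succ_left, typedSum_succ_left]
    simp only [contract_wedge, delVec_dzbar, zero_smul, zero_sub, typedSum_neg_left, ih]
    simp only [hXY, typedSum_neg_right]

lemma typedSum_eq_zero_of_lt_left {p : ℕ} (hp : n < p) (q : ℕ) (φ : Ext n) (v : V) :
    typedSum X Y w p q φ v = 0 := by
  simp [typedSum, component_eq_zero_of_lt_left hp]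

lemma typedSum_eq_zero_of_lt_right (p : ℕ) {q : ℕ} (hq : n < q) (φ : Ext n) (v : V) :
    typedSum X Y w p q φ v = 0 := by
  simp [typedSum, component_eq_zero_of_lt_right hq]

lemma totalSum_wedge_dz (hX : ∀ i j v, X i (X j v) = -X j (X i v)) (j : Fin n)
    (φ : Ext n) (v : V) :
    totalSum X Y w (wedge (dz j) φ) v = totalSum X Y w φ (X j v) := by
  rw [totalSum, totalSum, Finset.sum_range_succ',
    Finset.sum_range_succ (fun p => ∑ q ∈ Finset.range (n + 1), typedSum X Y w p q φ (X j v))]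
  simp only [typedSum_wedge_dz_zero, typedSum_wedge_dz X Y w hX, Finset.sum_const_zero]
  -- The shift p ↦ p + 1 leaves the term p = n over; it equals a sum of type (n + 1, q), which
  -- vanishes.
  have h : ∀ q, typedSum X Y w n q φ (X j v) = 0 := fun q => by
    rw [← typedSum_wedge_dz X Y w hX, typedSum_eq_zero_of_lt_left X Y w (Nat.lt_succ_self n)]
  simp only [h, Finset.sum_const_zero]

lemma totalSum_wedge_dzbar (hY : ∀ i j v, Y i (Y j v) = -Y j (Y i v))
    (hXY : ∀ i j v, X i (Y j v) = -Y j (X i v)) (j : Fin n) (φ : Ext n) (v : V) :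
    totalSum X Y w (wedge (dzbar j) φ) v = totalSum X Y w φ (Y j v) := by
  rw [totalSum, totalSum]
  refine Finset.sum_congr rfl fun p _ => ?_
  rw [Finset.sum_range_succ', Finset.sum_range_succ]
  simp only [typedSum_wedge_dzbar_zero, typedSum_wedge_dzbar X Y w hY hXY]
  congr 1
  rw [← typedSum_wedge_dzbar X Y w hY hXY,
    typedSum_eq_zero_of_lt_right X Y w p (Nat.lt_succ_self n)]

lemma totalSum_one (v : V) : totalSum X Y w (1 : Ext n) v = w v := by
  rw [totalSum, Finset.sum_range_succ', Finset.sum_range_succ']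
  have h1 : ∀ p q, typedSum X Y w (p + 1) q (1 : Ext n) v = 0 := fun p q => by
    rw [typedSum_succ_left]
    simp only [contract_one, typedSum_zero_left, Finset.sum_const_zero, smul_zero]
  have h2 : ∀ q, typedSum X Y w 0 (q + 1) (1 : Ext n) v = 0 := fun q => by
    rw [typedSum_succ_right]
    simp only [contract_one, typedSum_zero_left, Finset.sum_const_zero, smul_zero]
  simp only [h1, h2, typedSum_zero_zero, Finset.sum_const_zero]
  simp

lemma totalSum_add_left (φ ψ : Ext n) (v : V) :
    totalSum X Y w (φ + ψ) v = totalSum X Y w φ v + totalSum X Y w ψ v := by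
  simp only [totalSum, typedSum_add_left, Finset.sum_add_distrib]

lemma totalSum_smul_left (c : ℂ) (φ : Ext n) (v : V) :
    totalSum X Y w (c • φ) v = c • totalSum X Y w φ v := by
  simp only [totalSum, typedSum_smul_left, Finset.smul_sum]

end ComponentSum

lemma foldl_mul_eq {ι : Type*} (f : ι → Ext n) (l : List ι) (v : Ext n) :
    l.foldl (fun v j => v * f j) v = v * (l.map f).prod := by
  induction l generalizing v with
  | nil => simp
  | cons i l ih => simp [ih, mul_assoc]

/-- A form is the sum of its components. -/
theorem form_eq_sum_component (φ : Ext n) :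
    φ = ∑ p ∈ Finset.range (n + 1), ∑ q ∈ Finset.range (n + 1),
      ((p.factorial * q.factorial : ℂ)⁻¹) •
        ∑ J : Fin p → Fin n, ∑ K : Fin q → Fin n, component φ J K • monomial J K := by
  -- With right multiplications as the anticommuting operators, the sum over components sends v to v
  -- * φ, which is proved by induction on φ; then v = 1.
  let R : Covec n → Ext n →+ Ext n := fun α => AddMonoidHom.mulRight (ExteriorAlgebra.ι ℂ α)
  have hR : ∀ α β v, R α (R β v) = -R β (R α v) := fun α β v => by
    have h := ExteriorAlgebra.ι_add_mul_swap (R := ℂ) β α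
    simp only [R, AddMonoidHom.coe_mulRight, mul_assoc]
    rw [eq_neg_of_add_eq_zero_left h, mul_neg]
  have key : ∀ v, totalSum (fun j => R (dz j)) (fun k => R (dzbar k)) (AddMonoidHom.id _) φ v =
      v * φ := by
    induction φ using form_induction with
    | one => intro v; simp [totalSum_one]
    | add x y hx hy => intro v; rw [totalSum_add_left, hx, hy, mul_add]
    | smul c x hx => intro v; rw [totalSum_smul_left, hx, mul_smul_comm]
    | hz j x hx =>
      intro v
      rw [totalSum_wedge_dz _ _ _ (fun i j v => hR _ _ v), hx]
      simp [R, mul_assoc]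
    | hzb j x hx =>
      intro v
      rw [totalSum_wedge_dzbar _ _ _ (fun i j v => hR _ _ v) (fun i j v => hR _ _ v), hx]
      simp [R, mul_assoc]
  have h := (key 1).symm
  rw [one_mul, totalSum] at h
  conv_lhs => rw [h]
  refine Finset.sum_congr rfl fun p _ => Finset.sum_congr rfl fun q _ => ?_
  rw [typedSum]
  congr 1
  refine Finset.sum_congr rfl fun J _ => Finset.sum_congr rfl fun K _ => ?_
  congr 1
  simp only [R, AddMonoidHom.coe_mulRight, AddMonoidHom.id_apply]
  rw [foldl_mul_eq (fun k => ExteriorAlgebra.ι ℂ (dzbar k)),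
    foldl_mul_eq (fun k => ExteriorAlgebra.ι ℂ (dz k)), one_mul, monomial, List.map_ofFn,
    List.map_ofFn]
  rfl

lemma span_monomial_eq_top :
    Submodule.span ℂ (⋃ p ∈ Finset.range (n + 1), ⋃ q ∈ Finset.range (n + 1),
      Set.range fun JK : (Fin p → Fin n) × (Fin q → Fin n) => monomial JK.1 JK.2) = ⊤ := by
  refine eq_top_iff.2 fun φ _ => ?_
  rw [form_eq_sum_component φ]
  refine Submodule.sum_mem _ fun p hp => Submodule.sum_mem _ fun q hq => Submodule.smul_mem _ _ ?_
  refine Submodule.sum_mem _ fun J _ => Submodule.sum_mem _ fun K _ => Submodule.smul_mem _ _ ?_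
  refine Submodule.subset_span ?_
  simp only [Set.mem_iUnion]
  exact ⟨p, hp, q, hq, (J, K), rfl⟩

/-- Finite dimension is what later provides a norm on forms, so that form-valued functions can be
differentiated. -/
instance finiteDimensional_ext : FiniteDimensional ℂ (Ext n) := by
  refine Module.Finite.of_fg_top ?_
  rw [← span_monomial_eq_top]
  refine Submodule.fg_span ?_
  refine Set.Finite.biUnion (Finset.finite_toSet _) fun p _ => ?_
  exact Set.Finite.biUnion (Finset.finite_toSet _) fun q _ => Set.finite_range _

/-- A form is zero if all its components are. -/
lemma eq_zero_of_component {φ : Ext n}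
    (h : ∀ (p q : ℕ) (J : Fin p → Fin n) (K : Fin q → Fin n), component φ J K = 0) : φ = 0 := by
  rw [form_eq_sum_component φ]
  simp [h]

/-! ### Complex conjugation -/

/-- The ring of forms, with the conjugate complex structure. -/
def ConjExt (n : ℕ) : Type := Ext n

instance : Ring (ConjExt n) := inferInstanceAs (Ring (Ext n))

/-- The universal property of the exterior algebra produces complex-linear maps only; letting
scalars act through their conjugates turns complex conjugation of forms into one. -/
instance : Algebra ℂ (ConjExt n) :=
  RingHom.toAlgebra' ((algebraMap ℂ (Ext n)).comp (starRingEnd ℂ)) fun c x =>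
    Algebra.commutes (R := ℂ) (A := Ext n) (conj c) x

/-- The identity, as an isomorphism onto the conjugate algebra. -/
def toConjExt : Ext n ≃+* ConjExt n := RingEquiv.refl (Ext n)

lemma smul_toConjExt (c : ℂ) (x : Ext n) : c • toConjExt x = toConjExt (conj c • x) := by
  rw [Algebra.smul_def, Algebra.smul_def, map_mul]
  rfl

/-- The complex conjugate of a covector. -/
def conjCovec (α : Covec n) : Covec n := (Complex.conjCLE : ℂ →L[ℝ] ℂ).comp α

@[simp] lemma conjCovec_apply (α : Covec n) (v : Fin n → ℂ) : conjCovec α v = conj (α v) := rfl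

lemma conjCovec_add (α β : Covec n) : conjCovec (α + β) = conjCovec α + conjCovec β := by
  ext v; simp

lemma conjCovec_smul (c : ℂ) (α : Covec n) : conjCovec (c • α) = conj c • conjCovec α := by
  ext v; simp

/-- Complex conjugation, as an algebra homomorphism to the conjugate algebra. -/
def conjAlg : Ext n →ₐ[ℂ] ConjExt n :=
  ExteriorAlgebra.lift ℂ
    ⟨{ toFun := fun α => toConjExt (ExteriorAlgebra.ι ℂ (conjCovec α))
       map_add' := fun α β => by rw [conjCovec_add, map_add, map_add]
       map_smul' := fun c α => by rw [conjCovec_smul, map_smul, RingHom.id_apply, smul_toConjExt] },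
     fun α => by
      change toConjExt _ * toConjExt _ = 0
      rw [← map_mul, ExteriorAlgebra.ι_sq_zero, map_zero]⟩

/-- Complex conjugation of forms, as a ring homomorphism. -/
def conjExt : Ext n →+* Ext n :=
  (toConjExt (n := n)).symm.toRingHom.comp (conjAlg (n := n)).toRingHom

lemma conjExt_ι (α : Covec n) :
    conjExt (ExteriorAlgebra.ι ℂ α) = ExteriorAlgebra.ι ℂ (conjCovec α) := by
  change toConjExt.symm (conjAlg (ExteriorAlgebra.ι ℂ α)) = _
  rw [conjAlg, ExteriorAlgebra.lift_ι_apply]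
  exact toConjExt.symm_apply_apply _

lemma conjExt_algebraMap (c : ℂ) :
    conjExt (algebraMap ℂ (Ext n) c) = algebraMap ℂ (Ext n) (conj c) := by
  change toConjExt.symm (conjAlg (algebraMap ℂ (Ext n) c)) = _
  rw [AlgHom.commutes]
  rfl

lemma conjExt_smul (c : ℂ) (x : Ext n) : conjExt (c • x) = conj c • conjExt x := by
  rw [Algebra.smul_def, map_mul, conjExt_algebraMap, ← Algebra.smul_def]

lemma conjExt_wedge (α : Covec n) (x : Ext n) :
    conjExt (wedge α x) = wedge (conjCovec α) (conjExt x) := by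
  simp [conjExt_ι]

lemma conjCovec_dz (j : Fin n) : conjCovec (dz j) = dzbar j := rfl

lemma conjCovec_conjCovec (α : Covec n) : conjCovec (conjCovec α) = α := by ext v; simp

lemma conjCovec_dzbar (j : Fin n) : conjCovec (dzbar j) = dz j := by
  rw [← conjCovec_dz, conjCovec_conjCovec]

lemma conjExt_conjExt (x : Ext n) : conjExt (conjExt x) = x := by
  induction x using form_induction_wedge with
  | one => simp
  | add x y hx hy => rw [map_add, map_add, hx, hy]
  | smul c x hx => rw [conjExt_smul, conjExt_smul, hx, Complex.conj_conj]
  | hw α x hx => rw [conjExt_wedge, conjExt_wedge, hx, conjCovec_conjCovec]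

lemma conjExt_monomial {p q : ℕ} (J : Fin p → Fin n) (K : Fin q → Fin n) :
    conjExt (monomial J K) = monomialConj J K := by
  simp only [monomial, monomialConj, map_mul, map_list_prod, List.map_ofFn]
  congr 3
  · ext a
    simp [conjExt_ι, conjCovec_dz]
  · ext a
    simp [conjExt_ι, conjCovec_dzbar]

/-- Apply the ring homomorphism to the monomial expansion. Afterwards conjugation can be handled by
induction on wedges instead of components. -/
theorem conjForm_eq (φ : Ext n) : conjForm φ = conjExt φ := by
  conv_rhs => rw [form_eq_sum_component φ]
  simp only [map_sum, conjExt_smul, conjExt_monomial, conjForm]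
  simp

lemma delVec_conjCovec (j : Fin n) (α : Covec n) :
    delVec j (conjCovec α) = conj (delbarVec j α) := by
  simp only [delVec_apply, delbarVec_apply, conjCovec_apply, map_mul, map_add, Complex.conj_I,
    map_div₀, map_one, Complex.conj_ofNat]
  ring

lemma delbarVec_conjCovec (j : Fin n) (α : Covec n) :
    delbarVec j (conjCovec α) = conj (delVec j α) := by
  simp only [delVec_apply, delbarVec_apply, conjCovec_apply, map_mul, map_sub, Complex.conj_I,
    map_div₀, map_one, Complex.conj_ofNat]
  ring

lemma conjExt_contract_delVec (j : Fin n) (x : Ext n) :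
    conjExt (contract (delVec j) x) = contract (delbarVec j) (conjExt x) := by
  induction x using form_induction_wedge with
  | one => simp
  | add x y hx hy => simp only [map_add, hx, hy]
  | smul c x hx => simp only [conjExt_smul, map_smul, hx]
  | hw α x hx =>
    rw [contract_wedge, conjExt_wedge, contract_wedge, map_sub, conjExt_smul, conjExt_wedge, hx,
      delbarVec_conjCovec]

lemma conjExt_contract_delbarVec (j : Fin n) (x : Ext n) :
    conjExt (contract (delbarVec j) x) = contract (delVec j) (conjExt x) := by
  rw [← conjExt_conjExt x, ← conjExt_contract_delVec, conjExt_conjExt, conjExt_conjExt]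

lemma scalarPart_conjExt (x : Ext n) : scalarPart (conjExt x) = conj (scalarPart x) := by
  induction x using form_induction_wedge with
  | one => simp
  | add x y hx hy => simp only [map_add, hx, hy]
  | smul c x hx => simp only [conjExt_smul, map_smul, hx, smul_eq_mul, map_mul]
  | hw α x hx => rw [conjExt_wedge, scalarPart_wedge, scalarPart_wedge, map_zero]

/-! ### The pairing -/

/-- The pairing-adjoint of `dzⱼ ∧ ·`. -/
def sharpZ (η : Ext n) (j : Fin n) : Module.End ℂ (Ext n) :=
  ∑ r, conj ((matrixOf η)⁻¹ r j) • contract (delVec r)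

/-- The pairing-adjoint of `dz̄ₖ ∧ ·`. -/
def sharpZbar (η : Ext n) (k : Fin n) : Module.End ℂ (Ext n) :=
  ∑ s, conj ((matrixOf η)⁻¹ k s) • contract (delbarVec s)

lemma sharpZ_apply (η : Ext n) (j : Fin n) (x : Ext n) :
    sharpZ η j x = ∑ r, conj ((matrixOf η)⁻¹ r j) • contract (delVec r) x := by
  simp only [sharpZ, LinearMap.sum_apply, LinearMap.smul_apply]

lemma sharpZbar_apply (η : Ext n) (j : Fin n) (x : Ext n) :
    sharpZbar η j x = ∑ r, conj ((matrixOf η)⁻¹ j r) • contract (delbarVec r) x := by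
  simp only [sharpZbar, LinearMap.sum_apply, LinearMap.smul_apply]

lemma sum_contract_comm {ι κ : Type*} [Fintype ι] [Fintype κ] (a : ι → ℂ) (b : κ → ℂ)
    (d : ι → Module.Dual ℂ (Covec n)) (d' : κ → Module.Dual ℂ (Covec n)) (x : Ext n) :
    ∑ r, a r • contract (d r) (∑ s, b s • contract (d' s) x) =
      -∑ s, b s • contract (d' s) (∑ r, a r • contract (d r) x) := by
  simp only [map_sum, map_smul, Finset.smul_sum]
  rw [Finset.sum_comm, ← Finset.sum_neg_distrib]
  refine Finset.sum_congr rfl fun s _ => ?_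
  rw [← Finset.sum_neg_distrib]
  refine Finset.sum_congr rfl fun r _ => ?_
  rw [contract_comm, smul_neg, smul_neg, smul_comm]

lemma component_sum_left {p q : ℕ} (a : Fin n → ℂ) (x : Ext n) (J : Fin p → Fin n)
    (K : Fin q → Fin n) : component (∑ r, a r • contract (delVec r) x) J K =
      ∑ r, a r * component x (Fin.cons r J : Fin (p + 1) → Fin n) K := by
  rw [← componentₗ_apply, map_sum]
  refine Finset.sum_congr rfl fun r _ => ?_
  rw [component_cons_left, map_smul, smul_eq_mul, componentₗ_apply]

lemma component_sum_right {q : ℕ} (a : Fin n → ℂ) (x : Ext n) (J : Fin 0 → Fin n)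
    (K : Fin q → Fin n) : component (∑ r, a r • contract (delbarVec r) x) J K =
      ∑ r, a r * component x J (Fin.cons r K : Fin (q + 1) → Fin n) := by
  rw [← componentₗ_apply, map_sum]
  refine Finset.sum_congr rfl fun r _ => ?_
  rw [component_cons_right, map_smul, smul_eq_mul, componentₗ_apply]

/-- Each sharp is a contraction weighted by one entry of the inverse matrix, so iterating them
produces exactly the inner double sum over R and S in the definition of the pairing, up to
conjugation. -/
lemma scalarPart_foldl_sharp (η : Ext n) {p q : ℕ} (J : Fin p → Fin n) (K : Fin q → Fin n)
    (ψ : Ext n) :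
    scalarPart ((List.ofFn K).foldl (fun v k => sharpZbar η k v)
      ((List.ofFn J).foldl (fun v j => sharpZ η j v) ψ)) =
    ∑ R : Fin p → Fin n, ∑ S : Fin q → Fin n,
      (∏ a, conj ((matrixOf η)⁻¹ (R a) (J a))) * (∏ b, conj ((matrixOf η)⁻¹ (K b) (S b))) *
        component ψ R S := by
  induction p generalizing ψ with
  | zero =>
    induction q generalizing ψ with
    | zero => simp [component_empty]
    | succ q ih =>
      rw [List.ofFn_succ]
      simp only [List.ofFn_zero, List.foldl_nil, List.foldl_cons]
      have h := ih (fun b => K b.succ) (sharpZbar η (K 0) ψ)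
      simp only [List.ofFn_zero, List.foldl_nil] at h
      rw [h]
      simp only [Finset.univ_unique, Finset.sum_singleton]
      conv_rhs => rw [← (Fin.consEquiv (fun _ => Fin n)).sum_comp, Fintype.sum_prod_type,
        Finset.sum_comm]
      refine Finset.sum_congr rfl fun S _ => ?_
      rw [sharpZbar_apply, component_sum_right, Finset.mul_sum]
      refine Finset.sum_congr rfl fun s _ => ?_
      simp [Fin.consEquiv, Fin.prod_univ_succ]
      ring
  | succ p ih =>
    rw [List.ofFn_succ (f := J)]
    simp only [List.foldl_cons]
    rw [ih (fun b => J b.succ) (sharpZ η (J 0) ψ)]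
    conv_rhs => rw [← (Fin.consEquiv (fun _ => Fin n)).sum_comp, Fintype.sum_prod_type,
      Finset.sum_comm]
    refine Finset.sum_congr rfl fun R _ => ?_
    rw [Finset.sum_comm]
    refine Finset.sum_congr rfl fun S _ => ?_
    rw [sharpZ_apply, component_sum_left, Finset.mul_sum]
    refine Finset.sum_congr rfl fun s _ => ?_
    simp [Fin.consEquiv, Fin.prod_univ_succ]
    ring

/-- The conjugate of the scalar part, as an additive map. -/
def conjScalarPart : Ext n →+ ℂ :=
  (starRingEnd ℂ).toAddMonoidHom.comp (scalarPart (n := n)).toRingHom.toAddMonoidHom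

/-- In this form a wedge on the left argument moves to a sharp on the right one, and statements
about the pairing follow by induction on φ without touching components. -/
lemma pairing_eq_totalSum (η φ ψ : Ext n) :
    pairing η φ ψ = totalSum (fun j => (sharpZ η j).toAddMonoidHom)
      (fun k => (sharpZbar η k).toAddMonoidHom) conjScalarPart φ ψ := by
  simp only [pairing, totalSum, typedSum]
  refine Finset.sum_congr rfl fun p _ => Finset.sum_congr rfl fun q _ => ?_
  rw [smul_eq_mul]
  congr 1
  refine Finset.sum_congr rfl fun J _ => ?_
  rw [Finset.sum_comm]
  refine Finset.sum_congr rfl fun K _ => ?_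
  have h := scalarPart_foldl_sharp η J K ψ
  change _ = component φ J K • conj (scalarPart ((List.ofFn K).foldl (fun v k => sharpZbar η k v)
      ((List.ofFn J).foldl (fun v j => sharpZ η j v) ψ)))
  rw [h, smul_eq_mul, map_sum, Finset.mul_sum]
  refine Finset.sum_congr rfl fun R _ => ?_
  rw [map_sum, Finset.mul_sum]
  refine Finset.sum_congr rfl fun S _ => ?_
  simp only [map_mul, map_prod, Complex.conj_conj]
  ring

lemma pairing_wedge_dz (η : Ext n) (j : Fin n) (φ ψ : Ext n) :
    pairing η (wedge (dz j) φ) ψ = pairing η φ (sharpZ η j ψ) := by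
  rw [pairing_eq_totalSum, pairing_eq_totalSum, totalSum_wedge_dz]
  · rfl
  · intro i j v
    change sharpZ η i (sharpZ η j v) = -sharpZ η j (sharpZ η i v)
    simp only [sharpZ_apply]
    exact sum_contract_comm _ _ _ _ v

lemma pairing_wedge_dzbar (η : Ext n) (j : Fin n) (φ ψ : Ext n) :
    pairing η (wedge (dzbar j) φ) ψ = pairing η φ (sharpZbar η j ψ) := by
  rw [pairing_eq_totalSum, pairing_eq_totalSum, totalSum_wedge_dzbar]
  · rfl
  · intro i j v
    change sharpZbar η i (sharpZbar η j v) = -sharpZbar η j (sharpZbar η i v)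
    simp only [sharpZbar_apply]
    exact sum_contract_comm _ _ _ _ v
  · intro i j v
    change sharpZ η i (sharpZbar η j v) = -sharpZbar η j (sharpZ η i v)
    simp only [sharpZ_apply, sharpZbar_apply]
    exact sum_contract_comm _ _ _ _ v

lemma pairing_one (η ψ : Ext n) : pairing η 1 ψ = conj (scalarPart ψ) := by
  rw [pairing_eq_totalSum, totalSum_one]
  rfl

lemma pairing_add_left (η φ φ' ψ : Ext n) :
    pairing η (φ + φ') ψ = pairing η φ ψ + pairing η φ' ψ := by
  simp only [pairing_eq_totalSum, totalSum_add_left]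

lemma pairing_smul_left (η : Ext n) (c : ℂ) (φ ψ : Ext n) :
    pairing η (c • φ) ψ = c * pairing η φ ψ := by
  simp only [pairing_eq_totalSum, totalSum_smul_left, smul_eq_mul]

/-- The pairing, as a linear functional of its first argument. -/
def pairingₗ (η ψ : Ext n) : Ext n →ₗ[ℂ] ℂ where
  toFun φ := pairing η φ ψ
  map_add' φ φ' := pairing_add_left η φ φ' ψ
  map_smul' c φ := pairing_smul_left η c φ ψ

lemma pairing_sum_left {ι : Type*} (s : Finset ι) (η : Ext n) (f : ι → Ext n) (ψ : Ext n) :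
    pairing η (∑ i ∈ s, f i) ψ = ∑ i ∈ s, pairing η (f i) ψ :=
  map_sum (pairingₗ η ψ) f s

lemma conj_hermitian_sum {G : Matrix (Fin n) (Fin n) ℂ} (hG : ∀ i j, conj (G i j) = G j i)
    {p q : ℕ} (a b : (Fin p → Fin n) → (Fin q → Fin n) → ℂ) :
    conj (∑ J, ∑ R, ∑ K, ∑ S, (∏ i, G (R i) (J i)) * (∏ i, G (K i) (S i)) * a J K * conj (b R S)) =
      ∑ J, ∑ R, ∑ K, ∑ S, (∏ i, G (R i) (J i)) * (∏ i, G (K i) (S i)) * b J K * conj (a R S) := by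
  simp only [map_sum, map_mul, map_prod, hG, Complex.conj_conj]
  rw [Finset.sum_comm]
  refine Finset.sum_congr rfl fun R _ => Finset.sum_congr rfl fun J _ => ?_
  rw [Finset.sum_comm]
  refine Finset.sum_congr rfl fun S _ => Finset.sum_congr rfl fun K _ => ?_
  ring

lemma pairing_conj_symm {η : Ext n} (h : (matrixOf η).IsHermitian) (φ ψ : Ext n) :
    conj (pairing η φ ψ) = pairing η ψ φ := by
  have hG : ∀ i j, conj ((matrixOf η)⁻¹ i j) = (matrixOf η)⁻¹ j i := fun i j => h.inv.apply j i
  rw [pairing, pairing, map_sum]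
  refine Finset.sum_congr rfl fun p _ => ?_
  rw [map_sum]
  refine Finset.sum_congr rfl fun q _ => ?_
  rw [map_mul, conj_hermitian_sum hG (fun J K => component φ J K) (fun J K => component ψ J K)]
  simp

lemma contract_delVec_eq_sum_sharpZ {η : Ext n} (h : (matrixOf η).det ≠ 0) (r : Fin n) (x : Ext n) :
    contract (delVec r) x = ∑ j, conj (matrixOf η j r) • sharpZ η j x := by
  simp only [sharpZ_apply, Finset.smul_sum, smul_smul, ← map_mul]
  rw [Finset.sum_comm]
  simp only [← Finset.sum_smul, ← map_sum]
  have h1 : ∀ s, ∑ j, matrixOf η j r * (matrixOf η)⁻¹ s j = (1 : Matrix (Fin n) (Fin n) ℂ) s r := by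
    intro s
    rw [← Matrix.nonsing_inv_mul (matrixOf η) (isUnit_iff_ne_zero.2 h), Matrix.mul_apply]
    simp only [mul_comm]
  simp only [h1]
  rw [Finset.sum_eq_single r]
  · simp
  · intro b _ hb; simp [Matrix.one_apply, hb]
  · simp

lemma contract_delbarVec_eq_sum_sharpZbar {η : Ext n} (h : (matrixOf η).det ≠ 0) (r : Fin n)
    (x : Ext n) :
    contract (delbarVec r) x = ∑ j, conj (matrixOf η r j) • sharpZbar η j x := by
  simp only [sharpZbar_apply, Finset.smul_sum, smul_smul, ← map_mul]
  rw [Finset.sum_comm]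
  simp only [← Finset.sum_smul, ← map_sum]
  have h1 : ∀ s, ∑ j, matrixOf η r j * (matrixOf η)⁻¹ j s = (1 : Matrix (Fin n) (Fin n) ℂ) r s := by
    intro s
    rw [← Matrix.mul_nonsing_inv (matrixOf η) (isUnit_iff_ne_zero.2 h), Matrix.mul_apply]
  simp only [h1]
  rw [Finset.sum_eq_single r]
  · simp
  · intro b _ hb; simp [Matrix.one_apply, Ne.symm hb]
  · simp

lemma pairing_add_right (η φ ψ ψ' : Ext n) :
    pairing η φ (ψ + ψ') = pairing η φ ψ + pairing η φ ψ' := by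
  simp only [pairing_eq_totalSum, totalSum, typedSum_add_right, Finset.sum_add_distrib]

lemma pairing_smul_right (η : Ext n) (c : ℂ) (φ ψ : Ext n) :
    pairing η φ (c • ψ) = conj c * pairing η φ ψ := by
  simp only [pairing, ← componentₗ_apply, map_smul, smul_eq_mul, map_mul, Finset.mul_sum]
  refine Finset.sum_congr rfl fun p _ => Finset.sum_congr rfl fun q _ =>
    Finset.sum_congr rfl fun J _ => Finset.sum_congr rfl fun R _ =>
    Finset.sum_congr rfl fun K _ => Finset.sum_congr rfl fun S _ => ?_
  ring

/-- The pairing, as an additive map of its second argument. -/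
def pairingAddHom (η φ : Ext n) : Ext n →+ ℂ :=
  AddMonoidHom.mk' (fun ψ => pairing η φ ψ) (pairing_add_right η φ)

lemma pairing_sum_right {ι : Type*} (s : Finset ι) (η φ : Ext n) (f : ι → Ext n) :
    pairing η φ (∑ i ∈ s, f i) = ∑ i ∈ s, pairing η φ (f i) :=
  map_sum (pairingAddHom η φ) f s

/-- The pairing of a nondegenerate form is nondegenerate. -/
theorem eq_zero_of_pairing {η : Ext n} (h : (matrixOf η).det ≠ 0) {ψ : Ext n}
    (hψ : ∀ φ, pairing η φ ψ = 0) : ψ = 0 := by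
  -- The radical of the pairing is stable under contractions: inverting the matrix, a contraction is
  -- a combination of sharps, and these are adjoint to wedges. Pairing with 1 shows that elements of
  -- the radical have no scalar part, so all components of ψ vanish.
  have h1 : ∀ (r : Fin n) (x : Ext n), (∀ φ, pairing η φ x = 0) →
      ∀ φ, pairing η φ (contract (delVec r) x) = 0 := by
    intro r x hx φ
    rw [contract_delVec_eq_sum_sharpZ h, pairing_sum_right]
    simp only [pairing_smul_right, ← pairing_wedge_dz, hx, mul_zero, Finset.sum_const_zero]
  have h2 : ∀ (r : Fin n) (x : Ext n), (∀ φ, pairing η φ x = 0) →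
      ∀ φ, pairing η φ (contract (delbarVec r) x) = 0 := by
    intro r x hx φ
    rw [contract_delbarVec_eq_sum_sharpZbar h, pairing_sum_right]
    simp only [pairing_smul_right, ← pairing_wedge_dzbar, hx, mul_zero, Finset.sum_const_zero]
  have h3 : ∀ (l : List (Module.Dual ℂ (Covec n))),
      (∀ d ∈ l, (∃ j, d = delVec j) ∨ ∃ j, d = delbarVec j) →
      ∀ x : Ext n, (∀ φ, pairing η φ x = 0) → evalOn x l = 0 := by
    intro l
    induction l with
    | nil =>
      intro _ x hx
      have := hx 1
      rw [pairing_one] at this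
      simpa [evalOn] using this
    | cons d l ih =>
      intro hl x hx
      refine ih (fun d' hd' => hl d' (List.mem_cons_of_mem _ hd')) (contract d x) ?_
      rcases hl d List.mem_cons_self with ⟨j, rfl⟩ | ⟨j, rfl⟩
      · exact h1 j x hx
      · exact h2 j x hx
  refine eq_zero_of_component fun p q J K => h3 _ (fun d hd => ?_) ψ hψ
  rcases List.mem_append.1 hd with hd | hd
  · obtain ⟨a, rfl⟩ := List.mem_ofFn.1 hd
    exact Or.inl ⟨_, rfl⟩
  · obtain ⟨a, rfl⟩ := List.mem_ofFn.1 hd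
    exact Or.inr ⟨_, rfl⟩

/-! ### Types -/

lemma monomial_cons_left {p q : ℕ} (j : Fin n) (J : Fin p → Fin n) (K : Fin q → Fin n) :
    monomial (Fin.cons j J : Fin (p + 1) → Fin n) K = wedge (dz j) (monomial J K) := by
  simp [monomial, List.ofFn_succ, mul_assoc]

lemma monomial_cons_right {q : ℕ} (k : Fin n) (J : Fin 0 → Fin n) (K : Fin q → Fin n) :
    monomial J (Fin.cons k K : Fin (q + 1) → Fin n) = wedge (dzbar k) (monomial J K) := by
  simp [monomial, List.ofFn_succ]

lemma monomial_mem_typeSub {p q : ℕ} (J : Fin p → Fin n) (K : Fin q → Fin n) :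
    monomial J K ∈ typeSub n p q :=
  Submodule.subset_span ⟨(J, K), rfl⟩

lemma one_mem_typeSub : (1 : Ext n) ∈ typeSub n 0 0 := by
  have h := monomial_mem_typeSub (n := n) (p := 0) (q := 0) Fin.elim0 Fin.elim0
  simpa [monomial] using h

/-- A monomial has its dz factors in front, so it is built up by first multiplying with all dz̄ and
then with the dz; hence the dz̄ step is needed for p = 0 only. -/
lemma typeSub_induction {P : ℕ → ℕ → Ext n → Prop} (zero : ∀ p q, P p q 0)
    (add : ∀ p q x y, P p q x → P p q y → P p q (x + y))
    (smul : ∀ p q (c : ℂ) x, P p q x → P p q (c • x)) (one : P 0 0 1)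
    (hz : ∀ p q j x, x ∈ typeSub n p q → P p q x → P (p + 1) q (wedge (dz j) x))
    (hzb : ∀ q j x, x ∈ typeSub n 0 q → P 0 q x → P 0 (q + 1) (wedge (dzbar j) x))
    {p q : ℕ} {x : Ext n} (hx : x ∈ typeSub n p q) : P p q x := by
  have mono : ∀ (p q : ℕ) (J : Fin p → Fin n) (K : Fin q → Fin n), P p q (monomial J K) := by
    intro p
    induction p with
    | zero =>
      intro q
      induction q with
      | zero => intro J K; simpa [monomial] using one
      | succ q ih =>
        intro J K
        rw [← Fin.cons_self_tail K, monomial_cons_right]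
        exact hzb _ _ _ (monomial_mem_typeSub _ _) (ih _ _)
    | succ p ih =>
      intro q J K
      rw [← Fin.cons_self_tail J, monomial_cons_left]
      exact hz _ _ _ _ (monomial_mem_typeSub _ _) (ih _ _ _)
  refine Submodule.span_induction ?_ (zero p q) (fun x y _ _ => add p q x y)
    (fun c x _ => smul p q c x) hx
  rintro _ ⟨JK, rfl⟩
  exact mono _ _ _ _

lemma wedge_dz_mem_typeSub {p q : ℕ} (j : Fin n) {x : Ext n} (hx : x ∈ typeSub n p q) :
    wedge (dz j) x ∈ typeSub n (p + 1) q := by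
  refine Submodule.span_induction (p := fun x _ => wedge (dz j) x ∈ typeSub n (p + 1) q)
    ?_ (by rw [map_zero]; exact zero_mem _)
    (fun x y _ _ hx hy => by rw [map_add]; exact add_mem hx hy)
    (fun c x _ hx => by rw [map_smul]; exact Submodule.smul_mem _ c hx) hx
  rintro _ ⟨JK, rfl⟩
  change wedge (dz j) (monomial JK.1 JK.2) ∈ _
  rw [← monomial_cons_left]
  exact monomial_mem_typeSub _ _

lemma wedge_dzbar_mem_typeSub {p q : ℕ} (j : Fin n) {x : Ext n} (hx : x ∈ typeSub n p q) :
    wedge (dzbar j) x ∈ typeSub n p (q + 1) := by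
  have mono : ∀ (p q : ℕ) (J : Fin p → Fin n) (K : Fin q → Fin n),
      wedge (dzbar j) (monomial J K) ∈ typeSub n p (q + 1) := by
    intro p
    induction p with
    | zero =>
      intro q J K
      rw [← monomial_cons_right]
      exact monomial_mem_typeSub _ _
    | succ p ih =>
      intro q J K
      rw [← Fin.cons_self_tail J, monomial_cons_left, wedge_comm]
      exact neg_mem (wedge_dz_mem_typeSub _ (ih _ _ _))
  refine Submodule.span_induction (p := fun x _ => wedge (dzbar j) x ∈ typeSub n p (q + 1))
    ?_ (by rw [map_zero]; exact zero_mem _)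
    (fun x y _ _ hx hy => by rw [map_add]; exact add_mem hx hy)
    (fun c x _ hx => by rw [map_smul]; exact Submodule.smul_mem _ c hx) hx
  rintro _ ⟨JK, rfl⟩
  exact mono _ _ _ _

lemma mul_mem_typeSub {p q p' q' : ℕ} {x y : Ext n} (hx : x ∈ typeSub n p q)
    (hy : y ∈ typeSub n p' q') : x * y ∈ typeSub n (p + p') (q + q') := by
  refine typeSub_induction (P := fun p q x => x * y ∈ typeSub n (p + p') (q + q'))
    (fun p q => by simp) (fun p q x y hx hy => by rw [add_mul]; exact add_mem hx hy)
    (fun p q c x hx => by rw [smul_mul_assoc]; exact Submodule.smul_mem _ c hx)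
    (by simpa using hy) (fun p q j x _ hx => ?_) (fun q j x _ hx => ?_) hx
  · have := wedge_dz_mem_typeSub j hx
    rw [Nat.add_right_comm]
    simpa [mul_assoc] using this
  · have := wedge_dzbar_mem_typeSub j hx
    rw [Nat.add_right_comm]
    simpa [mul_assoc] using this

/-- At p = 0 the truncated p - 1 says nothing useful; the second half records that the contraction
vanishes there. The induction needs both halves. -/
lemma contract_delVec_mem_typeSub {p q : ℕ} (j : Fin n) {x : Ext n} (hx : x ∈ typeSub n p q) :
    contract (delVec j) x ∈ typeSub n (p - 1) q ∧ (p = 0 → contract (delVec j) x = 0) := by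
  refine typeSub_induction (P := fun p q x => contract (delVec j) x ∈ typeSub n (p - 1) q ∧
      (p = 0 → contract (delVec j) x = 0))
    (fun p q => by simp)
    (fun p q x y hx hy => by
      rw [map_add]
      exact ⟨add_mem hx.1 hy.1, fun h => by rw [hx.2 h, hy.2 h, add_zero]⟩)
    (fun p q c x hx => by
      rw [map_smul]
      exact ⟨Submodule.smul_mem _ c hx.1, fun h => by rw [hx.2 h, smul_zero]⟩)
    (by rw [contract_one]; simp) (fun p q k x hx ih => ?_) (fun q k x hx ih => ?_) hx
  · rw [contract_wedge]
    refine ⟨sub_mem (Submodule.smul_mem _ _ hx) ?_, fun h => absurd h (Nat.succ_ne_zero p)⟩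
    rcases Nat.eq_zero_or_pos p with rfl | hp
    · rw [ih.2 rfl, map_zero]; exact zero_mem _
    · have := wedge_dz_mem_typeSub k ih.1
      rwa [Nat.sub_add_cancel hp] at this
  · rw [contract_wedge, ih.2 rfl, delVec_dzbar]
    simp

lemma contract_delbarVec_mem_typeSub {p q : ℕ} (j : Fin n) {x : Ext n} (hx : x ∈ typeSub n p q) :
    contract (delbarVec j) x ∈ typeSub n p (q - 1) ∧ (q = 0 → contract (delbarVec j) x = 0) := by
  refine typeSub_induction (P := fun p q x => contract (delbarVec j) x ∈ typeSub n p (q - 1) ∧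
      (q = 0 → contract (delbarVec j) x = 0))
    (fun p q => by simp)
    (fun p q x y hx hy => by
      rw [map_add]
      exact ⟨add_mem hx.1 hy.1, fun h => by rw [hx.2 h, hy.2 h, add_zero]⟩)
    (fun p q c x hx => by
      rw [map_smul]
      exact ⟨Submodule.smul_mem _ c hx.1, fun h => by rw [hx.2 h, smul_zero]⟩)
    (by rw [contract_one]; simp) (fun p q k x hx ih => ?_) (fun q k x hx ih => ?_) hx
  · rw [contract_wedge, delbarVec_dz, zero_smul, zero_sub]
    refine ⟨neg_mem (wedge_dz_mem_typeSub k ih.1), fun h => by rw [ih.2 h, map_zero, neg_zero]⟩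
  · rw [contract_wedge]
    refine ⟨sub_mem (Submodule.smul_mem _ _ hx) ?_, fun h => absurd h (Nat.succ_ne_zero q)⟩
    rcases Nat.eq_zero_or_pos q with rfl | hq
    · rw [ih.2 rfl, map_zero]; exact zero_mem _
    · have := wedge_dzbar_mem_typeSub k ih.1
      rwa [Nat.sub_add_cancel hq] at this

lemma form_type_induction {P : Ext n → Prop} (add : ∀ x y, P x → P y → P (x + y))
    (type : ∀ p q x, p ≤ n → q ≤ n → x ∈ typeSub n p q → P x) (x : Ext n) : P x := by
  have zero : P 0 := type 0 0 0 (Nat.zero_le _) (Nat.zero_le _) (zero_mem _)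
  rw [form_eq_sum_component x]
  refine Finset.sum_induction _ P add zero fun p hp => Finset.sum_induction _ P add zero
    fun q hq => type p q _ (Nat.lt_succ_iff.1 (Finset.mem_range.1 hp))
      (Nat.lt_succ_iff.1 (Finset.mem_range.1 hq)) ?_
  exact Submodule.smul_mem _ _ (Submodule.sum_mem _ fun J _ => Submodule.sum_mem _ fun K _ =>
    Submodule.smul_mem _ _ (monomial_mem_typeSub J K))

lemma conjExt_mem_typeSub {p q : ℕ} {x : Ext n} (hx : x ∈ typeSub n p q) :
    conjExt x ∈ typeSub n q p :=
  typeSub_induction (P := fun p q x => conjExt x ∈ typeSub n q p)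
    (fun p q => by simp) (fun p q x y hx hy => by rw [map_add]; exact add_mem hx hy)
    (fun p q c x hx => by rw [conjExt_smul]; exact Submodule.smul_mem _ _ hx)
    (by rw [map_one]; exact one_mem_typeSub)
    (fun p q j x _ hx => by
      rw [conjExt_wedge, conjCovec_dz]; exact wedge_dzbar_mem_typeSub j hx)
    (fun q j x _ hx => by
      rw [conjExt_wedge, conjCovec_dzbar]; exact wedge_dz_mem_typeSub j hx) hx

/-! ### Number operators -/

/-- The holomorphic degree. -/
def numZ : Module.End ℂ (Ext n) := ∑ j, wedge (dz j) * contract (delVec j)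

/-- The antiholomorphic degree. -/
def numZbar : Module.End ℂ (Ext n) := ∑ j, wedge (dzbar j) * contract (delbarVec j)

lemma numZ_apply (x : Ext n) : numZ x = ∑ j, wedge (dz j) (contract (delVec j) x) := by
  simp only [numZ, LinearMap.sum_apply, Module.End.mul_apply]

lemma numZbar_apply (x : Ext n) :
    numZbar x = ∑ j, wedge (dzbar j) (contract (delbarVec j) x) := by
  simp only [numZbar, LinearMap.sum_apply, Module.End.mul_apply]

lemma numZ_one : numZ (1 : Ext n) = 0 := by
  simp only [numZ_apply, contract_one, map_zero, Finset.sum_const_zero]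

lemma numZbar_one : numZbar (1 : Ext n) = 0 := by
  simp only [numZbar_apply, contract_one, map_zero, Finset.sum_const_zero]

lemma numZ_wedge_dz (j : Fin n) (x : Ext n) :
    numZ (wedge (dz j) x) = wedge (dz j) x + wedge (dz j) (numZ x) := by
  rw [numZ_apply, numZ_apply]
  simp only [contract_wedge, map_sub, map_smul, wedge_comm (dz _) (dz j), delVec_dz, ite_smul,
    one_smul, zero_smul, sub_neg_eq_add, Finset.sum_add_distrib, map_sum]
  simp

lemma numZ_wedge_dzbar (j : Fin n) (x : Ext n) :
    numZ (wedge (dzbar j) x) = wedge (dzbar j) (numZ x) := by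
  rw [numZ_apply, numZ_apply]
  simp only [contract_wedge, map_sub, map_smul, wedge_comm (dz _) (dzbar j), delVec_dzbar,
    zero_smul, sub_neg_eq_add, Finset.sum_add_distrib, map_sum]
  simp

lemma numZbar_wedge_dz (j : Fin n) (x : Ext n) :
    numZbar (wedge (dz j) x) = wedge (dz j) (numZbar x) := by
  rw [numZbar_apply, numZbar_apply]
  simp only [contract_wedge, map_sub, map_smul, wedge_comm (dzbar _) (dz j), delbarVec_dz,
    zero_smul, sub_neg_eq_add, Finset.sum_add_distrib, map_sum]
  simp

lemma numZbar_wedge_dzbar (j : Fin n) (x : Ext n) :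
    numZbar (wedge (dzbar j) x) = wedge (dzbar j) x + wedge (dzbar j) (numZbar x) := by
  rw [numZbar_apply, numZbar_apply]
  simp only [contract_wedge, map_sub, map_smul, wedge_comm (dzbar _) (dzbar j), delbarVec_dzbar,
    ite_smul, one_smul, zero_smul, sub_neg_eq_add, Finset.sum_add_distrib, map_sum]
  simp

lemma numZ_of_mem {p q : ℕ} {x : Ext n} (hx : x ∈ typeSub n p q) : numZ x = (p : ℂ) • x :=
  typeSub_induction (P := fun p _ x => numZ x = (p : ℂ) • x)
    (fun p q => by simp) (fun p q x y hx hy => by rw [map_add, hx, hy, smul_add])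
    (fun p q c x hx => by rw [map_smul, hx, smul_comm]) (by simp [numZ_one])
    (fun p q j x _ hx => by
      rw [numZ_wedge_dz, hx, map_smul]; push_cast; rw [add_smul, one_smul, add_comm])
    (fun q j x _ hx => by rw [numZ_wedge_dzbar, hx, map_smul]) hx

lemma numZbar_of_mem {p q : ℕ} {x : Ext n} (hx : x ∈ typeSub n p q) :
    numZbar x = (q : ℂ) • x :=
  typeSub_induction (P := fun _ q x => numZbar x = (q : ℂ) • x)
    (fun p q => by simp) (fun p q x y hx hy => by rw [map_add, hx, hy, smul_add])
    (fun p q c x hx => by rw [map_smul, hx, smul_comm]) (by simp [numZbar_one])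
    (fun p q j x _ hx => by rw [numZbar_wedge_dz, hx, map_smul])
    (fun q j x _ hx => by
      rw [numZbar_wedge_dzbar, hx, map_smul]; push_cast; rw [add_smul, one_smul, add_comm]) hx

/-- The degree operator. -/
def numDeg : Module.End ℂ (Ext n) := numZ + numZbar

lemma numDeg_one : numDeg (1 : Ext n) = 0 := by
  rw [numDeg, LinearMap.add_apply, numZ_one, numZbar_one, add_zero]

lemma numDeg_wedge (α : Covec n) (x : Ext n) :
    numDeg (wedge α x) = wedge α x + wedge α (numDeg x) := by
  have h1 : ∀ j, numDeg (wedge (dz j) x) = wedge (dz j) x + wedge (dz j) (numDeg x) := fun j => by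
    simp only [numDeg, LinearMap.add_apply, numZ_wedge_dz, numZbar_wedge_dz, map_add]; abel
  have h2 : ∀ j, numDeg (wedge (dzbar j) x) = wedge (dzbar j) x + wedge (dzbar j) (numDeg x) :=
    fun j => by
    simp only [numDeg, LinearMap.add_apply, numZ_wedge_dzbar, numZbar_wedge_dzbar, map_add]; abel
  rw [wedge_eq_sum α]
  simp only [LinearMap.add_apply, LinearMap.sum_apply, LinearMap.smul_apply, map_add, map_sum,
    map_smul, h1, h2, smul_add, Finset.sum_add_distrib]
  abel

/-! ### The involution and functionals on top degree forms -/

abbrev involution : Ext n →ₐ[ℂ] Ext n := CliffordAlgebra.involute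

lemma involution_wedge (α : Covec n) (x : Ext n) :
    involution (wedge α x) = -wedge α (involution x) := by
  have : involution (ExteriorAlgebra.ι ℂ α) = -ExteriorAlgebra.ι ℂ α :=
    CliffordAlgebra.involute_ι _
  simp [this]

lemma involution_involution (x : Ext n) : involution (involution x) = x :=
  CliffordAlgebra.involute_involute x

lemma involution_contract (d : Module.Dual ℂ (Covec n)) (x : Ext n) :
    involution (contract d x) = -contract d (involution x) := by
  induction x using form_induction_wedge with
  | one => simp [contract_one]
  | add x y hx hy => simp only [map_add, hx, hy, neg_add]
  | smul c x hx => simp only [map_smul, hx, smul_neg]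
  | hw α x hx =>
    rw [contract_wedge, involution_wedge, map_neg, contract_wedge, map_sub, involution_wedge, hx,
      map_smul, map_neg]
    abel

lemma mul_ι_eq (α : Covec n) (x : Ext n) :
    x * ExteriorAlgebra.ι ℂ α = wedge α (involution x) := by
  induction x using form_induction_wedge with
  | one => simp
  | add x y hx hy => simp only [map_add, add_mul, hx, hy]
  | smul c x hx => simp only [map_smul, hx, smul_mul_assoc]
  | hw β x hx =>
    rw [involution_wedge, map_neg, ← wedge_comm, ← hx]
    simp [mul_assoc]

lemma involution_of_mem {p q : ℕ} {x : Ext n} (hx : x ∈ typeSub n p q) :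
    involution x = (-1 : ℂ) ^ (p + q) • x :=
  typeSub_induction (P := fun p q x => involution x = (-1 : ℂ) ^ (p + q) • x)
    (fun p q => by simp) (fun p q x y hx hy => by rw [map_add, hx, hy, smul_add])
    (fun p q c x hx => by rw [map_smul, hx, smul_comm]) (by simp)
    (fun p q j x _ hx => by
      rw [involution_wedge, hx, map_smul, ← neg_smul]; congr 1; ring)
    (fun q j x _ hx => by
      rw [involution_wedge, hx, map_smul, ← neg_smul]; congr 1; ring) hx

section TopFunctional

variable {T : Ext n →ₗ[ℂ] ℂ} (hT : ∀ d x, T (contract d x) = 0)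
include hT

/-- For each j, wedge after contraction is the identity minus contraction after wedge, and T kills
the latter. Thus T sees only the eigenvalue n of the degree, which is how it isolates type (n, n).
-/
lemma topFunctional_numZ (x : Ext n) : T (numZ x) = n * T x := by
  have h : ∀ j : Fin n, wedge (dz j) (contract (delVec j) x) =
      x - contract (delVec j) (wedge (dz j) x) := fun j => by
    rw [contract_wedge, delVec_dz]; simp
  rw [numZ_apply]
  simp only [h, map_sum, map_sub, hT]
  simp

lemma topFunctional_numZbar (x : Ext n) : T (numZbar x) = n * T x := by
  have h : ∀ j : Fin n, wedge (dzbar j) (contract (delbarVec j) x) =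
      x - contract (delbarVec j) (wedge (dzbar j) x) := fun j => by
    rw [contract_wedge, delbarVec_dzbar]; simp
  rw [numZbar_apply]
  simp only [h, map_sum, map_sub, hT]
  simp

lemma topFunctional_eq_zero {p q : ℕ} {x : Ext n} (hx : x ∈ typeSub n p q)
    (hpq : ¬ (p = n ∧ q = n)) : T x = 0 := by
  have h1 := topFunctional_numZ hT x
  have h2 := topFunctional_numZbar hT x
  rw [numZ_of_mem hx, map_smul, smul_eq_mul] at h1
  rw [numZbar_of_mem hx, map_smul, smul_eq_mul] at h2
  by_contra h
  exact hpq ⟨by exact_mod_cast mul_right_cancel₀ h h1, by exact_mod_cast mul_right_cancel₀ h h2⟩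

lemma topFunctional_involution (x : Ext n) : T (involution x) = T x := by
  induction x using form_type_induction with
  | add x y hx hy => simp only [map_add, hx, hy]
  | type p q x hp hq hx =>
    by_cases h : p = n ∧ q = n
    · obtain ⟨rfl, rfl⟩ := h
      rw [involution_of_mem hx, ← two_mul, pow_mul]
      simp
    · rw [involution_of_mem hx, map_smul, topFunctional_eq_zero hT hx h, smul_zero]

end TopFunctional

/-! ### Representations of `sl₂` -/

section Sl2

variable {R : Type*} [Ring R] [Module ℚ R]

lemma nilpotent_pow_mul {X A B : R} (h1 : X * A = A * X + B) (h2 : X * B = B * X) (i : ℕ) :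
    X ^ (i + 1) * A = A * X ^ (i + 1) + ((i + 1 : ℕ) : ℚ) • (B * X ^ i) := by
  have h3 : ∀ i : ℕ, X ^ i * B = B * X ^ i := fun i => (Commute.pow_left h2 i).eq
  induction i with
  | zero => simp [h1]
  | succ i ih =>
    rw [pow_succ X (i + 1), mul_assoc, h1, mul_add, ← mul_assoc, ih, h3, add_mul, smul_mul_assoc,
      mul_assoc A, mul_assoc B, ← pow_succ, ← pow_succ, add_assoc, add_right_inj]
    push_cast
    module

/-- e^X A e^{−X} = e^{ad X} A, and the series stops after the linear term because [X, B] = 0. -/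
lemma exp_mul_of_commutator {X A B : R} (hX : IsNilpotent X) (h1 : X * A = A * X + B)
    (h2 : X * B = B * X) : IsNilpotent.exp X * A = (A + B) * IsNilpotent.exp X := by
  obtain ⟨N, hN⟩ := hX
  have hN' : X ^ (N + 1) = 0 := by rw [pow_succ, hN, zero_mul]
  rw [add_mul]
  conv_lhs => rw [IsNilpotent.exp_eq_sum hN']
  conv_rhs => rw [IsNilpotent.exp_eq_sum hN]
  -- The exponential is cut at N + 1 on the left and at N on the right, which absorbs the shift from
  -- X^(i+1) to X^i in the B terms; here the A terms are brought back to N + 1.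
  have h3 : A * ∑ i ∈ Finset.range N, (i.factorial : ℚ)⁻¹ • X ^ i =
      A * ∑ i ∈ Finset.range (N + 1), (i.factorial : ℚ)⁻¹ • X ^ i := by
    rw [Finset.sum_range_succ, hN, smul_zero, add_zero]
  rw [h3, Finset.sum_range_succ', add_mul, mul_add, Finset.sum_mul, Finset.mul_sum, Finset.mul_sum]
  simp only [smul_mul_assoc, mul_smul_comm, nilpotent_pow_mul h1 h2, smul_add,
    Finset.sum_add_distrib, smul_smul]
  have h4 : ∀ i : ℕ, ((i + 1).factorial : ℚ)⁻¹ * ((i + 1 : ℕ) : ℚ) = (i.factorial : ℚ)⁻¹ := by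
    intro i
    have : ((i + 1 : ℕ) : ℚ) ≠ 0 := by positivity
    rw [Nat.factorial_succ]
    push_cast at *
    field_simp
  simp only [h4, pow_zero, one_mul, mul_one]
  abel

/-- The Weyl element of a pair of nilpotent elements. -/
def weylElement (L Λ : R) : R := IsNilpotent.exp L * IsNilpotent.exp (-Λ) * IsNilpotent.exp L

attribute [local instance] LieRing.ofAssociativeRing

variable [Algebra ℂ R] {L Λ H A : R}

omit [Module ℚ R] in
/-- A highest weight vector of weight one generates a two-dimensional representation. -/
theorem lie_lie_eq_zero_of_weight_one (hLΛ : ⁅L, Λ⁆ = H) (hHΛ : ⁅H, Λ⁆ = -(2 : ℂ) • Λ)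
    (hΛ : IsNilpotent Λ) (hLA : ⁅L, A⁆ = 0) (hHA : ⁅H, A⁆ = A) : ⁅Λ, ⁅Λ, A⁆⁆ = 0 := by
  -- The lowering sequence from the highest weight vector A: the weight of v j is 1 − 2j.
  let v : ℕ → R := fun j => ((LieAlgebra.ad ℂ R Λ) ^ j) A
  have v_succ : ∀ j, v (j + 1) = ⁅Λ, v j⁆ := fun j => by
    simp only [v, pow_succ', Module.End.mul_apply, LieAlgebra.ad_apply]
  have hH : ∀ j : ℕ, ⁅H, v j⁆ = (1 - 2 * j : ℂ) • v j := by
    intro j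
    induction j with
    | zero => simpa [v] using hHA
    | succ j ih =>
      rw [v_succ, leibniz_lie, hHΛ, ih, lie_smul, smul_lie, ← add_smul]
      congr 1
      push_cast
      ring
  -- The raising coefficient vanishes only at j = 1, so L cannot detect v 2, but it recovers every v
  -- j with j ≥ 2 from v (j + 1).
  have hL : ∀ j : ℕ, ⁅L, v (j + 1)⁆ = ((j + 1) * (1 - j) : ℂ) • v j := by
    intro j
    induction j with
    | zero =>
      have h0 : v 0 = A := rfl
      rw [v_succ, leibniz_lie, hLΛ, hH, h0, hLA, lie_zero]
      simp
    | succ j ih =>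
      rw [v_succ, leibniz_lie, hLΛ, hH, ih, lie_smul, ← v_succ, ← add_smul]
      congr 1
      push_cast
      ring
  obtain ⟨N, hN⟩ := LieAlgebra.ad_nilpotent_of_nilpotent (R := ℂ) (A := R) hΛ
  -- Nilpotency kills some v far out; nonvanishing raising coefficients then bring the vanishing
  -- down to v 2.
  have hv : ∀ k : ℕ, v (k + 2) = 0 → v 2 = 0 := by
    intro k
    induction k with
    | zero => exact id
    | succ k ih =>
      intro h
      refine ih ?_
      have h' := hL (k + 2)
      rw [show k + 2 + 1 = k + 1 + 2 by ring, h, lie_zero] at h'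
      refine (smul_eq_zero.1 h'.symm).resolve_left ?_
      push_cast
      have h1 : (k : ℂ) + 2 + 1 ≠ 0 := by exact_mod_cast (by omega : k + 2 + 1 ≠ 0)
      have h2 : (1 : ℂ) - (k + 2) ≠ 0 := by
        have : ((k : ℂ) + 1) ≠ 0 := by exact_mod_cast (by omega : k + 1 ≠ 0)
        intro h; apply this; linear_combination -h
      exact mul_ne_zero h1 h2
  have h2 : v 2 = 0 := hv N (by
    simp only [v]
    rw [pow_add, hN, zero_mul, LinearMap.zero_apply])
  rwa [v_succ, v_succ] at h2

/-- The action of the Weyl element on a two-dimensional representation. -/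
theorem weylElement_mul_of_weight_one (hLΛ : L * Λ - Λ * L = H) (hHΛ : H * Λ - Λ * H = -(2 : ℂ) • Λ)
    (hL : IsNilpotent L) (hΛ : IsNilpotent Λ) (hLA : L * A = A * L) (hHA : H * A - A * H = A) :
    weylElement L Λ * A = -(Λ * A - A * Λ) * weylElement L Λ ∧
      weylElement L Λ * (Λ * A - A * Λ) = A * weylElement L Λ := by
  have h0 : ⁅Λ, ⁅Λ, A⁆⁆ = 0 :=
    lie_lie_eq_zero_of_weight_one hLΛ hHΛ hΛ (sub_eq_zero.2 hLA) hHA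
  obtain ⟨B, hB⟩ : ∃ B, B = Λ * A - A * Λ := ⟨_, rfl⟩
  have hΛB : Λ * B = B * Λ := by rw [hB]; exact sub_eq_zero.1 h0
  rw [← hB]
  -- Jacobi: [L, [Λ, A]] = [[L, Λ], A] + [Λ, [L, A]] = [H, A] = A.
  have hLB : L * B = B * L + A := by
    have : L * B - B * L = (L * Λ - Λ * L) * A - A * (L * Λ - Λ * L) +
        (Λ * (L * A) - Λ * (A * L) + (L * A) * Λ * (-1) + (A * L) * Λ) := by
      rw [hB]; noncomm_ring
    rw [hLΛ, hHA, hLA] at this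
    rw [← sub_eq_iff_eq_add', this]
    noncomm_ring
  have hΛA : -Λ * A = A * -Λ + -B := by rw [hB]; noncomm_ring
  have hΛB' : -Λ * -B = -B * -Λ := by simpa using hΛB
  -- Conjugation by e^L fixes A and sends B to B + A; conjugation by e^{−Λ} sends A to A − B and
  -- fixes B. In succession: A ↦ A ↦ A − B ↦ −B and B ↦ B + A ↦ A ↦ A.
  have e1 : IsNilpotent.exp L * A = A * IsNilpotent.exp L := by
    have := exp_mul_of_commutator hL (A := A) (B := 0) (by simpa using hLA) (by simp)
    simpa using this
  have e2 : IsNilpotent.exp L * B = (B + A) * IsNilpotent.exp L :=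
    exp_mul_of_commutator hL hLB hLA
  have e3 : IsNilpotent.exp (-Λ) * A = (A + -B) * IsNilpotent.exp (-Λ) :=
    exp_mul_of_commutator hΛ.neg hΛA hΛB'
  have e4 : IsNilpotent.exp (-Λ) * B = B * IsNilpotent.exp (-Λ) := by
    have := exp_mul_of_commutator hΛ.neg (A := B) (B := 0) (by simpa using hΛB) (by simp)
    simpa using this
  rw [weylElement]
  constructor
  · rw [mul_assoc, e1, mul_assoc, ← mul_assoc _ A, e3, ← mul_assoc, ← mul_assoc, mul_add, e1,
      mul_neg, e2]
    noncomm_ring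
  · rw [mul_assoc, e2, mul_assoc, ← mul_assoc _ (B + A), mul_add (IsNilpotent.exp (-Λ)), e3, e4,
      ← add_mul, add_neg_cancel_comm_assoc, ← mul_assoc, ← mul_assoc, e1]
    noncomm_ring

end Sl2

/-! ### The Lefschetz operators of a nondegenerate `(1,1)`-form -/

/-- Nondegenerate forms of type `(1,1)`. -/
structure IsNondegOneOne (η : Ext n) : Prop where
  eq_sum : η = Complex.I • ∑ j : Fin n, ∑ k : Fin n, matrixOf η j k •
      (ExteriorAlgebra.ι ℂ (dz j) * ExteriorAlgebra.ι ℂ (dzbar k))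
  det_ne_zero : (matrixOf η).det ≠ 0

/-- The exterior product with `η`. -/
abbrev lef (η : Ext n) : Module.End ℂ (Ext n) := LinearMap.mulLeft ℂ η

/-- The commutator of the dual Lefschetz operator with `dzⱼ`. -/
def sharp (η : Ext n) (j : Fin n) : Module.End ℂ (Ext n) :=
  -Complex.I • ∑ k, (matrixOf η)⁻¹ k j • contract (delbarVec k)

/-- The commutator of the dual Lefschetz operator with `dz̄ₖ`. -/
def sharpBar (η : Ext n) (k : Fin n) : Module.End ℂ (Ext n) :=
  Complex.I • ∑ j, (matrixOf η)⁻¹ k j • contract (delVec j)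

/-- The dual Lefschetz operator of `η`, by contraction. -/
def lam (η : Ext n) : Module.End ℂ (Ext n) := ∑ j, sharp η j * contract (delVec j)

lemma sharp_apply (η : Ext n) (j : Fin n) (x : Ext n) :
    sharp η j x = -Complex.I • ∑ k, (matrixOf η)⁻¹ k j • contract (delbarVec k) x := by
  simp only [sharp, LinearMap.sum_apply, LinearMap.smul_apply]

lemma sharpBar_apply (η : Ext n) (k : Fin n) (x : Ext n) :
    sharpBar η k x = Complex.I • ∑ j, (matrixOf η)⁻¹ k j • contract (delVec j) x := by
  simp only [sharpBar, LinearMap.sum_apply, LinearMap.smul_apply]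

lemma lam_apply (η : Ext n) (x : Ext n) :
    lam η x = ∑ j, sharp η j (contract (delVec j) x) := by
  simp only [lam, LinearMap.sum_apply, Module.End.mul_apply]

lemma sharp_wedge (η : Ext n) (j : Fin n) (α : Covec n) (x : Ext n) :
    sharp η j (wedge α x) = (-Complex.I * ∑ k, (matrixOf η)⁻¹ k j * delbarVec k α) • x -
      wedge α (sharp η j x) := by
  rw [sharp_apply, sharp_apply]
  simp only [contract_wedge, smul_sub, Finset.sum_sub_distrib]
  rw [mul_smul, Finset.sum_smul, map_smul, map_sum]
  simp only [mul_smul, map_smul]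

lemma lam_wedge_dz (η : Ext n) (j : Fin n) (x : Ext n) :
    lam η (wedge (dz j) x) = wedge (dz j) (lam η x) + sharp η j x := by
  have h : ∀ i, sharp η i (contract (delVec i) (wedge (dz j) x)) =
      wedge (dz j) (sharp η i (contract (delVec i) x)) + if i = j then sharp η i x else 0 := by
    intro i
    rw [contract_wedge, map_sub, map_smul, sharp_wedge, delVec_dz]
    simp only [delbarVec_dz, mul_zero, Finset.sum_const_zero, zero_smul, zero_sub, sub_neg_eq_add]
    rw [add_comm]
    congr 1
    split_ifs <;> simp
  rw [lam_apply, lam_apply, map_sum]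
  simp only [h, Finset.sum_add_distrib]
  simp

lemma lam_wedge_dzbar (η : Ext n) (k : Fin n) (x : Ext n) :
    lam η (wedge (dzbar k) x) = wedge (dzbar k) (lam η x) + sharpBar η k x := by
  have h : ∀ i, sharp η i (contract (delVec i) (wedge (dzbar k) x)) =
      wedge (dzbar k) (sharp η i (contract (delVec i) x)) +
        Complex.I • (matrixOf η)⁻¹ k i • contract (delVec i) x := by
    intro i
    rw [contract_wedge, delVec_dzbar, zero_smul, zero_sub, map_neg, sharp_wedge]
    simp only [delbarVec_dzbar, mul_ite, mul_one, mul_zero, Finset.sum_ite_eq', Finset.mem_univ,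
      if_true, neg_mul, neg_smul, neg_sub, sub_neg_eq_add, mul_smul]
  rw [lam_apply, lam_apply, map_sum]
  simp only [h, Finset.sum_add_distrib]
  rw [sharpBar_apply, Finset.smul_sum]

section Nondeg

variable {η : Ext n} (hη : IsNondegOneOne η)
include hη

lemma lef_apply (x : Ext n) :
    lef η x = Complex.I • ∑ j, ∑ k, matrixOf η j k • wedge (dz j) (wedge (dzbar k) x) := by
  change η * x = _
  conv_lhs => rw [hη.eq_sum]
  simp only [smul_mul_assoc, Finset.sum_mul, mul_assoc, LinearMap.mulLeft_apply]

lemma lef_wedge (α : Covec n) (x : Ext n) : lef η (wedge α x) = wedge α (lef η x) := by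
  simp only [lef_apply hη, wedge_comm _ α, map_smul, map_sum, map_neg, neg_neg]

lemma contract_lef (d : Module.Dual ℂ (Covec n)) (x : Ext n) :
    contract d (lef η x) = lef η (contract d x) +
      Complex.I • ∑ j, ∑ k, matrixOf η j k •
        (d (dz j) • wedge (dzbar k) x - d (dzbar k) • wedge (dz j) x) := by
  simp only [lef_apply hη, map_smul, map_sum, contract_wedge, map_sub]
  rw [← smul_add, ← Finset.sum_add_distrib]
  congr 1
  refine Finset.sum_congr rfl fun j _ => ?_
  rw [← Finset.sum_add_distrib]
  refine Finset.sum_congr rfl fun k _ => ?_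
  rw [← smul_add]
  congr 1
  abel

lemma contract_delVec_lef (j : Fin n) (x : Ext n) :
    contract (delVec j) (lef η x) = lef η (contract (delVec j) x) +
      Complex.I • ∑ k, matrixOf η j k • wedge (dzbar k) x := by
  rw [contract_lef hη]
  congr 2
  rw [Finset.sum_eq_single j]
  · simp [delVec_dz, delVec_dzbar]
  · intro i _ hi; simp [delVec_dz, delVec_dzbar, Ne.symm hi]
  · simp

lemma contract_delbarVec_lef (k : Fin n) (x : Ext n) :
    contract (delbarVec k) (lef η x) = lef η (contract (delbarVec k) x) -
      Complex.I • ∑ j, matrixOf η j k • wedge (dz j) x := by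
  rw [contract_lef hη, sub_eq_add_neg, ← smul_neg, ← Finset.sum_neg_distrib]
  congr 2
  refine Finset.sum_congr rfl fun j _ => ?_
  rw [Finset.sum_eq_single k]
  · simp [delbarVec_dz, delbarVec_dzbar]
  · intro i _ hi; simp [delbarVec_dz, delbarVec_dzbar, Ne.symm hi]
  · simp

lemma sum_matrix_inv (l j : Fin n) :
    ∑ k, matrixOf η l k * (matrixOf η)⁻¹ k j = if l = j then 1 else 0 := by
  rw [← Matrix.one_apply, ← Matrix.mul_nonsing_inv (matrixOf η)
    (isUnit_iff_ne_zero.2 hη.det_ne_zero), Matrix.mul_apply]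

lemma sum_inv_matrix (l j : Fin n) :
    ∑ k, (matrixOf η)⁻¹ l k * matrixOf η k j = if l = j then 1 else 0 := by
  rw [← Matrix.one_apply, ← Matrix.nonsing_inv_mul (matrixOf η)
    (isUnit_iff_ne_zero.2 hη.det_ne_zero), Matrix.mul_apply]

lemma sharp_lef (j : Fin n) (x : Ext n) :
    sharp η j (lef η x) = lef η (sharp η j x) - wedge (dz j) x := by
  have h : ∑ k, (matrixOf η)⁻¹ k j • ∑ l, matrixOf η l k • wedge (dz l) x = wedge (dz j) x := by
    simp only [Finset.smul_sum, smul_smul]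
    rw [Finset.sum_comm]
    simp only [← Finset.sum_smul, mul_comm ((matrixOf η)⁻¹ _ _), sum_matrix_inv hη]
    simp
  simp only [sharp_apply, contract_delbarVec_lef hη, smul_sub, Finset.sum_sub_distrib, map_smul,
    map_sum]
  simp only [smul_comm _ Complex.I, ← Finset.smul_sum]
  rw [h, smul_smul]
  simp

lemma sum_sharp (k : Fin n) (x : Ext n) :
    ∑ j, matrixOf η j k • sharp η j x = -Complex.I • contract (delbarVec k) x := by
  simp only [sharp_apply, smul_comm _ (-Complex.I), ← Finset.smul_sum]
  congr 1
  simp only [Finset.smul_sum, smul_smul]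
  rw [Finset.sum_comm]
  simp only [← Finset.sum_smul, mul_comm (matrixOf η _ _), sum_inv_matrix hη]
  simp

lemma sum_sharpBar (j : Fin n) (x : Ext n) :
    ∑ k, matrixOf η j k • sharpBar η k x = Complex.I • contract (delVec j) x := by
  simp only [sharpBar_apply, smul_comm _ Complex.I, ← Finset.smul_sum]
  congr 1
  simp only [Finset.smul_sum, smul_smul]
  rw [Finset.sum_comm]
  simp only [← Finset.sum_smul, sum_matrix_inv hη]
  simp

/-- Moving the two contractions in Λ past η leaves three remainders: one is the holomorphic degree,
one the antiholomorphic degree, and the trace of the product of the matrix of η with its inverse is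
the constant n. -/
theorem lef_lam (x : Ext n) :
    lef η (lam η x) - lam η (lef η x) = numDeg x - (n : ℂ) • x := by
  have h1 : ∀ j, sharp η j (contract (delVec j) (lef η x)) =
      lef η (sharp η j (contract (delVec j) x)) - wedge (dz j) (contract (delVec j) x) +
        ∑ k, (matrixOf η j k * (matrixOf η)⁻¹ k j) • x -
        Complex.I • ∑ k, wedge (dzbar k) (matrixOf η j k • sharp η j x) := by
    intro j
    rw [contract_delVec_lef hη, map_add, sharp_lef hη, add_sub_assoc]
    congr 1
    simp only [map_smul, map_sum, sharp_wedge, delbarVec_dzbar, mul_ite, mul_one, mul_zero,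
      Finset.sum_ite_eq', Finset.mem_univ, if_true, smul_sub, Finset.sum_sub_distrib]
    congr 1
    rw [Finset.smul_sum]
    refine Finset.sum_congr rfl fun k _ => ?_
    rw [smul_smul, smul_smul]
    congr 1
    linear_combination -(matrixOf η j k * (matrixOf η)⁻¹ k j) * Complex.I_mul_I
  rw [lam_apply, lam_apply, numDeg, LinearMap.add_apply, numZ_apply, numZbar_apply]
  simp only [h1, Finset.sum_add_distrib, Finset.sum_sub_distrib, map_sum]
  have h2 : ∑ j : Fin n, ∑ k, (matrixOf η j k * (matrixOf η)⁻¹ k j) • x = (n : ℂ) • x := by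
    simp only [← Finset.sum_smul, sum_matrix_inv hη]
    simp
  have h3 : ∑ j : Fin n, Complex.I • ∑ k, wedge (dzbar k) (matrixOf η j k • sharp η j x) =
      ∑ k, wedge (dzbar k) (contract (delbarVec k) x) := by
    rw [← Finset.smul_sum, Finset.sum_comm, Finset.smul_sum]
    refine Finset.sum_congr rfl fun k _ => ?_
    rw [← map_sum, sum_sharp hη, map_smul, smul_smul]
    simp
  rw [h2, h3]
  abel

end Nondeg

lemma numDeg_contract (d : Module.Dual ℂ (Covec n)) (x : Ext n) :
    numDeg (contract d x) = contract d (numDeg x) - contract d x := by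
  induction x using form_induction_wedge with
  | one => simp [contract_one, numDeg_one]
  | add x y hx hy => simp only [map_add, hx, hy]; abel
  | smul c x hx => simp only [map_smul, hx, smul_sub]
  | hw α x hx =>
    simp only [numDeg_wedge, contract_wedge, map_add, map_sub, map_smul, hx]
    abel

lemma numDeg_lam (η x : Ext n) : numDeg (lam η x) = lam η (numDeg x) - (2 : ℂ) • lam η x := by
  simp only [lam_apply, map_sum, sharp_apply, map_smul, numDeg_contract, map_sub, smul_sub,
    Finset.sum_sub_distrib, two_smul]
  abel

/-! ### Nilpotency -/

lemma typeSub_eq_bot_left {p q : ℕ} (hp : n < p) : typeSub n p q = ⊥ := by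
  refine (Submodule.span_eq_bot).2 ?_
  rintro _ ⟨⟨J, K⟩, rfl⟩
  have h : ExteriorAlgebra.ιMulti ℂ p (fun a => (dz (J a) : Covec n)) = 0 := by
    refine AlternatingMap.map_eq_zero_of_not_injective _ _ fun hinj => ?_
    have hJ : Function.Injective J := fun a b hab => hinj (by simp [hab])
    have := Fintype.card_le_of_injective J hJ
    simp at this
    omega
  rw [ExteriorAlgebra.ιMulti_apply] at h
  simp [monomial, h]

lemma form_mem_typeSub {η : Ext n} (hη : IsNondegOneOne η) : η ∈ typeSub n 1 1 := by
  rw [hη.eq_sum]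
  refine Submodule.smul_mem _ _ (Submodule.sum_mem _ fun j _ => Submodule.sum_mem _ fun k _ =>
    Submodule.smul_mem _ _ ?_)
  have h := wedge_dz_mem_typeSub j (wedge_dzbar_mem_typeSub k (one_mem_typeSub (n := n)))
  simpa using h

lemma pow_mem_typeSub {η : Ext n} (hη : IsNondegOneOne η) (r : ℕ) : η ^ r ∈ typeSub n r r := by
  induction r with
  | zero => simpa using one_mem_typeSub
  | succ r ih => rw [pow_succ]; exact mul_mem_typeSub ih (form_mem_typeSub hη)

lemma pow_eq_zero_of_lt {η : Ext n} (hη : IsNondegOneOne η) : η ^ (n + 1) = 0 := by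
  have h := pow_mem_typeSub hη (n + 1)
  rwa [typeSub_eq_bot_left (Nat.lt_succ_self n), Submodule.mem_bot] at h

lemma lef_pow_eq_zero {η : Ext n} (hη : IsNondegOneOne η) : lef η ^ (n + 1) = 0 := by
  rw [LinearMap.pow_mulLeft, pow_eq_zero_of_lt hη, LinearMap.mulLeft_zero_eq_zero]

lemma sharp_mem_typeSub (η : Ext n) {p q : ℕ} (j : Fin n) {x : Ext n} (hx : x ∈ typeSub n p q) :
    sharp η j x ∈ typeSub n p (q - 1) := by
  rw [sharp_apply]
  exact Submodule.smul_mem _ _ (Submodule.sum_mem _ fun k _ => Submodule.smul_mem _ _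
    (contract_delbarVec_mem_typeSub k hx).1)

lemma sharpBar_mem_typeSub (η : Ext n) {p q : ℕ} (j : Fin n) {x : Ext n}
    (hx : x ∈ typeSub n p q) : sharpBar η j x ∈ typeSub n (p - 1) q := by
  rw [sharpBar_apply]
  exact Submodule.smul_mem _ _ (Submodule.sum_mem _ fun k _ => Submodule.smul_mem _ _
    (contract_delVec_mem_typeSub k hx).1)

lemma lam_mem_typeSub (η : Ext n) {p q : ℕ} {x : Ext n} (hx : x ∈ typeSub n p q) :
    lam η x ∈ typeSub n (p - 1) (q - 1) := by
  rw [lam_apply]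
  exact Submodule.sum_mem _ fun j _ => sharp_mem_typeSub η j (contract_delVec_mem_typeSub j hx).1

lemma lam_eq_zero_of_mem (η : Ext n) {q : ℕ} {x : Ext n} (hx : x ∈ typeSub n 0 q) :
    lam η x = 0 := by
  simp only [lam_apply, (contract_delVec_mem_typeSub _ hx).2 rfl, map_zero, Finset.sum_const_zero]

lemma lam_pow_eq_zero (η : Ext n) : lam η ^ (n + 1) = 0 := by
  have h : ∀ (p q : ℕ) (x : Ext n), x ∈ typeSub n p q → (lam η ^ (p + 1)) x = 0 := by
    intro p
    induction p with
    | zero => intro q x hx; rw [zero_add, pow_one]; exact lam_eq_zero_of_mem η hx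
    | succ p ih =>
      intro q x hx
      have h1 := lam_mem_typeSub η hx
      rw [Nat.add_sub_cancel] at h1
      rw [pow_succ (lam η) (p + 1), Module.End.mul_apply, ih _ _ h1]
  have h' : ∀ x : Ext n, (lam η ^ (n + 1)) x = 0 := fun x => by
    induction x using form_type_induction with
    | add x y hx hy => rw [map_add, hx, hy, add_zero]
    | type p q x hp hq hx =>
      rw [show n + 1 = (n - p) + (p + 1) by omega, pow_add, Module.End.mul_apply, h p q x hx,
        map_zero]
  exact LinearMap.ext h'

lemma isNilpotent_lef {η : Ext n} (hη : IsNondegOneOne η) : IsNilpotent (lef η) :=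
  ⟨_, lef_pow_eq_zero hη⟩

lemma isNilpotent_lam (η : Ext n) : IsNilpotent (lam η) := ⟨_, lam_pow_eq_zero η⟩

/-! ### The Weyl element -/

/-- The degree operator, centered at the middle degree. -/
def weightOp : Module.End ℂ (Ext n) := numDeg - (n : ℂ) • 1

lemma weightOp_apply (x : Ext n) : weightOp x = numDeg x - (n : ℂ) • x := rfl

lemma lef_mul_lam_sub {η : Ext n} (hη : IsNondegOneOne η) :
    lef η * lam η - lam η * lef η = weightOp :=
  LinearMap.ext fun x => lef_lam hη x

lemma weightOp_mul_lam_sub (η : Ext n) :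
    weightOp * lam η - lam η * weightOp = -(2 : ℂ) • lam η := by
  refine LinearMap.ext fun x => ?_
  simp only [LinearMap.sub_apply, Module.End.mul_apply, weightOp_apply, LinearMap.smul_apply,
    numDeg_lam, map_sub, map_smul]
  module

lemma weightOp_mul_wedge_sub (α : Covec n) :
    weightOp * wedge α - wedge α * weightOp = wedge α := by
  refine LinearMap.ext fun x => ?_
  simp only [LinearMap.sub_apply, Module.End.mul_apply, weightOp_apply, numDeg_wedge, map_sub,
    map_smul]
  abel

/-- The Weyl element of the Lefschetz `sl₂`. -/
def weyl (η : Ext n) : Module.End ℂ (Ext n) := weylElement (lef η) (lam η)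

section Nondeg

variable {η : Ext n} (hη : IsNondegOneOne η)
include hη

/-- Multiplication by α commutes with L, because η is even, and raises the degree by one: a highest
weight vector of weight one in the endomorphism algebra. -/
lemma weyl_wedge (α : Covec n) :
    weyl η * wedge α = -(lam η * wedge α - wedge α * lam η) * weyl η ∧
      weyl η * (lam η * wedge α - wedge α * lam η) = wedge α * weyl η :=
  weylElement_mul_of_weight_one (lef_mul_lam_sub hη) (weightOp_mul_lam_sub η) (isNilpotent_lef hη)
    (isNilpotent_lam η) (LinearMap.ext fun x => lef_wedge hη α x) (weightOp_mul_wedge_sub α)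

lemma weyl_wedge_dz (j : Fin n) (x : Ext n) :
    weyl η (wedge (dz j) x) = -sharp η j (weyl η x) := by
  have h := LinearMap.congr_fun (weyl_wedge hη (dz j)).1 x
  simp only [Module.End.mul_apply, LinearMap.neg_apply, LinearMap.sub_apply] at h
  rw [h, lam_wedge_dz, add_sub_cancel_left]

lemma weyl_wedge_dzbar (j : Fin n) (x : Ext n) :
    weyl η (wedge (dzbar j) x) = -sharpBar η j (weyl η x) := by
  have h := LinearMap.congr_fun (weyl_wedge hη (dzbar j)).1 x
  simp only [Module.End.mul_apply, LinearMap.neg_apply, LinearMap.sub_apply] at h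
  rw [h, lam_wedge_dzbar, add_sub_cancel_left]

lemma weyl_sharp (j : Fin n) (x : Ext n) :
    weyl η (sharp η j x) = wedge (dz j) (weyl η x) := by
  have h := LinearMap.congr_fun (weyl_wedge hη (dz j)).2 x
  simp only [Module.End.mul_apply, LinearMap.sub_apply] at h
  rwa [lam_wedge_dz, add_sub_cancel_left] at h

lemma weyl_sharpBar (j : Fin n) (x : Ext n) :
    weyl η (sharpBar η j x) = wedge (dzbar j) (weyl η x) := by
  have h := LinearMap.congr_fun (weyl_wedge hη (dzbar j)).2 x
  simp only [Module.End.mul_apply, LinearMap.sub_apply] at h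
  rwa [lam_wedge_dzbar, add_sub_cancel_left] at h

/-- The sl₂ ladder starting from 1, which Λ kills: [L, Λ] acts on η^(r+1) by its degree 2(r + 1)
minus n. -/
lemma lam_pow (r : ℕ) :
    lam η (η ^ (r + 1)) = ((r + 1) * (n - r) : ℂ) • η ^ r := by
  induction r with
  | zero =>
    have h := lef_lam hη 1
    have h1 : lam η (1 : Ext n) = 0 := lam_eq_zero_of_mem η one_mem_typeSub
    rw [h1, map_zero, numDeg_one, LinearMap.mulLeft_apply, mul_one, zero_sub, zero_sub, neg_inj] at h
    simpa using h
  | succ r ih =>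
    have h := lef_lam hη (η ^ (r + 1))
    have hd : numDeg (η ^ (r + 1)) = ((2 * (r + 1) : ℂ)) • η ^ (r + 1) := by
      have h' := pow_mem_typeSub hη (r + 1)
      rw [numDeg, LinearMap.add_apply, numZ_of_mem h', numZbar_of_mem h', ← add_smul]
      congr 1
      push_cast
      ring
    rw [ih, map_smul, hd, LinearMap.mulLeft_apply, LinearMap.mulLeft_apply, ← pow_succ',
      ← pow_succ'] at h
    rw [← sub_eq_zero] at h ⊢
    rw [← neg_eq_zero, ← h]
    push_cast
    module

/-- `ηʳ / r!`. -/
lemma lam_pow_volForm {s : ℕ} (hs : s ≤ n) :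
    (lam η ^ s) (volForm η) =
      (s.factorial : ℂ) • (((n - s).factorial : ℂ)⁻¹ • η ^ (n - s)) := by
  induction s with
  | zero => simp [volForm]
  | succ s ih =>
    rw [pow_succ', Module.End.mul_apply, ih (by omega)]
    obtain ⟨m, hm⟩ : ∃ m, n - s = m + 1 := ⟨n - s - 1, by omega⟩
    have hm' : n - (s + 1) = m := by omega
    have hc : (n : ℂ) - m = s + 1 := by
      have : n = m + s + 1 := by omega
      rw [this]; push_cast; ring
    rw [hm, hm', map_smul, map_smul, lam_pow hη, hc, smul_smul, smul_smul, smul_smul]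
    congr 1
    have h1 : ((m : ℂ) + 1) ≠ 0 := by positivity
    have h2 : (m.factorial : ℂ) ≠ 0 := by exact_mod_cast m.factorial_ne_zero
    rw [Nat.factorial_succ, Nat.factorial_succ]
    push_cast
    field_simp

omit hη in
lemma rat_smul_eq (q : ℚ) (x : Ext n) : q • x = (q : ℂ) • x := by
  rw [← Rat.cast_smul_eq_qsmul ℂ]

lemma exp_lef_one : IsNilpotent.exp (lef η) 1 =
    ∑ r ∈ Finset.range (n + 1), (r.factorial : ℂ)⁻¹ • η ^ r := by
  rw [IsNilpotent.exp_eq_sum (lef_pow_eq_zero hη), LinearMap.sum_apply]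
  refine Finset.sum_congr rfl fun r _ => ?_
  rw [LinearMap.smul_apply, rat_smul_eq, LinearMap.pow_mulLeft, LinearMap.mulLeft_apply, mul_one]
  push_cast
  rfl

/-- Λˢ/s! takes ηⁿ/n! to η^(n−s)/(n−s)!, so both sides are ∑ ηʳ/r!, summed in opposite orders. -/
lemma exp_lam_volForm : IsNilpotent.exp (lam η) (volForm η) = IsNilpotent.exp (lef η) 1 := by
  rw [exp_lef_one hη, IsNilpotent.exp_eq_sum (lam_pow_eq_zero η), LinearMap.sum_apply,
    ← Finset.sum_range_reflect]
  refine Finset.sum_congr rfl fun r hr => ?_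
  have hr' : r ≤ n := Nat.lt_succ_iff.1 (Finset.mem_range.1 hr)
  have e : n + 1 - 1 - r = n - r := by omega
  rw [LinearMap.smul_apply, rat_smul_eq, e, lam_pow_volForm hη (Nat.sub_le n r), Nat.sub_sub_self hr',
    smul_smul]
  push_cast
  rw [inv_mul_cancel₀ (by exact_mod_cast (n - r).factorial_ne_zero), one_smul]

lemma lef_volForm : lef η (volForm η) = 0 := by
  rw [volForm, map_smul, LinearMap.mulLeft_apply, ← pow_succ', pow_eq_zero_of_lt hη, smul_zero]

lemma exp_lef_volForm : IsNilpotent.exp (lef η) (volForm η) = volForm η := by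
  have h : (lef η ^ 1) • volForm η = 0 := by rw [pow_one]; exact lef_volForm hη
  have h' := IsNilpotent.exp_smul_eq_sum h (isNilpotent_lef hη)
  simpa using h'

/-- Writing e^L 1 as e^Λ(ηⁿ/n!), the middle factor e^{−Λ} of W cancels it, and the last factor e^L
fixes top degree. -/
lemma weyl_one : weyl η 1 = volForm η := by
  rw [weyl, weylElement, Module.End.mul_apply, Module.End.mul_apply, ← exp_lam_volForm hη,
    ← Module.End.mul_apply (IsNilpotent.exp (-lam η)),
    IsNilpotent.exp_neg_mul_exp_self (isNilpotent_lam η), Module.End.one_apply,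
    exp_lef_volForm hη]

omit hη in
lemma neg_pow_apply (X : Module.End ℂ (Ext n)) (m : ℕ) (x : Ext n) :
    ((-X) ^ m) x = (-1 : ℂ) ^ m • (X ^ m) x := by
  rw [(neg_one_smul ℂ X).symm, smul_pow, LinearMap.smul_apply]

omit hη in
lemma neg_pow_eq_zero {X : Module.End ℂ (Ext n)} {m : ℕ} (h : X ^ m = 0) : (-X) ^ m = 0 :=
  LinearMap.ext fun x => by rw [neg_pow_apply, h, LinearMap.zero_apply, smul_zero]

lemma exp_neg_lam_volForm : IsNilpotent.exp (-lam η) (volForm η) =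
    (-1 : ℂ) ^ n • IsNilpotent.exp (-lef η) 1 := by
  have hL : (-lef η) ^ (n + 1) = 0 := neg_pow_eq_zero (lef_pow_eq_zero hη)
  have hΛ : (-lam η) ^ (n + 1) = 0 := neg_pow_eq_zero (lam_pow_eq_zero η)
  rw [IsNilpotent.exp_eq_sum hL, IsNilpotent.exp_eq_sum hΛ, LinearMap.sum_apply,
    LinearMap.sum_apply, ← Finset.sum_range_reflect, Finset.smul_sum]
  refine Finset.sum_congr rfl fun r hr => ?_
  have hr' : r ≤ n := Nat.lt_succ_iff.1 (Finset.mem_range.1 hr)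
  have e : n + 1 - 1 - r = n - r := by omega
  rw [LinearMap.smul_apply, LinearMap.smul_apply, rat_smul_eq, rat_smul_eq, e, neg_pow_apply,
    neg_pow_apply,
    lam_pow_volForm hη (Nat.sub_le n r), Nat.sub_sub_self hr',
    LinearMap.pow_mulLeft, LinearMap.mulLeft_apply, mul_one]
  simp only [smul_smul]
  congr 1
  have h1 : ((n - r).factorial : ℂ) ≠ 0 := by exact_mod_cast (n - r).factorial_ne_zero
  have h2 : (-1 : ℂ) ^ n = (-1) ^ (n - r) * (-1) ^ r := by rw [← pow_add, Nat.sub_add_cancel hr']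
  have h3 : (-1 : ℂ) ^ r * (-1) ^ r = 1 := by rw [← mul_pow]; simp
  rw [h2]
  push_cast
  field_simp
  linear_combination -h3

lemma weyl_volForm : weyl η (volForm η) = (-1 : ℂ) ^ n • 1 := by
  rw [weyl, weylElement, Module.End.mul_apply, Module.End.mul_apply, exp_lef_volForm hη,
    exp_neg_lam_volForm hη, map_smul, ← Module.End.mul_apply (IsNilpotent.exp (lef η)),
    IsNilpotent.exp_mul_exp_neg_self (isNilpotent_lef hη), Module.End.one_apply]

end Nondeg

/-! ### The symplectic star operator -/

/-- The anti-involution with value `-α` on covectors. -/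
def antiInv : Module.End ℂ (Ext n) :=
  (CliffordAlgebra.reverse : Ext n →ₗ[ℂ] Ext n) ∘ₗ (involution : Ext n →ₐ[ℂ] Ext n).toLinearMap

lemma antiInv_apply (x : Ext n) : antiInv x = CliffordAlgebra.reverse (involution x) := rfl

lemma antiInv_one : antiInv (1 : Ext n) = 1 := by simp [antiInv_apply]

lemma antiInv_involution (x : Ext n) : antiInv (involution x) = involution (antiInv x) := by
  rw [antiInv_apply, antiInv_apply]
  exact CliffordAlgebra.reverse_involute (involution x)

lemma antiInv_mul (x y : Ext n) : antiInv (x * y) = antiInv y * antiInv x := by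
  simp [antiInv_apply, CliffordAlgebra.reverse.map_mul]

lemma antiInv_ι (α : Covec n) :
    antiInv (ExteriorAlgebra.ι ℂ α) = -ExteriorAlgebra.ι ℂ α := by
  have h1 : involution (ExteriorAlgebra.ι ℂ α) = -ExteriorAlgebra.ι ℂ α :=
    CliffordAlgebra.involute_ι _
  have h2 : CliffordAlgebra.reverse (ExteriorAlgebra.ι ℂ α) = ExteriorAlgebra.ι ℂ α :=
    CliffordAlgebra.reverse_ι _
  rw [antiInv_apply, h1, map_neg, h2]

lemma antiInv_wedge (α : Covec n) (x : Ext n) :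
    antiInv (wedge α x) = -wedge α (involution (antiInv x)) := by
  rw [LinearMap.mulLeft_apply, antiInv_mul, antiInv_ι, mul_neg, mul_ι_eq]

lemma antiInv_contract (d : Module.Dual ℂ (Covec n)) (x : Ext n) :
    antiInv (contract d x) = contract d (antiInv (involution x)) := by
  induction x using form_induction_wedge with
  | one => simp [contract_one, antiInv_one]
  | add x y hx hy => simp only [map_add, hx, hy]
  | smul c x hx => simp only [map_smul, hx]
  | hw α x hx =>
    rw [contract_wedge, map_sub, map_smul, antiInv_wedge, hx, involution_wedge, map_neg,
      antiInv_wedge, neg_neg, contract_wedge, involution_contract, antiInv_involution,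
      involution_involution, map_neg, neg_neg]

/-- The symplectic star operator, through the Weyl element. -/
def starOp (η : Ext n) : Module.End ℂ (Ext n) := weyl η * antiInv

lemma starOp_apply (η x : Ext n) : starOp η x = weyl η (antiInv x) := rfl

lemma involution_sharp (η : Ext n) (j : Fin n) (x : Ext n) :
    involution (sharp η j x) = -sharp η j (involution x) := by
  rw [sharp_apply, sharp_apply]
  simp only [map_smul, map_sum, involution_contract, smul_neg, Finset.sum_neg_distrib]

lemma involution_sharpBar (η : Ext n) (j : Fin n) (x : Ext n) :
    involution (sharpBar η j x) = -sharpBar η j (involution x) := by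
  rw [sharpBar_apply, sharpBar_apply]
  simp only [map_smul, map_sum, involution_contract, smul_neg, Finset.sum_neg_distrib]

lemma antiInv_sharp (η : Ext n) (j : Fin n) (x : Ext n) :
    antiInv (sharp η j x) = sharp η j (antiInv (involution x)) := by
  rw [sharp_apply, sharp_apply]
  simp only [map_smul, map_sum, antiInv_contract]

lemma antiInv_sharpBar (η : Ext n) (j : Fin n) (x : Ext n) :
    antiInv (sharpBar η j x) = sharpBar η j (antiInv (involution x)) := by
  rw [sharpBar_apply, sharpBar_apply]
  simp only [map_smul, map_sum, antiInv_contract]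

section Nondeg

variable {η : Ext n} (hη : IsNondegOneOne η)
include hη

lemma starOp_one : starOp η 1 = volForm η := by
  rw [starOp_apply, antiInv_one, weyl_one hη]

/-- The sign that `antiInv` puts on a covector cancels the minus sign in W A W⁻¹ = −[Λ, A]. The
involution that remains comes from the reversal of the order of factors. -/
lemma starOp_wedge_dz (j : Fin n) (x : Ext n) :
    starOp η (wedge (dz j) x) = sharp η j (starOp η (involution x)) := by
  rw [starOp_apply, starOp_apply, antiInv_wedge, map_neg, weyl_wedge_dz hη, neg_neg,
    antiInv_involution]

lemma starOp_wedge_dzbar (j : Fin n) (x : Ext n) :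
    starOp η (wedge (dzbar j) x) = sharpBar η j (starOp η (involution x)) := by
  rw [starOp_apply, starOp_apply, antiInv_wedge, map_neg, weyl_wedge_dzbar hη, neg_neg,
    antiInv_involution]

lemma starOp_sharp (j : Fin n) (x : Ext n) :
    starOp η (sharp η j x) = wedge (dz j) (starOp η (involution x)) := by
  rw [starOp_apply, starOp_apply, antiInv_sharp, weyl_sharp hη]

lemma starOp_sharpBar (j : Fin n) (x : Ext n) :
    starOp η (sharpBar η j x) = wedge (dzbar j) (starOp η (involution x)) := by
  rw [starOp_apply, starOp_apply, antiInv_sharpBar, weyl_sharpBar hη]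

lemma involution_volForm : involution (volForm η) = volForm η := by
  have h : volForm η ∈ typeSub n n n := Submodule.smul_mem _ _ (pow_mem_typeSub hη n)
  rw [involution_of_mem h, ← two_mul, pow_mul]
  simp

lemma involution_starOp (x : Ext n) : involution (starOp η x) = starOp η (involution x) := by
  induction x using form_induction with
  | one => rw [map_one involution, starOp_one hη, involution_volForm hη]
  | add x y hx hy => simp only [map_add, hx, hy]
  | smul c x hx => simp only [map_smul, hx]
  | hz j x hx =>
    have hx' : involution (starOp η (involution x)) = starOp η x := by
      rw [← hx, involution_involution]
    rw [starOp_wedge_dz hη, involution_sharp, hx', involution_wedge, map_neg,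
      starOp_wedge_dz hη, involution_involution]
  | hzb j x hx =>
    have hx' : involution (starOp η (involution x)) = starOp η x := by
      rw [← hx, involution_involution]
    rw [starOp_wedge_dzbar hη, involution_sharpBar, hx', involution_wedge, map_neg,
      starOp_wedge_dzbar hη, involution_involution]

lemma antiInv_volForm : antiInv (volForm η) = (-1 : ℂ) ^ n • volForm η := by
  have h : antiInv η = -η := by
    conv_lhs => rw [hη.eq_sum]
    conv_rhs => rw [hη.eq_sum]
    have h1 : ∀ α β : Covec n, antiInv (ExteriorAlgebra.ι ℂ α * ExteriorAlgebra.ι ℂ β) =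
        -(ExteriorAlgebra.ι ℂ α * ExteriorAlgebra.ι ℂ β) := by
      intro α β
      have h2 := antiInv_wedge α (ExteriorAlgebra.ι ℂ β)
      rw [antiInv_ι, map_neg,
        show involution (ExteriorAlgebra.ι ℂ β) = _ from CliffordAlgebra.involute_ι _] at h2
      simpa using h2
    simp only [map_smul, map_sum, h1, smul_neg, Finset.sum_neg_distrib]
  have h2 : ∀ r : ℕ, antiInv (η ^ r) = (-1 : ℂ) ^ r • η ^ r := by
    intro r
    induction r with
    | zero => simp [antiInv_one]
    | succ r ih =>
      rw [pow_succ, antiInv_mul, h, ih, neg_mul, mul_smul_comm, ← pow_succ', ← pow_succ, ← neg_smul]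
      congr 1
      ring
  rw [volForm, map_smul, h2, smul_comm]

/-- The star turns a wedge into a sharp and the sharp back into the same wedge. In degree zero, W
sends ηⁿ/n! to (−1)ⁿ, and `antiInv` contributes the same sign. -/
theorem starOp_starOp (x : Ext n) : starOp η (starOp η x) = x := by
  induction x using form_induction with
  | one =>
    rw [starOp_one hη, starOp_apply, antiInv_volForm hη, map_smul, weyl_volForm hη, smul_smul,
      ← mul_pow]
    simp
  | add x y hx hy => simp only [map_add, hx, hy]
  | smul c x hx => simp only [map_smul, hx]
  | hz j x hx =>
    rw [starOp_wedge_dz hη, starOp_sharp hη, involution_starOp hη, involution_involution, hx]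
  | hzb j x hx =>
    rw [starOp_wedge_dzbar hη, starOp_sharpBar hη, involution_starOp hη, involution_involution, hx]

/-- Each summand dzⱼ ∧ dz̄ₖ of η becomes two sharps; the matrix of η then undoes the inverse matrix
in one of them. With ** = 1 this identifies *L* with Λ. -/
lemma starOp_lef (x : Ext n) : starOp η (lef η x) = lam η (starOp η x) := by
  have h : ∀ j k, starOp η (wedge (dz j) (wedge (dzbar k) x)) =
      -sharp η j (sharpBar η k (starOp η x)) := by
    intro j k
    rw [starOp_wedge_dz hη, involution_wedge, map_neg, starOp_wedge_dzbar hη, map_neg,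
      involution_involution]
  rw [lef_apply hη, lam_apply]
  simp only [map_smul, map_sum, h]
  rw [Finset.smul_sum]
  refine Finset.sum_congr rfl fun j _ => ?_
  have h2 := sum_sharpBar hη j (starOp η x)
  have h3 : ∑ k, matrixOf η j k • -sharp η j (sharpBar η k (starOp η x)) =
      -sharp η j (∑ k, matrixOf η j k • sharpBar η k (starOp η x)) := by
    simp only [map_sum, map_smul, smul_neg, Finset.sum_neg_distrib]
  rw [h3, h2, map_smul, smul_neg, smul_smul, Complex.I_mul_I]
  simp

/-- A (1,1)-form identifies dz with ∂/∂z̄, so the star exchanges the roles of p and q; conjugating ψ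
beforehand restores them. -/
lemma starOp_mem_typeSub {p q : ℕ} {x : Ext n} (hx : x ∈ typeSub n p q) (hp : p ≤ n)
    (hq : q ≤ n) : starOp η x ∈ typeSub n (n - q) (n - p) := by
  have key : p ≤ n → q ≤ n → starOp η x ∈ typeSub n (n - q) (n - p) := by
    refine typeSub_induction (P := fun p q x => p ≤ n → q ≤ n →
      starOp η x ∈ typeSub n (n - q) (n - p)) (fun p q _ _ => by simp)
      (fun p q x y hx hy hp hq => by rw [map_add]; exact add_mem (hx hp hq) (hy hp hq))
      (fun p q c x hx hp hq => by rw [map_smul]; exact Submodule.smul_mem _ _ (hx hp hq))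
      (fun _ _ => ?_) (fun p q j x hx ih hp hq => ?_) (fun q j x hx ih hp hq => ?_) hx
    · rw [starOp_one hη]
      exact Submodule.smul_mem _ _ (pow_mem_typeSub hη n)
    · rw [starOp_wedge_dz hη, involution_of_mem hx, map_smul, map_smul]
      exact Submodule.smul_mem _ _ (sharp_mem_typeSub η j (ih (by omega) hq))
    · rw [starOp_wedge_dzbar hη, involution_of_mem hx, map_smul, map_smul]
      exact Submodule.smul_mem _ _ (sharpBar_mem_typeSub η j (ih hp (by omega)))
  exact key hp hq

end Nondeg

/-! ### Pullbacks -/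

/-- The pullback of covectors under a real-linear map. -/
def pullCovec (A : (Fin n → ℂ) →L[ℝ] (Fin n → ℂ)) : Covec n →ₗ[ℂ] Covec n where
  toFun := fun α : Covec n => α.comp A
  map_add' := fun _ _ => rfl
  map_smul' := fun _ _ => rfl

lemma pullCovec_apply (A : (Fin n → ℂ) →L[ℝ] (Fin n → ℂ)) (α : Covec n) :
    pullCovec A α = α.comp A := rfl

/-- The pullback of forms under a real-linear map. -/
def pullback (A : (Fin n → ℂ) →L[ℝ] (Fin n → ℂ)) : Ext n →ₐ[ℂ] Ext n :=
  ExteriorAlgebra.map (pullCovec A)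

lemma pullback_ι (A : (Fin n → ℂ) →L[ℝ] (Fin n → ℂ)) (α : Covec n) :
    pullback A (ExteriorAlgebra.ι ℂ α) = ExteriorAlgebra.ι ℂ (α.comp A) :=
  ExteriorAlgebra.map_apply_ι _ _

lemma pullback_wedge (A : (Fin n → ℂ) →L[ℝ] (Fin n → ℂ)) (α : Covec n) (x : Ext n) :
    pullback A (wedge α x) = wedge (α.comp A) (pullback A x) := by
  rw [LinearMap.mulLeft_apply, map_mul, pullback_ι, LinearMap.mulLeft_apply]

lemma contract_pullback (A : (Fin n → ℂ) →L[ℝ] (Fin n → ℂ)) (d : Module.Dual ℂ (Covec n))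
    (x : Ext n) : contract d (pullback A x) = pullback A (contract (d ∘ₗ pullCovec A) x) := by
  induction x using form_induction_wedge with
  | one => rw [map_one, contract_one, contract_one, map_zero]
  | add x y hx hy => simp only [map_add, hx, hy]
  | smul c x hx => simp only [map_smul, hx]
  | hw α x hx =>
    rw [contract_wedge, pullback_wedge, contract_wedge, map_sub, map_smul, pullback_wedge, hx]
    rfl

lemma pullback_pullback (A B : (Fin n → ℂ) →L[ℝ] (Fin n → ℂ)) (x : Ext n) :
    pullback A (pullback B x) = pullback (B.comp A) x := by
  induction x using form_induction_wedge with
  | one => simp only [map_one]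
  | add x y hx hy => simp only [map_add, hx, hy]
  | smul c x hx => simp only [map_smul, hx]
  | hw α x hx => rw [pullback_wedge, pullback_wedge, pullback_wedge, hx]; rfl

lemma pullback_id (x : Ext n) : pullback (ContinuousLinearMap.id ℝ (Fin n → ℂ)) x = x := by
  induction x using form_induction_wedge with
  | one => simp only [map_one]
  | add x y hx hy => simp only [map_add, hx, hy]
  | smul c x hx => simp only [map_smul, hx]
  | hw α x hx => rw [pullback_wedge, hx]; rfl

lemma pullback_conjExt (A : (Fin n → ℂ) →L[ℝ] (Fin n → ℂ)) (x : Ext n) :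
    pullback A (conjExt x) = conjExt (pullback A x) := by
  induction x using form_induction_wedge with
  | one => simp only [map_one]
  | add x y hx hy => simp only [map_add, hx, hy]
  | smul c x hx => simp only [map_smul, conjExt_smul, hx]
  | hw α x hx => rw [pullback_wedge, conjExt_wedge, conjExt_wedge, pullback_wedge, hx]; rfl

lemma pullback_involution (A : (Fin n → ℂ) →L[ℝ] (Fin n → ℂ)) (x : Ext n) :
    pullback A (involution x) = involution (pullback A x) := by
  induction x using form_induction_wedge with
  | one => simp only [map_one]
  | add x y hx hy => simp only [map_add, hx, hy]
  | smul c x hx => simp only [map_smul, hx]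
  | hw α x hx => rw [pullback_wedge, involution_wedge, involution_wedge, map_neg, pullback_wedge, hx]

lemma pullback_antiInv (A : (Fin n → ℂ) →L[ℝ] (Fin n → ℂ)) (x : Ext n) :
    pullback A (antiInv x) = antiInv (pullback A x) := by
  induction x using form_induction_wedge with
  | one => simp only [map_one, antiInv_one]
  | add x y hx hy => simp only [map_add, hx, hy]
  | smul c x hx => simp only [map_smul, hx]
  | hw α x hx =>
    rw [pullback_wedge, antiInv_wedge, antiInv_wedge, map_neg, pullback_wedge, ← hx,
      pullback_involution]

/-! ### Pullback under complex-linear maps and naturality of Λ and of the star. -/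

section Holomorphic

variable (A : (Fin n → ℂ) →L[ℂ] (Fin n → ℂ))

/-- The matrix of a complex-linear map. -/
def cmatrix : Matrix (Fin n) (Fin n) ℂ := Matrix.of fun k j => A (ex j) k

lemma map_ey (j : Fin n) : A (ey j) = Complex.I • A (ex j) := by
  rw [← map_smul]
  congr 1
  ext k
  by_cases h : k = j
  · subst h; simp [ex, ey]
  · simp [ex, ey, h]

lemma dual_comp_pullCovec (d : Module.Dual ℂ (Covec n)) (B : (Fin n → ℂ) →L[ℝ] (Fin n → ℂ)) :
    d ∘ₗ pullCovec B = ∑ k, d ((dz k).comp B) • delVec k + ∑ k, d ((dzbar k).comp B) • delbarVec k :=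
  covec_dual_eq_sum _

lemma delVec_dz_comp (j k : Fin n) :
    delVec j ((dz k).comp (A.restrictScalars ℝ)) = cmatrix A k j := by
  rw [delVec_apply]
  simp [dz, map_ey, cmatrix]
  linear_combination (-(A (ex j) k) / 2) * Complex.I_mul_I

lemma delbarVec_dz_comp (j k : Fin n) :
    delbarVec j ((dz k).comp (A.restrictScalars ℝ)) = 0 := by
  rw [delbarVec_apply]
  simp [dz, map_ey]
  linear_combination (A (ex j) k) * Complex.I_mul_I

lemma dzbar_comp (B : (Fin n → ℂ) →L[ℝ] (Fin n → ℂ)) (k : Fin n) :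
    (dzbar k).comp B = conjCovec ((dz k).comp B) := rfl

lemma delVec_dzbar_comp (j k : Fin n) :
    delVec j ((dzbar k).comp (A.restrictScalars ℝ)) = 0 := by
  rw [dzbar_comp, delVec_conjCovec, delbarVec_dz_comp, map_zero]

lemma delbarVec_dzbar_comp (j k : Fin n) :
    delbarVec j ((dzbar k).comp (A.restrictScalars ℝ)) = conj (cmatrix A k j) := by
  rw [dzbar_comp, delbarVec_conjCovec, delVec_dz_comp]

lemma zero_smul_covec (α : Covec n) : (0 : ℂ) • α = 0 := zero_smul ℂ α

lemma dz_comp (k : Fin n) :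
    (dz k).comp (A.restrictScalars ℝ) = ∑ j, cmatrix A k j • dz j := by
  conv_lhs => rw [covec_eq_sum ((dz k).comp (A.restrictScalars ℝ))]
  simp only [delVec_dz_comp, delbarVec_dz_comp, zero_smul_covec, Finset.sum_const_zero, add_zero]

lemma dzbar_comp_eq_sum (k : Fin n) :
    (dzbar k).comp (A.restrictScalars ℝ) = ∑ j, conj (cmatrix A k j) • dzbar j := by
  conv_lhs => rw [covec_eq_sum ((dzbar k).comp (A.restrictScalars ℝ))]
  simp only [delVec_dzbar_comp, delbarVec_dzbar_comp, zero_smul_covec, Finset.sum_const_zero, zero_add]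

lemma contract_sum_smul (s : Fin n → Module.Dual ℂ (Covec n)) (a : Fin n → ℂ) (x : Ext n) :
    contract (∑ k, a k • s k) x = ∑ k, a k • contract (s k) x := by
  simp only [contract, map_sum, map_smul, LinearMap.sum_apply, LinearMap.smul_apply]

lemma contract_delVec_pullback (j : Fin n) (x : Ext n) :
    contract (delVec j) (pullback (A.restrictScalars ℝ) x) =
      ∑ k, cmatrix A k j • pullback (A.restrictScalars ℝ) (contract (delVec k) x) := by
  rw [contract_pullback, dual_comp_pullCovec]
  simp only [delVec_dz_comp, delVec_dzbar_comp, zero_smul, Finset.sum_const_zero, add_zero]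
  rw [contract_sum_smul]
  simp only [map_sum, map_smul]

lemma contract_delbarVec_pullback (j : Fin n) (x : Ext n) :
    contract (delbarVec j) (pullback (A.restrictScalars ℝ) x) =
      ∑ k, conj (cmatrix A k j) • pullback (A.restrictScalars ℝ) (contract (delbarVec k) x) := by
  rw [contract_pullback, dual_comp_pullCovec]
  simp only [delbarVec_dz_comp, delbarVec_dzbar_comp, zero_smul, Finset.sum_const_zero, zero_add]
  rw [contract_sum_smul]
  simp only [map_sum, map_smul]

lemma matrixOf_apply (η : Ext n) (j k : Fin n) :
    matrixOf η j k =
      -Complex.I * scalarPart (contract (delbarVec k) (contract (delVec j) η)) := by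
  simp [matrixOf, component, evalOn]

lemma scalarPart_pullback (B : (Fin n → ℂ) →L[ℝ] (Fin n → ℂ)) (x : Ext n) :
    scalarPart (pullback B x) = scalarPart x := by
  induction x using form_induction_wedge with
  | one => simp only [map_one]
  | add x y hx hy => simp only [map_add, hx, hy]
  | smul c x hx => simp only [map_smul, hx]
  | hw α x hx => rw [pullback_wedge, scalarPart_wedge, scalarPart_wedge]

lemma matrixOf_pullback (η : Ext n) :
    matrixOf (pullback (A.restrictScalars ℝ) η) =
      (cmatrix A).transpose * matrixOf η * (cmatrix A).map conj := by
  ext j k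
  rw [matrixOf_apply, contract_delVec_pullback]
  simp only [map_sum, map_smul, contract_delbarVec_pullback, scalarPart_pullback]
  simp only [Matrix.mul_apply, Matrix.transpose_apply, Matrix.map_apply, matrixOf_apply,
    Finset.mul_sum, Finset.sum_mul, smul_eq_mul]
  rw [Finset.sum_comm]
  refine Finset.sum_congr rfl fun l _ => Finset.sum_congr rfl fun m _ => ?_
  ring

variable {A}

lemma det_cmatrix_ne_zero {A' : (Fin n → ℂ) →L[ℂ] (Fin n → ℂ)}
    (h : A.comp A' = ContinuousLinearMap.id ℂ (Fin n → ℂ)) : (cmatrix A).det ≠ 0 := by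
  have hA : ∀ B : (Fin n → ℂ) →L[ℂ] (Fin n → ℂ), cmatrix B = LinearMap.toMatrix' B.toLinearMap := by
    intro B
    ext i j
    simp [cmatrix, ex, LinearMap.toMatrix'_apply]
  have h1 : cmatrix A * cmatrix A' = 1 := by
    rw [hA, hA, ← LinearMap.toMatrix'_comp, ← LinearMap.toMatrix'_id]
    congr 1
    exact congrArg (fun B : (Fin n → ℂ) →L[ℂ] (Fin n → ℂ) => B.toLinearMap) h
  intro h0
  have := congrArg Matrix.det h1
  rw [Matrix.det_mul, h0, zero_mul, Matrix.det_one] at this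
  exact zero_ne_one this

variable (hA : (cmatrix A).det ≠ 0)
include hA

lemma det_cmatrix_conj_ne_zero : ((cmatrix A).map conj).det ≠ 0 := by
  have : ((cmatrix A).map conj).det = conj (cmatrix A).det :=
    ((starRingEnd ℂ).map_det (cmatrix A)).symm
  rw [this]
  simpa using hA

lemma IsNondegOneOne.pullback {η : Ext n} (hη : IsNondegOneOne η) :
    IsNondegOneOne (pullback (A.restrictScalars ℝ) η) := by
  refine ⟨?_, ?_⟩
  · conv_lhs => rw [hη.eq_sum]
    rw [matrixOf_pullback, map_smul]
    congr 1
    simp only [map_sum, map_smul, map_mul, pullback_ι, dz_comp, dzbar_comp_eq_sum,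
      Matrix.mul_apply, Matrix.transpose_apply, Matrix.map_apply, Finset.sum_mul, Finset.mul_sum,
      smul_mul_assoc, mul_smul_comm, Finset.smul_sum, Finset.sum_smul, smul_smul]
    have e : ∀ f : Fin n → Fin n → Fin n → Fin n → Ext n,
        ∑ l, ∑ m, ∑ j, ∑ k, f l m j k = ∑ j, ∑ k, ∑ m, ∑ l, f l m j k := by
      intro f
      calc ∑ l, ∑ m, ∑ j, ∑ k, f l m j k = ∑ l, ∑ j, ∑ m, ∑ k, f l m j k :=
            Finset.sum_congr rfl fun l _ => Finset.sum_comm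
        _ = ∑ j, ∑ l, ∑ m, ∑ k, f l m j k := Finset.sum_comm
        _ = ∑ j, ∑ l, ∑ k, ∑ m, f l m j k :=
            Finset.sum_congr rfl fun j _ => Finset.sum_congr rfl fun l _ => Finset.sum_comm
        _ = ∑ j, ∑ k, ∑ l, ∑ m, f l m j k := Finset.sum_congr rfl fun j _ => Finset.sum_comm
        _ = _ := Finset.sum_congr rfl fun j _ => Finset.sum_congr rfl fun k _ => Finset.sum_comm
    rw [e, Finset.sum_comm]
    refine Finset.sum_congr rfl fun j _ => Finset.sum_congr rfl fun k _ =>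
      Finset.sum_congr rfl fun m _ => Finset.sum_congr rfl fun l _ => ?_
    congr 1
    ring
  · rw [matrixOf_pullback, Matrix.det_mul, Matrix.det_mul, Matrix.det_transpose]
    exact mul_ne_zero (mul_ne_zero hA hη.det_ne_zero) (det_cmatrix_conj_ne_zero hA)

lemma inv_matrixOf_pullback {η : Ext n} (hη : IsNondegOneOne η) :
    (cmatrix A).map conj * (matrixOf (MinkowskiKahler.pullback (A.restrictScalars ℝ) η))⁻¹ *
      (cmatrix A).transpose = (matrixOf η)⁻¹ := by
  have h1 : IsUnit ((cmatrix A).map conj).det :=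
    isUnit_iff_ne_zero.2 (det_cmatrix_conj_ne_zero hA)
  have h2 : IsUnit (cmatrix A).transpose.det := by
    rw [Matrix.det_transpose]; exact isUnit_iff_ne_zero.2 hA
  rw [matrixOf_pullback, Matrix.mul_inv_rev, Matrix.mul_inv_rev, ← mul_assoc,
    Matrix.mul_nonsing_inv _ h1, one_mul, mul_assoc, Matrix.nonsing_inv_mul _ h2, mul_one]

lemma sum_inv_matrixOf_pullback {η : Ext n} (hη : IsNondegOneOne η) (m l : Fin n) :
    ∑ j, ∑ k, cmatrix A l j *
      (matrixOf (MinkowskiKahler.pullback (A.restrictScalars ℝ) η))⁻¹ k j * conj (cmatrix A m k) =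
      (matrixOf η)⁻¹ m l := by
  rw [← inv_matrixOf_pullback hA hη, Matrix.mul_apply]
  refine Finset.sum_congr rfl fun j _ => ?_
  rw [Matrix.mul_apply, Finset.sum_mul]
  refine Finset.sum_congr rfl fun k _ => ?_
  rw [Matrix.map_apply, Matrix.transpose_apply]
  ring

omit hA in
lemma lam_eq_sum (η x : Ext n) : lam η x = -Complex.I • ∑ j, ∑ k, (matrixOf η)⁻¹ k j •
    contract (delbarVec k) (contract (delVec j) x) := by
  simp only [lam_apply, sharp_apply, ← Finset.smul_sum]

/-- The two contractions bring in the matrix of A and its conjugate, and the inverse matrix of the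
pulled back form transforms contragrediently, so these factors cancel. -/
lemma pullback_lam {η : Ext n} (hη : IsNondegOneOne η) (x : Ext n) :
    MinkowskiKahler.pullback (A.restrictScalars ℝ) (lam η x) =
      lam (MinkowskiKahler.pullback (A.restrictScalars ℝ) η)
        (MinkowskiKahler.pullback (A.restrictScalars ℝ) x) := by
  rw [lam_eq_sum, lam_eq_sum, map_smul]
  congr 1
  simp only [contract_delVec_pullback, contract_delbarVec_pullback, map_sum, map_smul,
    Finset.smul_sum, smul_smul, ← sum_inv_matrixOf_pullback hA hη, Finset.sum_smul]
  have e : ∀ f : Fin n → Fin n → Fin n → Fin n → Ext n,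
      ∑ l, ∑ m, ∑ j, ∑ k, f l m j k = ∑ j, ∑ k, ∑ l, ∑ m, f l m j k := by
    intro f
    calc ∑ l, ∑ m, ∑ j, ∑ k, f l m j k = ∑ l, ∑ j, ∑ m, ∑ k, f l m j k :=
          Finset.sum_congr rfl fun l _ => Finset.sum_comm
      _ = ∑ j, ∑ l, ∑ m, ∑ k, f l m j k := Finset.sum_comm
      _ = ∑ j, ∑ l, ∑ k, ∑ m, f l m j k :=
          Finset.sum_congr rfl fun j _ => Finset.sum_congr rfl fun l _ => Finset.sum_comm
      _ = ∑ j, ∑ k, ∑ l, ∑ m, f l m j k := Finset.sum_congr rfl fun j _ => Finset.sum_comm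
  rw [e]
  refine Finset.sum_congr rfl fun j _ => Finset.sum_congr rfl fun k _ =>
    Finset.sum_congr rfl fun m _ => Finset.sum_congr rfl fun l _ => ?_
  congr 1
  ring

lemma pullback_weyl {η : Ext n} (hη : IsNondegOneOne η) (x : Ext n) :
    MinkowskiKahler.pullback (A.restrictScalars ℝ) (weyl η x) =
      weyl (MinkowskiKahler.pullback (A.restrictScalars ℝ) η)
        (MinkowskiKahler.pullback (A.restrictScalars ℝ) x) := by
  have hη' := hη.pullback hA
  have h1 := Module.End.commute_exp_left_of_commute (isNilpotent_lef hη) (isNilpotent_lef hη')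
    (g := (MinkowskiKahler.pullback (A.restrictScalars ℝ)).toLinearMap)
    (LinearMap.ext fun x => by simp)
  have h2 := Module.End.commute_exp_left_of_commute (isNilpotent_lam η).neg
    (isNilpotent_lam (MinkowskiKahler.pullback (A.restrictScalars ℝ) η)).neg
    (g := (MinkowskiKahler.pullback (A.restrictScalars ℝ)).toLinearMap)
    (LinearMap.ext fun x => by
      simp only [LinearMap.comp_apply, LinearMap.neg_apply, AlgHom.toLinearMap_apply, map_neg,
        pullback_lam hA hη])
  have h1' : ∀ x, MinkowskiKahler.pullback (A.restrictScalars ℝ) (IsNilpotent.exp (lef η) x) =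
      IsNilpotent.exp (lef (MinkowskiKahler.pullback (A.restrictScalars ℝ) η))
        (MinkowskiKahler.pullback (A.restrictScalars ℝ) x) :=
    fun x => (LinearMap.congr_fun h1 x).symm
  have h2' : ∀ x, MinkowskiKahler.pullback (A.restrictScalars ℝ) (IsNilpotent.exp (-lam η) x) =
      IsNilpotent.exp (-lam (MinkowskiKahler.pullback (A.restrictScalars ℝ) η))
        (MinkowskiKahler.pullback (A.restrictScalars ℝ) x) :=
    fun x => (LinearMap.congr_fun h2 x).symm
  simp only [weyl, weylElement, Module.End.mul_apply, h1', h2']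

/-- W is a polynomial in L and Λ, both natural. This is what lets the pointwise star be computed in
any chart. -/
lemma pullback_starOp {η : Ext n} (hη : IsNondegOneOne η) (x : Ext n) :
    MinkowskiKahler.pullback (A.restrictScalars ℝ) (starOp η x) =
      starOp (MinkowskiKahler.pullback (A.restrictScalars ℝ) η)
        (MinkowskiKahler.pullback (A.restrictScalars ℝ) x) := by
  rw [starOp_apply, starOp_apply, pullback_weyl hA hη, pullback_antiInv]

end Holomorphic

/-! ### The conjugate-linear star operator -/

/-- Multiplication by a complex number, as a real-linear map. -/
def scalarMap (n : ℕ) (c : ℂ) : (Fin n → ℂ) →L[ℂ] (Fin n → ℂ) :=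
  c • ContinuousLinearMap.id ℂ (Fin n → ℂ)

/-- The operator `i^{p-q}` on forms of type `(p,q)`. -/
def weil : Ext n →ₐ[ℂ] Ext n := pullback ((scalarMap n Complex.I).restrictScalars ℝ)

/-- The operator `i^{q-p}` on forms of type `(p,q)`. -/
def weilInv : Ext n →ₐ[ℂ] Ext n := pullback ((scalarMap n (-Complex.I)).restrictScalars ℝ)

lemma weil_weilInv (x : Ext n) : weil (weilInv x) = x := by
  rw [weil, weilInv, pullback_pullback]
  conv_rhs => rw [← pullback_id x]
  congr 2
  ext v k
  simp [scalarMap, ← mul_assoc]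

lemma pullback_weil (A : (Fin n → ℂ) →L[ℂ] (Fin n → ℂ)) (x : Ext n) :
    pullback (A.restrictScalars ℝ) (weil x) = weil (pullback (A.restrictScalars ℝ) x) := by
  rw [weil, pullback_pullback, pullback_pullback]
  congr 2
  ext v k
  simp [scalarMap]

lemma pullback_weilInv (A : (Fin n → ℂ) →L[ℂ] (Fin n → ℂ)) (x : Ext n) :
    pullback (A.restrictScalars ℝ) (weilInv x) = weilInv (pullback (A.restrictScalars ℝ) x) := by
  rw [weilInv, pullback_pullback, pullback_pullback]
  congr 2
  ext v k
  simp [scalarMap]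

lemma cmatrix_scalarMap (c : ℂ) (k j : Fin n) :
    cmatrix (scalarMap n c) k j = if k = j then c else 0 := by
  simp [cmatrix, scalarMap, ex, Pi.single_apply]

lemma wedge_smul_covec (c : ℂ) (α : Covec n) (x : Ext n) : wedge (c • α) x = c • wedge α x := by
  rw [LinearMap.mulLeft_apply, LinearMap.mulLeft_apply, map_smul, smul_mul_assoc]

lemma weil_wedge_dz (j : Fin n) (x : Ext n) :
    weil (wedge (dz j) x) = Complex.I • wedge (dz j) (weil x) := by
  have h : (dz j).comp ((scalarMap n Complex.I).restrictScalars ℝ) = Complex.I • dz j := by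
    ext v; simp [dz, scalarMap]
  rw [weil, pullback_wedge, h, wedge_smul_covec]

lemma weil_wedge_dzbar (j : Fin n) (x : Ext n) :
    weil (wedge (dzbar j) x) = -Complex.I • wedge (dzbar j) (weil x) := by
  have h : (dzbar j).comp ((scalarMap n Complex.I).restrictScalars ℝ) = -Complex.I • dzbar j := by
    ext v; simp [dzbar, scalarMap]
  rw [weil, pullback_wedge, h, wedge_smul_covec]

lemma contract_delVec_weil (j : Fin n) (x : Ext n) :
    contract (delVec j) (weil x) = Complex.I • weil (contract (delVec j) x) := by
  rw [weil, contract_delVec_pullback]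
  simp [cmatrix_scalarMap]

lemma contract_delbarVec_weil (j : Fin n) (x : Ext n) :
    contract (delbarVec j) (weil x) = -Complex.I • weil (contract (delbarVec j) x) := by
  rw [weil, contract_delbarVec_pullback]
  have h : ∀ i, conj (if i = j then Complex.I else 0) = if i = j then -Complex.I else 0 := by
    intro i; split_ifs <;> simp
  simp only [cmatrix_scalarMap, h]
  simp

lemma weil_of_mem {p q : ℕ} {x : Ext n} (hx : x ∈ typeSub n p q) :
    weil x = (Complex.I ^ ((p : ℤ) - (q : ℤ))) • x := by
  refine typeSub_induction (P := fun p q x => weil x = (Complex.I ^ ((p : ℤ) - (q : ℤ))) • x)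
    (fun p q => by simp) (fun p q x y hx hy => by rw [map_add, hx, hy, smul_add])
    (fun p q c x hx => by rw [map_smul, hx, smul_comm]) (by simp)
    (fun p q j x _ hx => ?_) (fun q j x _ hx => ?_) hx
  · rw [weil_wedge_dz, hx, map_smul, smul_smul]
    congr 1
    push_cast
    rw [show (p : ℤ) + 1 - q = 1 + (p - q) by ring, zpow_add₀ Complex.I_ne_zero, zpow_one]
  · rw [weil_wedge_dzbar, hx, map_smul, smul_smul]
    congr 1
    push_cast
    rw [show (0 : ℤ) - (q + 1) = -1 + (0 - q) by ring, zpow_add₀ Complex.I_ne_zero, zpow_neg_one,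
      Complex.inv_I]

lemma scalarPart_weil (x : Ext n) : scalarPart (weil x) = scalarPart x :=
  scalarPart_pullback _ x

/-- The conjugate-linear star operator of `η`. -/
def hodge (η ψ : Ext n) : Ext n := starOp η (conjExt (weil ψ))

/-- The inverse of the conjugate-linear star operator. -/
def hodgeInv (η ψ : Ext n) : Ext n := weilInv (conjExt (starOp η ψ))

lemma hodge_add (η x y : Ext n) : hodge η (x + y) = hodge η x + hodge η y := by
  simp only [hodge, map_add]

lemma hodge_smul (η : Ext n) (c : ℂ) (x : Ext n) : hodge η (c • x) = conj c • hodge η x := by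
  simp only [hodge, map_smul, conjExt_smul]

/-- The conjugate-linear star operator, as an additive map. -/
def hodgeAddHom (η : Ext n) : Ext n →+ Ext n := AddMonoidHom.mk' (hodge η) (hodge_add η)

lemma hodge_sum {ι : Type*} (s : Finset ι) (η : Ext n) (f : ι → Ext n) :
    hodge η (∑ i ∈ s, f i) = ∑ i ∈ s, hodge η (f i) :=
  map_sum (hodgeAddHom η) f s

section Nondeg

variable {η : Ext n} (hη : IsNondegOneOne η)
include hη

lemma hodge_hodgeInv (x : Ext n) : hodge η (hodgeInv η x) = x := by
  rw [hodge, hodgeInv, weil_weilInv, conjExt_conjExt, starOp_starOp hη]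

/-- Conjugation exchanges ∂/∂z and ∂/∂z̄, so the pairing-adjoint of dzⱼ becomes, up to the factor i
from `weil`, the sharp that the star takes back to dzⱼ. This is the inductive step for representing
the pairing. -/
lemma hodge_sharpZ (j : Fin n) (ψ : Ext n) :
    hodge η (sharpZ η j ψ) = involution (wedge (dz j) (hodge η ψ)) := by
  have h : ∀ r, hodge η (contract (delVec r) ψ) =
      Complex.I • starOp η (contract (delbarVec r) (conjExt (weil ψ))) := by
    intro r
    have h1 : weil (contract (delVec r) ψ) = -Complex.I • contract (delVec r) (weil ψ) := by
      rw [contract_delVec_weil, smul_smul]; simp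
    rw [hodge, h1, conjExt_smul, conjExt_contract_delVec, map_smul]
    simp
  have h2 : ∑ r, (matrixOf η)⁻¹ r j • Complex.I •
      starOp η (contract (delbarVec r) (conjExt (weil ψ))) =
        -starOp η (sharp η j (conjExt (weil ψ))) := by
    rw [sharp_apply]
    refine (Finset.sum_congr rfl fun r _ => smul_comm _ _ _).trans ?_
    rw [← Finset.smul_sum, neg_smul, map_neg, neg_neg, map_smul, map_sum]
    simp only [map_smul]
  rw [sharpZ_apply, hodge_sum]
  simp only [hodge_smul, Complex.conj_conj, h]
  rw [h2, starOp_sharp hη, involution_wedge, hodge, involution_starOp hη]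

lemma hodge_sharpZbar (j : Fin n) (ψ : Ext n) :
    hodge η (sharpZbar η j ψ) = involution (wedge (dzbar j) (hodge η ψ)) := by
  have h : ∀ r, hodge η (contract (delbarVec r) ψ) =
      -Complex.I • starOp η (contract (delVec r) (conjExt (weil ψ))) := by
    intro r
    have h1 : weil (contract (delbarVec r) ψ) = Complex.I • contract (delbarVec r) (weil ψ) := by
      rw [contract_delbarVec_weil, smul_smul]; simp
    rw [hodge, h1, conjExt_smul, conjExt_contract_delbarVec, map_smul]
    simp
  have h2 : ∑ r, (matrixOf η)⁻¹ j r • -Complex.I •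
      starOp η (contract (delVec r) (conjExt (weil ψ))) =
        -starOp η (sharpBar η j (conjExt (weil ψ))) := by
    rw [sharpBar_apply]
    refine (Finset.sum_congr rfl fun r _ => smul_comm _ _ _).trans ?_
    rw [← Finset.smul_sum, neg_smul, map_smul, map_sum]
    simp only [map_smul]
  rw [sharpZbar_apply, hodge_sum]
  simp only [hodge_smul, Complex.conj_conj, h]
  rw [h2, starOp_sharpBar hη, involution_wedge, hodge, involution_starOp hη]

/-! ### The star represents the pairing and is the only such operator. -/

section TopFunctional

variable {T : Ext n →ₗ[ℂ] ℂ} (hT : ∀ d x, T (contract d x) = 0)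
include hT

/-- The star of a wedge product is a contraction, which T kills; only the scalar part of x survives.
-/
lemma topFunctional_starOp (x : Ext n) : T (starOp η x) = scalarPart x * T (volForm η) := by
  induction x using form_induction with
  | one => rw [starOp_one hη, map_one, one_mul]
  | add x y hx hy => simp only [map_add, hx, hy, add_mul]
  | smul c x hx => simp only [map_smul, hx, smul_eq_mul, mul_assoc]
  | hz j x hx =>
    rw [starOp_wedge_dz hη, scalarPart_wedge, zero_mul, sharp_apply]
    simp only [map_smul, map_sum, hT, smul_zero, Finset.sum_const_zero]
  | hzb j x hx =>
    rw [starOp_wedge_dzbar hη, scalarPart_wedge, zero_mul, sharpBar_apply]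
    simp only [map_smul, map_sum, hT, smul_zero, Finset.sum_const_zero]

-- Moving α across x costs the sign of the degree of x; it can be shifted to the second factor
-- because T is invariant under the involution.
omit hη in
lemma topFunctional_wedge_mul (α : Covec n) (x y : Ext n) :
    T (wedge α x * y) = T (x * involution (wedge α y)) := by
  have h1 : wedge α x * y = involution (x * ExteriorAlgebra.ι ℂ α * involution y) * (-1) := by
    rw [mul_ι_eq, map_mul, involution_involution, involution_wedge, involution_involution]
    simp
  have h2 : x * involution (wedge α y) = (x * ExteriorAlgebra.ι ℂ α * involution y) * (-1) := by
    rw [involution_wedge]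
    simp [mul_assoc]
  rw [h1, h2, mul_neg_one, mul_neg_one, map_neg, map_neg, topFunctional_involution hT]

/-- The conjugate-linear star operator represents the pairing. -/
theorem topFunctional_mul_hodge (φ ψ : Ext n) :
    T (φ * hodge η ψ) = pairing η φ ψ * T (volForm η) := by
  induction φ using form_induction generalizing ψ with
  | one =>
    rw [one_mul, pairing_one, hodge, topFunctional_starOp hη hT, scalarPart_conjExt,
      scalarPart_weil]
  | add x y hx hy => rw [add_mul, map_add, hx, hy, pairing_add_left, add_mul]
  | smul c x hx => rw [smul_mul_assoc, map_smul, hx, pairing_smul_left, smul_eq_mul, mul_assoc]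
  | hz j x hx =>
    rw [topFunctional_wedge_mul hT, ← hodge_sharpZ hη, hx, pairing_wedge_dz]
  | hzb j x hx =>
    rw [topFunctional_wedge_mul hT, ← hodge_sharpZbar hη, hx, pairing_wedge_dzbar]

/-- The conjugate-linear star is onto, so T x is a multiple of T(ηⁿ/n!) for every x. -/
lemma topFunctional_volForm_ne_zero (hT0 : T ≠ 0) : T (volForm η) ≠ 0 := by
  intro h
  refine hT0 (LinearMap.ext fun x => ?_)
  have h1 := topFunctional_mul_hodge hη hT 1 (hodgeInv η x)
  rwa [one_mul, hodge_hodgeInv hη, h, mul_zero] at h1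

/-- The wedge product is nondegenerate. -/
theorem eq_zero_of_topFunctional_mul (hT0 : T ≠ 0) {x : Ext n} (hx : ∀ φ, T (φ * x) = 0) :
    x = 0 := by
  have h : hodgeInv η x = 0 := by
    refine eq_zero_of_pairing hη.det_ne_zero fun φ => ?_
    have h1 := topFunctional_mul_hodge hη hT φ (hodgeInv η x)
    rw [hodge_hodgeInv hη, hx] at h1
    exact (mul_eq_zero.1 h1.symm).resolve_right (topFunctional_volForm_ne_zero hη hT hT0)
  rw [← hodge_hodgeInv hη x, h]
  simp [hodge]

lemma eq_zero_of_mem_of_topFunctional (hT0 : T ≠ 0) {p q : ℕ} {x : Ext n}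
    (hx : x ∈ typeSub n (n - p) (n - q)) (hp : p ≤ n) (hq : q ≤ n)
    (h : ∀ φ ∈ typeSub n p q, T (φ * x) = 0) : x = 0 := by
  refine eq_zero_of_topFunctional_mul hη hT hT0 fun φ => ?_
  induction φ using form_type_induction with
  | add y z hy hz => rw [add_mul, map_add, hy, hz, add_zero]
  | type p' q' y hp' hq' hy =>
    by_cases hpq : p' = p ∧ q' = q
    · obtain ⟨rfl, rfl⟩ := hpq
      exact h y hy
    · exact topFunctional_eq_zero hT (mul_mem_typeSub hy hx) (by omega)

/-- By type, a form of type (n, n) is tested only against forms of type (0, 0), and these are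
constants. -/
lemma eq_of_mem_top (hT0 : T ≠ 0) {x y : Ext n} (hx : x ∈ typeSub n n n) (hy : y ∈ typeSub n n n)
    (h : T x = T y) : x = y := by
  rw [← sub_eq_zero]
  refine eq_zero_of_mem_of_topFunctional hη hT hT0 (p := 0) (q := 0) (sub_mem hx hy)
    (Nat.zero_le n) (Nat.zero_le n) fun φ hφ => ?_
  have h1 : ∃ c : ℂ, φ = c • 1 := by
    refine typeSub_induction (P := fun p q x => p = 0 → q = 0 → ∃ c : ℂ, x = c • (1 : Ext n))
      (fun p q _ _ => ⟨0, by simp⟩) (fun p q x y hx hy hp hq => ?_) (fun p q c x hx hp hq => ?_)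
      (fun _ _ => ⟨1, by simp⟩) (fun p q j x _ _ hp _ => absurd hp (Nat.succ_ne_zero p))
      (fun q j x _ _ _ hq => absurd hq (Nat.succ_ne_zero q)) hφ rfl rfl
    · obtain ⟨a, rfl⟩ := hx hp hq
      obtain ⟨b, rfl⟩ := hy hp hq
      exact ⟨a + b, by rw [add_smul]⟩
    · obtain ⟨a, rfl⟩ := hx hp hq
      exact ⟨c * a, by rw [mul_smul]⟩
  obtain ⟨c, rfl⟩ := h1
  rw [smul_mul_assoc, one_mul, map_smul, map_sub, h, sub_self, smul_zero]

/-- Both sides of the defining identity have type (n, n), so it suffices to compare them under T,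
where it is `topFunctional_mul_hodge`. The factor i^{q−p} is the conjugate of the one by which
`weil` acts. -/
theorem isSymplStar_starOp (hT0 : T ≠ 0) : IsSymplStar η (starOp η) := by
  intro p q hp hq φ hφ ψ hψ
  rw [conjForm_eq]
  have h1 := starOp_mem_typeSub hη (conjExt_mem_typeSub hψ) hq hp
  have h2 : hodge η ψ = Complex.I ^ ((q : ℤ) - (p : ℤ)) • starOp η (conjExt ψ) := by
    rw [hodge, weil_of_mem hψ, conjExt_smul, map_smul, map_zpow₀, Complex.conj_I, ← Complex.inv_I,
      inv_zpow, ← zpow_neg, neg_sub]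
  refine ⟨h1, ?_⟩
  rw [← mul_smul_comm, ← h2]
  refine eq_of_mem_top hη hT hT0 ?_ (Submodule.smul_mem _ _ (Submodule.smul_mem _ _
    (pow_mem_typeSub hη n))) ?_
  · rw [h2]
    have := mul_mem_typeSub hφ (Submodule.smul_mem _ (Complex.I ^ ((q : ℤ) - (p : ℤ))) h1)
    rwa [Nat.add_sub_cancel' hp, Nat.add_sub_cancel' hq] at this
  · rw [topFunctional_mul_hodge hη hT, map_smul, smul_eq_mul]

/-- The defining identity fixes φ ∧ Sψ̄ for all φ of type (p, q), and such φ separate forms of the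
complementary type. -/
theorem IsSymplStar.eq_starOp (hT0 : T ≠ 0) {S : Ext n →ₗ[ℂ] Ext n} (hS : IsSymplStar η S) :
    S = starOp η := by
  have key : ∀ ψ, S (conjForm ψ) = starOp η (conjForm ψ) := by
    intro ψ
    simp only [conjForm_eq]
    induction ψ using form_type_induction with
    | add x y hx hy => simp only [map_add, hx, hy]
    | type p q ψ hp hq hψ =>
      rw [← sub_eq_zero]
      -- The type of S ψ̄ is stated under the quantifier over φ; φ = 0 gives access to it.
      have h0 : (0 : Ext n) ∈ typeSub n p q := zero_mem _
      have h1 := fun φ hφ => hS p q hp hq φ hφ ψ hψ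
      have h2 := fun φ hφ => isSymplStar_starOp hη hT hT0 p q hp hq φ hφ ψ hψ
      simp only [conjForm_eq] at h1 h2
      refine eq_zero_of_mem_of_topFunctional hη hT hT0 (sub_mem (h1 0 h0).1 (h2 0 h0).1) hp hq
        fun φ hφ => ?_
      have h3 := (h1 φ hφ).2.trans (h2 φ hφ).2.symm
      have h4 := smul_right_injective (Ext n) (zpow_ne_zero _ Complex.I_ne_zero) h3
      rw [mul_sub, h4, sub_self, map_zero]
  refine LinearMap.ext fun x => ?_
  have := key (conjExt x)
  rwa [conjForm_eq, conjExt_conjExt] at this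

end TopFunctional

end Nondeg

/-! ### The top degree coefficient -/

/-- The coefficient of a top degree form, as a linear functional. -/
def topCoeffₗ (n : ℕ) : Ext n →ₗ[ℂ] ℂ :=
  evalOnₗ ((List.finRange n).flatMap fun j => [evalVec (ex j), evalVec (ey j)])

lemma topCoeffₗ_apply (x : Ext n) : topCoeffₗ n x = topCoeff x := rfl

lemma contract_add_vec (d d' : Module.Dual ℂ (Covec n)) (x : Ext n) :
    contract (d + d') x = contract d x + contract d' x := by
  simp only [contract, map_add, LinearMap.add_apply]

lemma contract_smul_vec (c : ℂ) (d : Module.Dual ℂ (Covec n)) (x : Ext n) :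
    contract (c • d) x = c • contract d x := by
  simp only [contract, map_smul, LinearMap.smul_apply]

/-- The top coefficient already contracts with every ∂/∂xⱼ and ∂/∂yⱼ, and d is a complex combination
of these, so some vector is contracted twice in each term. -/
theorem topCoeffₗ_contract (d : Module.Dual ℂ (Covec n)) (x : Ext n) :
    topCoeffₗ n (contract d x) = 0 := by
  have hx : ∀ j : Fin n, topCoeffₗ n (contract (evalVec (ex j)) x) = 0 := fun j => by
    rw [topCoeffₗ, evalOnₗ_apply, evalOn]
    exact (congrArg _ (contractList_contract_of_mem (List.mem_flatMap.2
      ⟨j, List.mem_finRange j, by simp⟩) x)).trans (map_zero _)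
  have hy : ∀ j : Fin n, topCoeffₗ n (contract (evalVec (ey j)) x) = 0 := fun j => by
    rw [topCoeffₗ, evalOnₗ_apply, evalOn]
    exact (congrArg _ (contractList_contract_of_mem (List.mem_flatMap.2
      ⟨j, List.mem_finRange j, by simp⟩) x)).trans (map_zero _)
  rw [covec_dual_eq_sum d, contract_add_vec, contract_sum_smul, contract_sum_smul]
  simp only [delVec, delbarVec, map_add, map_sum, map_smul, map_sub, LinearMap.add_apply,
    LinearMap.sub_apply, LinearMap.smul_apply, hx, hy, smul_zero, sub_zero, add_zero,
    Finset.sum_const_zero]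

lemma contract_prod_eq_zero (d : Module.Dual ℂ (Covec n)) (l : List (Covec n))
    (h : ∀ α ∈ l, d α = 0) : contract d (l.map (ExteriorAlgebra.ι ℂ)).prod = 0 := by
  induction l with
  | nil => simp [contract_one]
  | cons α l ih =>
    have h1 : (List.map (ExteriorAlgebra.ι ℂ) (α :: l)).prod =
        wedge α (l.map (ExteriorAlgebra.ι ℂ)).prod := by
      rw [List.map_cons, List.prod_cons, LinearMap.mulLeft_apply]
    rw [h1, contract_wedge, h α (by simp), zero_smul, ih fun β hβ => h β (by simp [hβ]), map_zero,
      sub_zero]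

/-- Vectors are contracted in the order of the factors, so each one removes the current first
factor; only its values on later covectors have to vanish. -/
lemma contractList_prod (l : List (Module.Dual ℂ (Covec n) × Covec n))
    (h1 : ∀ a ∈ l, a.1 a.2 = 1) (h2 : l.Pairwise fun a b => a.1 b.2 = 0) :
    contractList ((l.map Prod.snd).map (ExteriorAlgebra.ι ℂ)).prod (l.map Prod.fst) = 1 := by
  induction l with
  | nil => simp [contractList]
  | cons a l ih =>
    have h3 : (List.map (ExteriorAlgebra.ι ℂ) (List.map Prod.snd (a :: l))).prod =
        wedge a.2 ((l.map Prod.snd).map (ExteriorAlgebra.ι ℂ)).prod := by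
      rw [List.map_cons, List.map_cons, List.prod_cons, LinearMap.mulLeft_apply]
    rw [List.pairwise_cons] at h2
    rw [h3, List.map_cons, contractList_cons, contract_wedge, h1 a (by simp), one_smul,
      contract_prod_eq_zero, map_zero, sub_zero]
    · exact ih (fun b hb => h1 b (by simp [hb])) h2.2
    · intro α hα
      obtain ⟨b, hb, rfl⟩ := List.mem_map.1 hα
      exact h2.1 b hb

theorem topCoeffₗ_ne_zero : topCoeffₗ n ≠ 0 := by
  -- These are dxⱼ and dyⱼ = (dzⱼ − dz̄ⱼ)/(2i); the functional takes the value 1 on dx₁ ∧ dy₁ ∧ … ∧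
  -- dxₙ ∧ dyₙ.
  let a : Fin n → Covec n := fun j => (1 / 2 : ℂ) • (dz j + dzbar j)
  let b : Fin n → Covec n := fun j => (-Complex.I / 2 : ℂ) • (dz j - dzbar j)
  have h := contractList_prod ((List.finRange n).flatMap fun j =>
    [(evalVec (ex j), a j), (evalVec (ey j), b j)]) (by
      intro c hc
      obtain ⟨j, -, hj⟩ := List.mem_flatMap.1 hc
      simp only [List.mem_cons, List.not_mem_nil, or_false] at hj
      rcases hj with rfl | rfl
      · simp [evalVec, ex, a, dz, dzbar]; norm_num
      · simp [evalVec, ey, b, dz, dzbar]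
        linear_combination -Complex.I_mul_I) (by
      rw [List.pairwise_flatMap]
      refine ⟨fun j _ => by simp [evalVec, ex, b, dz, dzbar], ?_⟩
      refine (List.nodup_finRange n).imp fun {i j} hij => ?_
      have hij' : j ≠ i := Ne.symm hij
      intro x hx y hy
      simp only [List.mem_cons, List.not_mem_nil, or_false] at hx hy
      rcases hx with rfl | rfl <;> rcases hy with rfl | rfl <;>
        simp [evalVec, ex, ey, a, b, dz, dzbar, hij', hij])
  intro h0
  have h1 := LinearMap.congr_fun h0 (((((List.finRange n).flatMap fun j =>
    [(evalVec (ex j), a j), (evalVec (ey j), b j)]).map Prod.snd).map (ExteriorAlgebra.ι ℂ)).prod)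
  rw [topCoeffₗ, evalOnₗ_apply, evalOn] at h1
  have h2 : ((List.finRange n).flatMap fun j =>
      [(evalVec (ex j), a j), (evalVec (ey j), b j)]).map Prod.fst =
      (List.finRange n).flatMap fun j => [evalVec (ex j), evalVec (ey j)] := by
    rw [List.map_flatMap]
    rfl
  rw [h2] at h
  refine one_ne_zero (α := ℂ) ?_
  rw [← map_one (scalarPart (n := n)), ← h]
  exact h1

lemma evalOn_update_add {m : ℕ} (x : Ext n) (w : Fin m → Module.Dual ℂ (Covec n)) (i : Fin m)
    (a b : Module.Dual ℂ (Covec n)) :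
    contractList x (List.ofFn (Function.update w i (a + b))) =
      contractList x (List.ofFn (Function.update w i a)) +
        contractList x (List.ofFn (Function.update w i b)) := by
  induction m generalizing x with
  | zero => exact i.elim0
  | succ m ih =>
    refine Fin.cases ?_ (fun i => ?_) i
    · simp only [List.ofFn_succ, Function.update_self, contractList_cons, contract_add_vec,
        contractList_add]
      simp [Fin.succ_ne_zero, Function.update_of_ne]
    · have h : ∀ a, (fun j : Fin m => Function.update w i.succ a j.succ) =
          Function.update (fun j => w j.succ) i a := by
        intro a; ext j
        by_cases hj : j = i
        · subst hj; simp
        · rw [Function.update_of_ne hj, Function.update_of_ne (by simpa using hj)]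
      simp only [List.ofFn_succ, contractList_cons, h]
      rw [Function.update_of_ne (Fin.succ_ne_zero i).symm,
        Function.update_of_ne (Fin.succ_ne_zero i).symm,
        Function.update_of_ne (Fin.succ_ne_zero i).symm, ih]

lemma evalOn_update_smul {m : ℕ} (x : Ext n) (w : Fin m → Module.Dual ℂ (Covec n)) (i : Fin m)
    (c : ℂ) (a : Module.Dual ℂ (Covec n)) :
    contractList x (List.ofFn (Function.update w i (c • a))) =
      c • contractList x (List.ofFn (Function.update w i a)) := by
  induction m generalizing x with
  | zero => exact i.elim0
  | succ m ih =>
    refine Fin.cases ?_ (fun i => ?_) i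
    · simp only [List.ofFn_succ, Function.update_self, contractList_cons, contract_smul_vec,
        contractList_smul]
      simp [Fin.succ_ne_zero, Function.update_of_ne]
    · have h : ∀ a, (fun j : Fin m => Function.update w i.succ a j.succ) =
          Function.update (fun j => w j.succ) i a := by
        intro a; ext j
        by_cases hj : j = i
        · subst hj; simp
        · rw [Function.update_of_ne hj, Function.update_of_ne (by simpa using hj)]
      simp only [List.ofFn_succ, contractList_cons, h]
      rw [Function.update_of_ne (Fin.succ_ne_zero i).symm,
        Function.update_of_ne (Fin.succ_ne_zero i).symm, ih]

lemma evalVec_add (v w : Fin n → ℂ) : evalVec (v + w) = evalVec v + evalVec w := by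
  ext α; simp [evalVec]

lemma evalVec_smul (c : ℝ) (v : Fin n → ℂ) : evalVec (c • v) = (c : ℂ) • evalVec v := by
  ext α; simp [evalVec]

/-- The alternating map of real tangent vectors defined by a form. -/
def evalAlternating (m : ℕ) (x : Ext n) : (Fin n → ℂ) [⋀^Fin m]→ₗ[ℝ] ℂ where
  toFun w := evalOn x (List.ofFn fun i => evalVec (w i))
  map_update_add' := @fun inst w i a b => by
    obtain rfl := Subsingleton.elim inst (instDecidableEqFin m)
    have h : ∀ c, (fun j => evalVec (Function.update w i c j)) =
        Function.update (fun j => evalVec (w j)) i (evalVec c) := fun c => by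
      ext1 j; exact Function.apply_update (fun _ => evalVec) w i c j
    have h2 := evalOn_update_add x (fun j => evalVec (w j)) i (evalVec a) (evalVec b)
    have h3 := congrArg scalarPart h2
    rw [map_add, ← evalVec_add, ← h, ← h, ← h] at h3
    convert h3 <;> simp [evalOn]
  map_update_smul' := @fun inst w i c a => by
    obtain rfl := Subsingleton.elim inst (instDecidableEqFin m)
    have h : ∀ c, (fun j => evalVec (Function.update w i c j)) =
        Function.update (fun j => evalVec (w j)) i (evalVec c) := fun c => by
      ext1 j; exact Function.apply_update (fun _ => evalVec) w i c j
    have h2 := evalOn_update_smul x (fun j => evalVec (w j)) i c (evalVec a)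
    have h3 := congrArg scalarPart h2
    rw [map_smul, ← evalVec_smul, ← h, ← h] at h3
    convert h3 <;> simp [evalOn]
  map_eq_zero_of_eq' w i j hw hij := by
    rw [evalOn]
    refine (congrArg _ (contractList_of_not_nodup (fun h => ?_) x)).trans (map_zero _)
    exact hij (List.nodup_ofFn.1 h (by simp only [hw]))

lemma evalAlternating_pullback {m : ℕ} (A : (Fin n → ℂ) →L[ℝ] (Fin n → ℂ)) (x : Ext n)
    (w : Fin m → Fin n → ℂ) :
    evalAlternating m (pullback A x) w = evalAlternating m x fun i => A (w i) := by
  have h : ∀ (l : List (Fin n → ℂ)) (x : Ext n), contractList (pullback A x) (l.map evalVec) =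
      pullback A (contractList x ((l.map A).map evalVec)) := by
    intro l
    induction l with
    | nil => intro x; rfl
    | cons v l ih =>
      intro x
      simp only [List.map_cons, contractList_cons]
      rw [contract_pullback, ih]
      rfl
  have h1 := congrArg scalarPart (h (List.ofFn w) x)
  rw [scalarPart_pullback, List.map_ofFn, List.map_ofFn, List.map_ofFn] at h1
  exact h1

/-- The real basis `∂/∂x₁, ∂/∂y₁, …, ∂/∂xₙ, ∂/∂yₙ`. -/
def realBasis (n : ℕ) : Module.Basis (Fin (n * 2)) ℝ (Fin n → ℂ) :=
  (Complex.basisOneI.smulTower' (Pi.basisFun ℂ (Fin n))).reindex finProdFinEquiv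

lemma topCoeff_eq_evalAlternating (x : Ext n) :
    topCoeff x = evalAlternating (n * 2) x (realBasis n) := by
  have h : (List.finRange n).flatMap (fun j => [evalVec (ex j), evalVec (ey j)]) =
      List.ofFn fun i => evalVec (realBasis n i) := by
    rw [List.ofFn_mul, List.flatMap, ← List.ofFn_eq_map]
    congr 1
    congr 1
    ext1 i
    -- The indexing puts ∂/∂xᵢ and ∂/∂yᵢ next to each other, in the order used by `topCoeff`.
    have h0 : ∀ j : Fin 2, (⟨i * 2 + j, by omega⟩ : Fin (n * 2)) = finProdFinEquiv (i, j) := by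
      intro j; ext; simp [finProdFinEquiv]; ring
    have h1 : ∀ j : Fin 2, realBasis n (finProdFinEquiv (i, j)) =
        Complex.basisOneI j • (Pi.single i 1 : Fin n → ℂ) := by
      intro j
      rw [realBasis, Module.Basis.reindex_apply, Equiv.symm_apply_apply,
        Module.Basis.smulTower'_apply, Pi.basisFun_apply]
    simp only [h0, h1, List.ofFn_succ, List.ofFn_zero]
    simp only [Complex.coe_basisOneI]
    congr 2
    · simp [ex]
    · congr 1; ext k; simp [ey, Pi.single_apply]
  rw [topCoeff, h]
  rfl

/-- A top degree form is multiplied by the real determinant under pullback. -/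
theorem topCoeff_pullback (A : (Fin n → ℂ) →L[ℝ] (Fin n → ℂ)) (x : Ext n) :
    topCoeff (pullback A x) = A.det • topCoeff x := by
  -- A top degree alternating map is determined by its value on the basis, so it is a multiple of
  -- the determinant.
  have h1 : evalAlternating (n * 2) x = (LinearMap.toSpanSingleton ℝ ℂ
      (evalAlternating (n * 2) x (realBasis n))).compAlternatingMap (realBasis n).det := by
    refine Module.Basis.ext_alternating (realBasis n) fun v hv => ?_
    let σ : Equiv.Perm (Fin (n * 2)) := Equiv.ofBijective v (Finite.injective_iff_bijective.1 hv)
    have h2 : (fun i => realBasis n (v i)) = (realBasis n) ∘ σ := rfl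
    rw [h2, AlternatingMap.map_perm, AlternatingMap.map_perm]
    simp [Module.Basis.det_self]
  rw [topCoeff_eq_evalAlternating, evalAlternating_pullback, h1]
  have h3 : (fun i => A (realBasis n i)) = A.toLinearMap ∘ realBasis n := rfl
  rw [h3, LinearMap.compAlternatingMap_apply, Module.Basis.det_comp, Module.Basis.det_self,
    topCoeff_eq_evalAlternating, mul_one]
  simp only [LinearMap.toSpanSingleton_apply]

/-- The real determinant is |det_ℂ A|². Hence holomorphic coordinate changes preserve orientation,
and the absolute value in the change of variables formula does no harm. -/
lemma det_restrictScalars_nonneg (A : (Fin n → ℂ) →L[ℂ] (Fin n → ℂ)) :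
    0 ≤ (A.restrictScalars ℝ).det := by
  have h : (A.restrictScalars ℝ).det = Complex.normSq (LinearMap.det A.toLinearMap) := by
    rw [← Algebra.norm_complex_apply, ← LinearMap.det_restrictScalars]
    rfl
  rw [h]
  exact Complex.normSq_nonneg _

/-! ### The star operators, pointwise -/

theorem IsNondegOneOne.symplStar_eq {η : Ext n} (hη : IsNondegOneOne η) :
    symplStar η = starOp η := by
  have h : ∃ S : Ext n →ₗ[ℂ] Ext n, IsSymplStar η S :=
    ⟨_, isSymplStar_starOp hη topCoeffₗ_contract topCoeffₗ_ne_zero⟩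
  rw [symplStar, dif_pos h]
  exact IsSymplStar.eq_starOp hη topCoeffₗ_contract topCoeffₗ_ne_zero h.choose_spec

lemma pullback_hodge {A : (Fin n → ℂ) →L[ℂ] (Fin n → ℂ)} (hA : (cmatrix A).det ≠ 0) {η : Ext n}
    (hη : IsNondegOneOne η) (x : Ext n) :
    pullback (A.restrictScalars ℝ) (hodge η x) =
      hodge (pullback (A.restrictScalars ℝ) η) (pullback (A.restrictScalars ℝ) x) := by
  rw [hodge, hodge, pullback_starOp hA hη, pullback_conjExt, pullback_weil]

lemma pullback_hodgeInv {A : (Fin n → ℂ) →L[ℂ] (Fin n → ℂ)} (hA : (cmatrix A).det ≠ 0) {η : Ext n}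
    (hη : IsNondegOneOne η) (x : Ext n) :
    pullback (A.restrictScalars ℝ) (hodgeInv η x) =
      hodgeInv (pullback (A.restrictScalars ℝ) η) (pullback (A.restrictScalars ℝ) x) := by
  rw [hodgeInv, hodgeInv, ← pullback_starOp hA hη, pullback_weilInv, pullback_conjExt]

lemma IsRealOneOne.isNondegOneOne {η : Ext n} (h : IsRealOneOne η) (hd : (matrixOf η).det ≠ 0) :
    IsNondegOneOne η := ⟨h.1, hd⟩

/-! ### Admissible metrics -/

-- N = g⁻¹M is self-adjoint for the Hermitian product g with eigenvalues ±1, so N² = 1. Instead of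
-- diagonalizing, take P = N² − 1, which is g-self-adjoint and commutes with N. If P ≠ 0, then N has
-- an eigenvector w = Pu in the range of P. Its eigenvalue has square 1, so Pw = 0, and then g(w, w)
-- = g(u, Pw) = 0 contradicts positivity.
open Matrix in
lemma admissible_mul_self {M g : Matrix (Fin n) (Fin n) ℂ} (hM : M.IsHermitian) (hg : g.PosDef)
    (h : ∀ (μ : ℂ) (v : Fin n → ℂ), v ≠ 0 → M *ᵥ v = μ • g *ᵥ v → μ = 1 ∨ μ = -1) :
    g⁻¹ * M * (g⁻¹ * M) = 1 := by
  have hgu : IsUnit g.det := by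
    rw [← Matrix.isUnit_iff_isUnit_det]; exact hg.isUnit
  set N := g⁻¹ * M with hN
  set P := N * N - 1 with hP
  have hgN : g * N = M := by rw [hN, ← mul_assoc, Matrix.mul_nonsing_inv _ hgu, one_mul]
  have hNP : N * P = P * N :=
    (((Commute.refl N).mul_right (Commute.refl N)).sub_right (Commute.one_right N)).eq
  have hgP : g * P = Pᴴ * g := by
    have h1 : g * P = M * g⁻¹ * M - g := by
      rw [hP, mul_sub, ← mul_assoc, hgN, mul_one, hN, mul_assoc]
    have h2 : (g * P)ᴴ = g * P := by
      rw [h1, conjTranspose_sub, conjTranspose_mul, conjTranspose_mul, hM.eq, hg.1.inv.eq, hg.1.eq,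
        mul_assoc]
    rw [← h2, conjTranspose_mul, hg.1.eq]
  suffices hP0 : P = 0 from sub_eq_zero.1 hP0
  by_contra hne
  have hR : ∀ x ∈ LinearMap.range P.toLin', N.toLin' x ∈ LinearMap.range P.toLin' := by
    rintro _ ⟨u, rfl⟩
    refine ⟨N *ᵥ u, ?_⟩
    rw [toLin'_apply, toLin'_apply, toLin'_apply, mulVec_mulVec, mulVec_mulVec, hNP]
  have hnt : Nontrivial (LinearMap.range P.toLin') := by
    rw [Submodule.nontrivial_iff_ne_bot]
    intro h0
    refine hne (Matrix.toLin'.injective ?_)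
    rw [map_zero]
    exact LinearMap.range_eq_bot.1 h0
  obtain ⟨μ, hμ⟩ := Module.End.exists_eigenvalue (LinearMap.restrict N.toLin' hR)
  obtain ⟨w, hw⟩ := hμ.exists_hasEigenvector
  obtain ⟨u, hu⟩ := w.2
  have hw0 : (w : Fin n → ℂ) ≠ 0 := fun h0 => hw.2 (Subtype.ext h0)
  have hNw : N *ᵥ (w : Fin n → ℂ) = μ • (w : Fin n → ℂ) := congrArg Subtype.val hw.apply_eq_smul
  have hμ' : μ * μ = 1 := by
    have : M *ᵥ (w : Fin n → ℂ) = μ • g *ᵥ (w : Fin n → ℂ) := by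
      rw [← hgN, ← mulVec_mulVec, hNw, mulVec_smul]
    rcases h μ w hw0 this with rfl | rfl <;> norm_num
  have hP0 : ∀ w' : Fin n → ℂ, N *ᵥ w' = μ • w' → P *ᵥ w' = 0 := fun w' hw' => by
    rw [hP, sub_mulVec, ← mulVec_mulVec, hw', mulVec_smul, hw', smul_smul, hμ', one_smul,
      one_mulVec, sub_self]
  have hPw := hP0 w hNw
  have hu' : P *ᵥ u = w := hu
  have hzero : star (w : Fin n → ℂ) ⬝ᵥ g *ᵥ (w : Fin n → ℂ) = 0 := by
    conv_lhs => rw [← hu']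
    rw [star_mulVec, ← dotProduct_mulVec, mulVec_mulVec, ← hgP, ← mulVec_mulVec, hu', hPw]
    simp
  exact (hg.dotProduct_mulVec_pos hw0).ne' hzero

lemma admissible_inv {M g : Matrix (Fin n) (Fin n) ℂ} (h : g⁻¹ * M * (g⁻¹ * M) = 1) :
    M⁻¹ = g⁻¹ * M * g⁻¹ :=
  Matrix.inv_eq_left_inv (by rw [mul_assoc, h])

/-- For an admissible metric, `Λ` is the pointwise adjoint of `L`. -/
theorem pairing_lef_left {η g : Ext n} (hη : IsNondegOneOne η) (hM : (matrixOf η).IsHermitian)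
    (hg : (matrixOf g).IsHermitian)
    (h : (matrixOf η)⁻¹ = (matrixOf g)⁻¹ * matrixOf η * (matrixOf g)⁻¹) (φ ψ : Ext n) :
    pairing g (lef η ψ) φ = pairing g ψ (lam η φ) := by
  have hG : ∀ i j, conj ((matrixOf g)⁻¹ i j) = (matrixOf g)⁻¹ j i := fun i j => hg.inv.apply j i
  have hM' : ∀ i j, conj (matrixOf η i j) = matrixOf η j i := fun i j => hM.apply j i
  -- Since η⁻¹ = g⁻¹ηg⁻¹, contraction with η⁻¹ is contraction with η after raising both indices by
  -- g, that is, term by term the g-adjoint of the product with η.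
  have h1 : lam η φ = -Complex.I • ∑ j, ∑ k, conj (matrixOf η j k) •
      sharpZbar g k (sharpZ g j φ) := by
    rw [lam_eq_sum]
    congr 1
    simp only [sharpZbar_apply, sharpZ_apply, map_sum, map_smul, Finset.smul_sum, smul_smul, h, hG,
      hM', Matrix.mul_apply, Finset.sum_mul, Finset.sum_smul]
    have e : ∀ f : Fin n → Fin n → Fin n → Fin n → Ext n,
        ∑ l, ∑ m, ∑ j, ∑ k, f l m j k = ∑ j, ∑ k, ∑ l, ∑ m, f l m j k := by
      intro f
      calc ∑ l, ∑ m, ∑ j, ∑ k, f l m j k = ∑ l, ∑ j, ∑ m, ∑ k, f l m j k :=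
            Finset.sum_congr rfl fun l _ => Finset.sum_comm
        _ = ∑ j, ∑ l, ∑ m, ∑ k, f l m j k := Finset.sum_comm
        _ = ∑ j, ∑ l, ∑ k, ∑ m, f l m j k :=
            Finset.sum_congr rfl fun j _ => Finset.sum_congr rfl fun l _ => Finset.sum_comm
        _ = ∑ j, ∑ k, ∑ l, ∑ m, f l m j k := Finset.sum_congr rfl fun j _ => Finset.sum_comm
    rw [e]
    refine Finset.sum_congr rfl fun j _ => Finset.sum_congr rfl fun k _ =>
      Finset.sum_congr rfl fun m _ => Finset.sum_congr rfl fun l _ => ?_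
    congr 1
    ring
  rw [h1, lef_apply hη, pairing_smul_left, pairing_smul_right]
  simp only [pairing_sum_left, pairing_sum_right, pairing_smul_left, pairing_smul_right,
    pairing_wedge_dz, pairing_wedge_dzbar, Complex.conj_conj, map_neg, Complex.conj_I, neg_neg]

/-! ### Calculus of form-valued functions -/

/-- A norm on the space of forms. -/
abbrev extNormedAddCommGroup : NormedAddCommGroup (Ext n) :=
  NormedAddCommGroup.induced (Ext n) (Fin (Module.finrank ℂ (Ext n)) → ℂ)
    (Module.finBasis ℂ (Ext n)).equivFun (LinearEquiv.injective _)

attribute [local instance] extNormedAddCommGroup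

/-- The space of forms is a normed space. -/
abbrev extNormedSpace : NormedSpace ℂ (Ext n) :=
  NormedSpace.induced ℂ (Ext n) (Fin (Module.finrank ℂ (Ext n)) → ℂ)
    (Module.finBasis ℂ (Ext n)).equivFun

attribute [local instance] extNormedSpace

section RealCLM

variable {E F : Type*} [NormedAddCommGroup E] [NormedSpace ℂ E] [FiniteDimensional ℂ E]
  [NormedAddCommGroup F] [NormedSpace ℂ F]

/-- A complex-linear map, as a continuous real-linear map. -/
def realCLM (φ : E →ₗ[ℂ] F) : E →L[ℝ] F := (LinearMap.toContinuousLinearMap φ).restrictScalars ℝ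

@[simp] lemma realCLM_apply (φ : E →ₗ[ℂ] F) (x : E) : realCLM φ x = φ x := rfl

end RealCLM

lemma form_eq_sum_basis (x : Ext n) :
    x = ∑ i, (Module.finBasis ℂ (Ext n)).coord i x • Module.finBasis ℂ (Ext n) i :=
  ((Module.finBasis ℂ (Ext n)).sum_repr x).symm

section ContDiff

variable {E : Type*} [NormedAddCommGroup E] [NormedSpace ℝ E] {s : Set E} {m : ℕ∞ω}

lemma contDiffOn_linear {F : Type*} [NormedAddCommGroup F] [NormedSpace ℂ F] (φ : Ext n →ₗ[ℂ] F)
    {f : E → Ext n} (hf : ContDiffOn ℝ m f s) : ContDiffOn ℝ m (fun y => φ (f y)) s :=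
  (realCLM φ).contDiff.comp_contDiffOn hf

lemma contDiffOn_smul_const {a : E → ℂ} (ha : ContDiffOn ℝ m a s) (x : Ext n) :
    ContDiffOn ℝ m (fun y => a y • x) s :=
  (realCLM (LinearMap.toSpanSingleton ℂ (Ext n) x)).contDiff.comp_contDiffOn ha

/-- Relates smoothness of all coefficients, as in `IsSmooth`, to smoothness for the auxiliary norm.
-/
lemma contDiffOn_ext_iff {f : E → Ext n} :
    ContDiffOn ℝ m f s ↔ ∀ ℓ : Module.Dual ℂ (Ext n), ContDiffOn ℝ m (fun y => ℓ (f y)) s := by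
  refine ⟨fun hf ℓ => contDiffOn_linear ℓ hf, fun h => ?_⟩
  have h1 : f = fun y => ∑ i, (Module.finBasis ℂ (Ext n)).coord i (f y) •
      Module.finBasis ℂ (Ext n) i := funext fun y => form_eq_sum_basis (f y)
  rw [h1]
  exact ContDiffOn.sum fun i _ => contDiffOn_smul_const (h _) _

/-- The exterior product, as a continuous bilinear map. -/
def mulCLM : Ext n →L[ℝ] Ext n →L[ℝ] Ext n :=
  haveI : FiniteDimensional ℝ (Ext n) := FiniteDimensional.complexToReal _
  LinearMap.toContinuousBilinearMap (LinearMap.mul ℝ (Ext n))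

@[simp] lemma mulCLM_apply (x y : Ext n) : mulCLM x y = x * y := rfl

lemma contDiffOn_mul {f g : E → Ext n} (hf : ContDiffOn ℝ m f s) (hg : ContDiffOn ℝ m g s) :
    ContDiffOn ℝ m (fun y => f y * g y) s :=
  mulCLM.isBoundedBilinearMap.contDiff.comp_contDiffOn (hf.prodMk hg)

lemma contDiffOn_smul {a : E → ℂ} {f : E → Ext n} (ha : ContDiffOn ℝ m a s)
    (hf : ContDiffOn ℝ m f s) : ContDiffOn ℝ m (fun y => a y • f y) s := by
  have h := contDiffOn_mul (contDiffOn_smul_const ha 1) hf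
  simpa only [smul_mul_assoc, one_mul] using h

lemma contDiffOn_conjExt {f : E → Ext n} (hf : ContDiffOn ℝ m f s) :
    ContDiffOn ℝ m (fun y => conjExt (f y)) s := by
  have h1 : (fun y => conjExt (f y)) = fun y => ∑ i,
      conj ((Module.finBasis ℂ (Ext n)).coord i (f y)) • conjExt (Module.finBasis ℂ (Ext n) i) := by
    ext1 y
    conv_lhs => rw [form_eq_sum_basis (f y)]
    simp only [map_sum, conjExt_smul]
  rw [h1]
  exact ContDiffOn.sum fun i _ => contDiffOn_smul_const
    (Complex.conjCLE.contDiff.comp_contDiffOn (contDiffOn_linear _ hf)) _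

lemma contDiffOn_matrixOf {f : E → Ext n} (hf : ContDiffOn ℝ m f s) (j k : Fin n) :
    ContDiffOn ℝ m (fun y => matrixOf (f y) j k) s := by
  have h : (fun y => matrixOf (f y) j k) =
      fun y => (-Complex.I • (scalarPart.toLinearMap ∘ₗ contract (delbarVec k) ∘ₗ
        contract (delVec j)) : Ext n →ₗ[ℂ] ℂ) (f y) := by
    ext1 y; rw [matrixOf_apply]; rfl
  rw [h]
  exact contDiffOn_linear _ hf

lemma contDiffOn_det {M : E → Matrix (Fin n) (Fin n) ℂ}
    (hM : ∀ j k, ContDiffOn ℝ m (fun y => M y j k) s) : ContDiffOn ℝ m (fun y => (M y).det) s := by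
  simp only [Matrix.det_apply']
  exact ContDiffOn.sum fun σ _ => contDiffOn_const.mul (contDiffOn_prod fun i _ => hM _ _)

/-- Cramer's rule: the entries of the inverse are quotients of polynomials in the entries. -/
lemma contDiffOn_inv {M : E → Matrix (Fin n) (Fin n) ℂ}
    (hM : ∀ j k, ContDiffOn ℝ m (fun y => M y j k) s) (h0 : ∀ y ∈ s, (M y).det ≠ 0) (j k : Fin n) :
    ContDiffOn ℝ m (fun y => (M y)⁻¹ j k) s := by
  have h : (fun y => (M y)⁻¹ j k) =
      fun y => ((M y).det)⁻¹ * ((M y).updateRow k (Pi.single j 1)).det := by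
    ext1 y
    rw [Matrix.inv_def, Matrix.smul_apply, Ring.inverse_eq_inv', Matrix.adjugate_apply, smul_eq_mul]
  rw [h]
  refine ((contDiffOn_det hM).inv h0).mul (contDiffOn_det fun a b => ?_)
  by_cases hak : a = k
  · subst hak
    simp only [Matrix.updateRow_self]
    exact contDiffOn_const
  · simp only [Matrix.updateRow_ne hak]
    exact hM a b

lemma contDiffOn_lam {η f : E → Ext n} (hη : ContDiffOn ℝ m η s) (hf : ContDiffOn ℝ m f s)
    (h0 : ∀ y ∈ s, (matrixOf (η y)).det ≠ 0) : ContDiffOn ℝ m (fun y => lam (η y) (f y)) s := by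
  have h : (fun y => lam (η y) (f y)) = fun y => ∑ j, ∑ k, (-Complex.I * (matrixOf (η y))⁻¹ k j) •
      contract (delbarVec k) (contract (delVec j) (f y)) := by
    ext1 y
    rw [lam_eq_sum]
    simp only [Finset.smul_sum, smul_smul]
  rw [h]
  refine ContDiffOn.sum fun j _ => ContDiffOn.sum fun k _ => contDiffOn_smul
    (contDiffOn_const.mul (contDiffOn_inv (contDiffOn_matrixOf hη) h0 k j)) ?_
  exact contDiffOn_linear (contract (delbarVec k)) (contDiffOn_linear (contract (delVec j)) hf)

lemma contDiffOn_exp_apply {B : E → Module.End ℂ (Ext n)} {N : ℕ} (hN : ∀ y ∈ s, B y ^ N = 0)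
    (hB : ∀ f : E → Ext n, ContDiffOn ℝ m f s → ContDiffOn ℝ m (fun y => B y (f y)) s)
    {f : E → Ext n} (hf : ContDiffOn ℝ m f s) :
    ContDiffOn ℝ m (fun y => IsNilpotent.exp (B y) (f y)) s := by
  have h1 : ∀ k : ℕ, ContDiffOn ℝ m (fun y => (B y ^ k) (f y)) s := by
    intro k
    induction k with
    | zero => simpa using hf
    | succ k ih => simpa only [pow_succ', Module.End.mul_apply] using hB _ ih
  have h2 : ContDiffOn ℝ m (fun y => ∑ k ∈ Finset.range N,
      ((k.factorial : ℂ)⁻¹) • (B y ^ k) (f y)) s :=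
    ContDiffOn.sum fun k _ => contDiffOn_smul contDiffOn_const (h1 k)
  refine h2.congr fun y hy => ?_
  rw [IsNilpotent.exp_eq_sum (hN y hy), LinearMap.sum_apply]
  refine Finset.sum_congr rfl fun k _ => ?_
  rw [LinearMap.smul_apply, rat_smul_eq]
  simp

lemma contDiffOn_weyl {η f : E → Ext n} (hη : ContDiffOn ℝ m η s)
    (h0 : ∀ y ∈ s, IsNondegOneOne (η y)) (hf : ContDiffOn ℝ m f s) :
    ContDiffOn ℝ m (fun y => weyl (η y) (f y)) s := by
  have hL : ∀ f : E → Ext n, ContDiffOn ℝ m f s →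
      ContDiffOn ℝ m (fun y => IsNilpotent.exp (lef (η y)) (f y)) s := fun f hf =>
    contDiffOn_exp_apply (N := n + 1) (fun y hy => lef_pow_eq_zero (h0 y hy))
      (fun f hf => contDiffOn_mul hη hf) hf
  have hΛ : ∀ f : E → Ext n, ContDiffOn ℝ m f s →
      ContDiffOn ℝ m (fun y => IsNilpotent.exp (-lam (η y)) (f y)) s := fun f hf =>
    contDiffOn_exp_apply (N := n + 1) (fun y hy => neg_pow_eq_zero (lam_pow_eq_zero (η y)))
      (fun f hf => (contDiffOn_lam hη hf fun y hy => (h0 y hy).det_ne_zero).neg) hf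
  exact hL _ (hΛ _ (hL _ hf))

lemma contDiffOn_starOp {η f : E → Ext n} (hη : ContDiffOn ℝ m η s)
    (h0 : ∀ y ∈ s, IsNondegOneOne (η y)) (hf : ContDiffOn ℝ m f s) :
    ContDiffOn ℝ m (fun y => starOp (η y) (f y)) s := by
  simp only [starOp_apply]
  exact contDiffOn_weyl hη h0 (contDiffOn_linear antiInv hf)

lemma contDiffOn_hodge {η f : E → Ext n} (hη : ContDiffOn ℝ m η s)
    (h0 : ∀ y ∈ s, IsNondegOneOne (η y)) (hf : ContDiffOn ℝ m f s) :
    ContDiffOn ℝ m (fun y => hodge (η y) (f y)) s :=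
  contDiffOn_starOp hη h0 (contDiffOn_conjExt (contDiffOn_linear weil.toLinearMap hf))

lemma contDiffOn_hodgeInv {η f : E → Ext n} (hη : ContDiffOn ℝ m η s)
    (h0 : ∀ y ∈ s, IsNondegOneOne (η y)) (hf : ContDiffOn ℝ m f s) :
    ContDiffOn ℝ m (fun y => hodgeInv (η y) (f y)) s :=
  contDiffOn_linear weilInv.toLinearMap (contDiffOn_conjExt (contDiffOn_starOp hη h0 hf))

end ContDiff

/-! ### The local operators -/

/-- The `(0,1)`-part of a real-linear form-valued map, wedged. -/
def dbarOf (D : (Fin n → ℂ) →L[ℝ] Ext n) : Ext n :=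
  ∑ l, wedge (dzbar l) ((1 / 2 : ℂ) • (D (ex l) + Complex.I • D (ey l)))

/-- The `(1,0)`-part of a real-linear form-valued map, wedged. -/
def delOf (D : (Fin n → ℂ) →L[ℝ] Ext n) : Ext n :=
  ∑ l, wedge (dz l) ((1 / 2 : ℂ) • (D (ex l) - Complex.I • D (ey l)))

section LocalOperators

variable {f g : (Fin n → ℂ) → Ext n} {y : Fin n → ℂ}

lemma fderiv_linear {F : Type*} [NormedAddCommGroup F] [NormedSpace ℂ F] (φ : Ext n →ₗ[ℂ] F)
    (hf : DifferentiableAt ℝ f y) (v : Fin n → ℂ) :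
    fderiv ℝ (fun y => φ (f y)) y v = φ (fderiv ℝ f y v) :=
  congrArg (fun D => D v) ((realCLM φ).hasFDerivAt.comp y hf.hasFDerivAt).fderiv

lemma differentiableAt_linear {F : Type*} [NormedAddCommGroup F] [NormedSpace ℂ F]
    (φ : Ext n →ₗ[ℂ] F) (hf : DifferentiableAt ℝ f y) :
    DifferentiableAt ℝ (fun y => φ (f y)) y :=
  ((realCLM φ).hasFDerivAt.comp y hf.hasFDerivAt).differentiableAt

/-- Components are linear functionals and commute with the derivative; expanding the derivative of f
in monomials recovers the componentwise definition. -/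
lemma partialZbar_eq (hf : DifferentiableAt ℝ f y) (l : Fin n) :
    partialZbar f l y = (1 / 2 : ℂ) • (fderiv ℝ f y (ex l) + Complex.I • fderiv ℝ f y (ey l)) := by
  conv_rhs => rw [form_eq_sum_component
    ((1 / 2 : ℂ) • (fderiv ℝ f y (ex l) + Complex.I • fderiv ℝ f y (ey l)))]
  simp only [partialZbar, ← componentₗ_apply, fderiv_linear _ hf, map_smul, map_add, smul_eq_mul]

lemma partialZ_eq (hf : DifferentiableAt ℝ f y) (l : Fin n) :
    partialZ f l y = (1 / 2 : ℂ) • (fderiv ℝ f y (ex l) - Complex.I • fderiv ℝ f y (ey l)) := by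
  conv_rhs => rw [form_eq_sum_component
    ((1 / 2 : ℂ) • (fderiv ℝ f y (ex l) - Complex.I • fderiv ℝ f y (ey l)))]
  simp only [partialZ, ← componentₗ_apply, fderiv_linear _ hf, map_smul, map_sub, smul_eq_mul]

lemma localDbar_eq (hf : DifferentiableAt ℝ f y) : localDbar f y = dbarOf (fderiv ℝ f y) := by
  simp only [localDbar, dbarOf, partialZbar_eq hf, LinearMap.mulLeft_apply]

lemma localDel_eq (hf : DifferentiableAt ℝ f y) : localDel f y = delOf (fderiv ℝ f y) := by
  simp only [localDel, delOf, partialZ_eq hf, LinearMap.mulLeft_apply]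

lemma hasFDerivAt_mul (hf : DifferentiableAt ℝ f y) (hg : DifferentiableAt ℝ g y) :
    HasFDerivAt (fun y => f y * g y) (mulCLM.precompR (Fin n → ℂ) (f y) (fderiv ℝ g y) +
      mulCLM.precompL (Fin n → ℂ) (fderiv ℝ f y) (g y)) y :=
  mulCLM.hasFDerivAt_of_bilinear hf.hasFDerivAt hg.hasFDerivAt

lemma fderiv_mul_form (hf : DifferentiableAt ℝ f y) (hg : DifferentiableAt ℝ g y)
    (v : Fin n → ℂ) : fderiv ℝ (fun y => f y * g y) y v =
      f y * fderiv ℝ g y v + fderiv ℝ f y v * g y := by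
  rw [(hasFDerivAt_mul hf hg).fderiv]
  rfl

lemma ι_mul_eq (α : Covec n) (x : Ext n) :
    ExteriorAlgebra.ι ℂ α * x = involution x * ExteriorAlgebra.ι ℂ α := by
  rw [mul_ι_eq, involution_involution, LinearMap.mulLeft_apply]

/-- The Leibniz rule for `∂̄`. -/
lemma localDbar_mul (hf : DifferentiableAt ℝ f y) (hg : DifferentiableAt ℝ g y) :
    localDbar (fun y => f y * g y) y =
      localDbar f y * g y + involution (f y) * localDbar g y := by
  rw [localDbar_eq (hasFDerivAt_mul hf hg).differentiableAt, localDbar_eq hf, localDbar_eq hg]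
  simp only [dbarOf, fderiv_mul_form hf hg, Finset.sum_mul, Finset.mul_sum,
    ← Finset.sum_add_distrib]
  refine Finset.sum_congr rfl fun l _ => ?_
  simp only [LinearMap.mulLeft_apply, mul_smul_comm, smul_mul_assoc, ← smul_add]
  congr 1
  simp only [mul_add, add_mul, mul_smul_comm, smul_mul_assoc, smul_add, ← mul_assoc,
    ← ι_mul_eq]
  abel

lemma localDbar_congr {f g : (Fin n → ℂ) → Ext n} (h : f =ᶠ[nhds y] g) :
    localDbar f y = localDbar g y := by
  have h1 : ∀ (p q : ℕ) (J : Fin p → Fin n) (K : Fin q → Fin n),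
      fderiv ℝ (fun y' => component (f y') J K) y = fderiv ℝ (fun y' => component (g y') J K) y :=
    fun p q J K => Filter.EventuallyEq.fderiv_eq (h.mono fun y' hy' => congrArg (component · J K) hy')
  simp only [localDbar, partialZbar, h1]

lemma localDbar_const (x : Ext n) : localDbar (fun _ : Fin n → ℂ => x) y = 0 := by
  rw [localDbar_eq (differentiableAt_const x)]
  simp [dbarOf]

lemma localDbar_add (hf : DifferentiableAt ℝ f y) (hg : DifferentiableAt ℝ g y) :
    localDbar (fun y => f y + g y) y = localDbar f y + localDbar g y := by
  rw [localDbar_eq (hf.fun_add hg), localDbar_eq hf, localDbar_eq hg]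
  simp only [dbarOf, ← Finset.sum_add_distrib, ← map_add, ← smul_add]
  refine Finset.sum_congr rfl fun l _ => ?_
  rw [fderiv_fun_add hf hg]
  simp only [add_apply, smul_add, map_add]
  abel

lemma localDbar_sum {ι : Type*} (s : Finset ι) (F : ι → (Fin n → ℂ) → Ext n)
    (hF : ∀ i ∈ s, DifferentiableAt ℝ (F i) y) :
    localDbar (fun y => ∑ i ∈ s, F i y) y = ∑ i ∈ s, localDbar (F i) y := by
  classical
  induction s using Finset.induction_on with
  | empty => simpa using localDbar_const (0 : Ext n)
  | insert a s ha ih =>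
    simp only [Finset.sum_insert ha]
    rw [localDbar_add (hF a (Finset.mem_insert_self a s))
      (DifferentiableAt.fun_sum fun i hi => hF i (Finset.mem_insert_of_mem hi)),
      ih fun i hi => hF i (Finset.mem_insert_of_mem hi)]

lemma localDbar_const_smul (c : ℂ) (hf : DifferentiableAt ℝ f y) :
    localDbar (fun y => c • f y) y = c • localDbar f y := by
  have h := localDbar_mul (f := fun _ => c • (1 : Ext n)) (differentiableAt_const _) hf
  rw [localDbar_const] at h
  simpa using h

end LocalOperators

/-! ### Holomorphic changes of coordinates -/

/-- `A` is the real map underlying a complex-linear map. -/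
def IsComplexLinear (A : (Fin n → ℂ) →L[ℝ] (Fin n → ℂ)) : Prop :=
  ∃ B : (Fin n → ℂ) →L[ℂ] (Fin n → ℂ), B.restrictScalars ℝ = A

/-- A smooth map that is holomorphic near `y`. -/
structure IsHoloAt (t : (Fin n → ℂ) → (Fin n → ℂ)) (y : Fin n → ℂ) : Prop where
  contDiffAt : ContDiffAt ℝ ∞ t y
  complexLinear : ∀ᶠ y' in nhds y, IsComplexLinear (fderiv ℝ t y')

lemma IsHoloAt.of_contDiffAt {t : (Fin n → ℂ) → (Fin n → ℂ)} {y : Fin n → ℂ}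
    (h : ContDiffAt ℂ ω t y) : IsHoloAt t y := by
  refine ⟨(h.restrict_scalars ℝ).of_le le_top, ?_⟩
  filter_upwards [h.eventually (by simp)] with y' hy'
  exact ⟨fderiv ℂ t y', ((hy'.differentiableAt (by simp)).fderiv_restrictScalars ℝ).symm⟩

lemma IsComplexLinear.map_I_smul {A : (Fin n → ℂ) →L[ℝ] (Fin n → ℂ)} (hA : IsComplexLinear A)
    (w : Fin n → ℂ) : A (Complex.I • w) = Complex.I • A w := by
  obtain ⟨B, rfl⟩ := hA
  exact map_smul B _ _

lemma ey_eq (l : Fin n) : ey l = Complex.I • ex l := by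
  ext k
  by_cases h : k = l
  · subst h; simp [ex, ey]
  · simp [ex, ey, h]

/-- The pullback of a form under a linear map, as a function of the map, is a polynomial; for a
covector it is linear. -/
def pullCovecCLM (α : Covec n) : ((Fin n → ℂ) →L[ℝ] (Fin n → ℂ)) →L[ℝ] Ext n :=
  LinearMap.toContinuousLinearMap
    { toFun := fun A => ExteriorAlgebra.ι ℂ (α.comp A)
      map_add' := fun A B => by rw [ContinuousLinearMap.comp_add, map_add]
      map_smul' := fun c A => by
        have h : α.comp (c • A) = (c : ℂ) • α.comp A := by ext v; simp
        rw [h, map_smul, RingHom.id_apply, Complex.coe_smul] }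

lemma pullCovecCLM_apply (α : Covec n) (A : (Fin n → ℂ) →L[ℝ] (Fin n → ℂ)) :
    pullCovecCLM α A = ExteriorAlgebra.ι ℂ (α.comp A) := rfl

section Local

variable {t : (Fin n → ℂ) → (Fin n → ℂ)} {y : Fin n → ℂ} (ht : IsHoloAt t y)
include ht

lemma IsHoloAt.contDiffAt_fderiv : ContDiffAt ℝ ∞ (fderiv ℝ t) y :=
  ht.contDiffAt.fderiv_right (m := ∞) (by simp)

lemma IsHoloAt.differentiableAt_fderiv : DifferentiableAt ℝ (fderiv ℝ t) y :=
  ht.contDiffAt_fderiv.differentiableAt (by simp)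

/-- Differentiate Dt(iw) = i Dt(w), which holds in a whole neighbourhood of y. -/
lemma IsHoloAt.second_fderiv_I_smul (v w : Fin n → ℂ) :
    fderiv ℝ (fderiv ℝ t) y v (Complex.I • w) = Complex.I • fderiv ℝ (fderiv ℝ t) y v w := by
  have h1 : ∀ w, HasFDerivAt (fun y' => fderiv ℝ t y' w)
      ((ContinuousLinearMap.apply ℝ (Fin n → ℂ) w).comp (fderiv ℝ (fderiv ℝ t) y)) y := fun w =>
    (ContinuousLinearMap.apply ℝ (Fin n → ℂ) w).hasFDerivAt.comp y
      ht.differentiableAt_fderiv.hasFDerivAt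
  have h2 := h1 (Complex.I • w)
  have h3 := (h1 w).const_smul Complex.I
  have h4 : (fun y' => fderiv ℝ t y' (Complex.I • w)) =ᶠ[nhds y]
      fun y' => Complex.I • fderiv ℝ t y' w := by
    filter_upwards [ht.complexLinear] with y' hy'
    exact hy'.map_I_smul w
  have h5 := (h3.congr_of_eventuallyEq h4).unique h2
  exact (congrArg (fun D : (Fin n → ℂ) →L[ℝ] (Fin n → ℂ) => D v) h5).symm

lemma IsHoloAt.second_fderiv_symm (v w : Fin n → ℂ) :
    fderiv ℝ (fderiv ℝ t) y v w = fderiv ℝ (fderiv ℝ t) y w v :=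
  (ht.contDiffAt.isSymmSndFDerivAt (by
    rw [minSmoothness_of_isRCLikeNormedField]; exact WithTop.coe_le_coe.2 (le_top : (2 : ℕ∞) ≤ ⊤))).eq v w

/-- Symmetry of the second derivative transfers complex linearity from the second argument to the
first. -/
lemma IsHoloAt.second_fderiv_ey (l : Fin n) (w : Fin n → ℂ) :
    fderiv ℝ (fderiv ℝ t) y (ey l) w = Complex.I • fderiv ℝ (fderiv ℝ t) y (ex l) w := by
  rw [ht.second_fderiv_symm, ey_eq, ht.second_fderiv_I_smul, ht.second_fderiv_symm]

lemma IsHoloAt.contDiffAt_pullCovec (α : Covec n) :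
    ContDiffAt ℝ ∞ (fun y' => ExteriorAlgebra.ι ℂ (α.comp (fderiv ℝ t y'))) y :=
  (pullCovecCLM α).contDiff.contDiffAt.comp y ht.contDiffAt_fderiv

lemma IsHoloAt.fderiv_pullCovec (α : Covec n) (v : Fin n → ℂ) :
    fderiv ℝ (fun y' => ExteriorAlgebra.ι ℂ (α.comp (fderiv ℝ t y'))) y v =
      ExteriorAlgebra.ι ℂ (α.comp (fderiv ℝ (fderiv ℝ t) y v)) :=
  congrArg (fun D => D v) ((pullCovecCLM α).hasFDerivAt.comp y
    ht.differentiableAt_fderiv.hasFDerivAt).fderiv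

/-- The pullback is dtⱼ, whose coefficients are holomorphic: the derivatives along x and y differ by
the factor i and cancel in ∂̄. -/
lemma IsHoloAt.localDbar_pullCovec_dz (j : Fin n) :
    localDbar (fun y' => ExteriorAlgebra.ι ℂ ((dz j).comp (fderiv ℝ t y'))) y = 0 := by
  rw [localDbar_eq ((ht.contDiffAt_pullCovec _).differentiableAt (by simp)), dbarOf]
  refine Finset.sum_eq_zero fun l _ => ?_
  have h : (dz j).comp (fderiv ℝ (fderiv ℝ t) y (ey l)) =
      Complex.I • (dz j).comp (fderiv ℝ (fderiv ℝ t) y (ex l)) := by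
    ext w
    simp [dz, ht.second_fderiv_ey]
  rw [ht.fderiv_pullCovec, ht.fderiv_pullCovec, h, map_smul (ExteriorAlgebra.ι ℂ), smul_smul,
    Complex.I_mul_I, neg_smul,
    one_smul, add_neg_cancel, smul_zero, map_zero]

lemma IsHoloAt.isComplexLinear_second (v : Fin n → ℂ) :
    IsComplexLinear (fderiv ℝ (fderiv ℝ t) y v) := by
  refine ⟨LinearMap.toContinuousLinearMap
    { toFun := fun w => fderiv ℝ (fderiv ℝ t) y v w
      map_add' := fun a b => map_add _ a b
      map_smul' := fun c w => ?_ }, ?_⟩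
  · have h : c • w = c.re • w + c.im • (Complex.I • w) := by
      conv_lhs => rw [← Complex.re_add_im c]
      rw [add_smul, mul_smul, Complex.coe_smul, Complex.coe_smul]
    rw [h, map_add, map_smul, map_smul, ht.second_fderiv_I_smul, RingHom.id_apply]
    conv_rhs => rw [← Complex.re_add_im c]
    rw [add_smul, mul_smul, Complex.coe_smul, Complex.coe_smul]
  · rfl

/-- ∂̄ of the conjugate of dtⱼ is the sum of conj(∂ₗ∂ₘtⱼ) dz̄ₗ ∧ dz̄ₘ, in which symmetric
coefficients meet antisymmetric products. -/
lemma IsHoloAt.localDbar_pullCovec_dzbar (j : Fin n) :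
    localDbar (fun y' => ExteriorAlgebra.ι ℂ ((dzbar j).comp (fderiv ℝ t y'))) y = 0 := by
  rw [localDbar_eq ((ht.contDiffAt_pullCovec _).differentiableAt (by simp)), dbarOf]
  choose B hB using fun l : Fin n => ht.isComplexLinear_second (ex l)
  have h : ∀ l, (1 / 2 : ℂ) • (fderiv ℝ (fun y' => ExteriorAlgebra.ι ℂ
      ((dzbar j).comp (fderiv ℝ t y'))) y (ex l) + Complex.I • fderiv ℝ (fun y' =>
        ExteriorAlgebra.ι ℂ ((dzbar j).comp (fderiv ℝ t y'))) y (ey l)) =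
      ∑ m, conj (cmatrix (B l) j m) • ExteriorAlgebra.ι ℂ (dzbar m) := by
    intro l
    have h1 : (dzbar j).comp (fderiv ℝ (fderiv ℝ t) y (ey l)) =
        (-Complex.I) • (dzbar j).comp (fderiv ℝ (fderiv ℝ t) y (ex l)) := by
      ext w
      simp [dzbar, ht.second_fderiv_ey]
    rw [ht.fderiv_pullCovec, ht.fderiv_pullCovec, h1, map_smul (ExteriorAlgebra.ι ℂ), smul_smul, mul_neg,
      Complex.I_mul_I, neg_neg, one_smul, ← hB, dzbar_comp_eq_sum, map_sum, ← two_smul ℂ, smul_smul]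
    norm_num
  have hs : ∀ l m, cmatrix (B l) j m = cmatrix (B m) j l := by
    intro l m
    have h1 : ∀ l m, cmatrix (B l) j m = fderiv ℝ (fderiv ℝ t) y (ex l) (ex m) j := fun l m => by
      rw [← hB l]; rfl
    rw [h1, h1, ht.second_fderiv_symm]
  simp only [h, map_sum, map_smul, LinearMap.mulLeft_apply]
  have h2 : ∑ l, ∑ m, conj (cmatrix (B l) j m) •
      (ExteriorAlgebra.ι ℂ (dzbar l) * ExteriorAlgebra.ι ℂ (dzbar m)) =
      -∑ l, ∑ m, conj (cmatrix (B l) j m) •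
        (ExteriorAlgebra.ι ℂ (dzbar l) * ExteriorAlgebra.ι ℂ (dzbar m)) := by
    conv_lhs => rw [Finset.sum_comm]
    simp only [← Finset.sum_neg_distrib]
    refine Finset.sum_congr rfl fun m _ => Finset.sum_congr rfl fun l _ => ?_
    have h3 := wedge_comm (dzbar l) (dzbar m) (1 : Ext n)
    simp only [LinearMap.mulLeft_apply, mul_one] at h3
    rw [hs l m, h3, smul_neg]
  have h3 : (2 : ℂ) • ∑ l, ∑ m, conj (cmatrix (B l) j m) •
      (ExteriorAlgebra.ι ℂ (dzbar l) * ExteriorAlgebra.ι ℂ (dzbar m)) = 0 := by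
    rw [two_smul]
    nth_rewrite 1 [h2]
    exact neg_add_cancel _
  exact (smul_eq_zero.1 h3).resolve_left two_ne_zero

/-- The pullback of a constant form is smooth and `∂̄`-closed. -/
lemma IsHoloAt.pullback_const (φ : Ext n) :
    ContDiffAt ℝ ∞ (fun y' => pullback (fderiv ℝ t y') φ) y ∧
      localDbar (fun y' => pullback (fderiv ℝ t y') φ) y = 0 := by
  have hw : ∀ (α : Covec n) (x : Ext n),
      localDbar (fun y' => ExteriorAlgebra.ι ℂ (α.comp (fderiv ℝ t y'))) y = 0 →
      (ContDiffAt ℝ ∞ (fun y' => pullback (fderiv ℝ t y') x) y ∧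
        localDbar (fun y' => pullback (fderiv ℝ t y') x) y = 0) →
      ContDiffAt ℝ ∞ (fun y' => pullback (fderiv ℝ t y') (wedge α x)) y ∧
        localDbar (fun y' => pullback (fderiv ℝ t y') (wedge α x)) y = 0 := by
    intro α x hα hx
    have h1 : (fun y' => pullback (fderiv ℝ t y') (wedge α x)) = fun y' =>
        ExteriorAlgebra.ι ℂ (α.comp (fderiv ℝ t y')) * pullback (fderiv ℝ t y') x := by
      ext1 y'
      rw [pullback_wedge, LinearMap.mulLeft_apply]
    rw [h1]
    refine ⟨?_, ?_⟩
    · exact mulCLM.isBoundedBilinearMap.contDiff.contDiffAt.comp y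
        ((ht.contDiffAt_pullCovec α).prodMk hx.1)
    · rw [localDbar_mul ((ht.contDiffAt_pullCovec α).differentiableAt (by simp))
        (hx.1.differentiableAt (by simp)), hα, hx.2, zero_mul, mul_zero, add_zero]
  induction φ using form_induction with
  | one =>
    simp only [map_one]
    exact ⟨contDiffAt_const, localDbar_const 1⟩
  | add x y' hx hy =>
    simp only [map_add]
    exact ⟨hx.1.add hy.1, by rw [localDbar_add (hx.1.differentiableAt (by simp))
      (hy.1.differentiableAt (by simp)), hx.2, hy.2, add_zero]⟩
  | smul c x hx =>
    simp only [map_smul]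
    exact ⟨(realCLM (LinearMap.lsmul ℂ (Ext n) c)).contDiff.contDiffAt.comp y hx.1, by
      rw [localDbar_const_smul c (hx.1.differentiableAt (by simp)), hx.2, smul_zero]⟩
  | hz j x hx => exact hw _ x (ht.localDbar_pullCovec_dz j) hx
  | hzb j x hx => exact hw _ x (ht.localDbar_pullCovec_dzbar j) hx

-- The chain rule for ∂̄ at the level of one derivative: composition with a complex-linear map
-- transforms the ∂/∂z̄ part by the conjugate matrix, exactly as the pullback transforms dz̄.
omit ht in
lemma dbarOf_comp (D : (Fin n → ℂ) →L[ℝ] Ext n) (A : (Fin n → ℂ) →L[ℂ] (Fin n → ℂ)) :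
    dbarOf ((realCLM (pullback (A.restrictScalars ℝ)).toLinearMap).comp
      (D.comp (A.restrictScalars ℝ))) = pullback (A.restrictScalars ℝ) (dbarOf D) := by
  have h1 : ∀ l, A (ex l) = ∑ m, ((cmatrix A m l).re • ex m + (cmatrix A m l).im • ey m) := by
    intro l
    ext k
    rw [Finset.sum_apply, Finset.sum_eq_single k]
    · simp [cmatrix, ex, ey]
    · intro m _ hm; simp [ex, ey, hm.symm]
    · simp
  have h2 : ∀ l, A (ey l) = ∑ m, (-(cmatrix A m l).im • ex m + (cmatrix A m l).re • ey m) := by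
    intro l
    rw [map_ey]
    ext k
    rw [Finset.sum_apply, Finset.sum_eq_single k]
    · simp only [Pi.smul_apply, smul_eq_mul, Pi.add_apply, ex, ey, Pi.single_eq_same, cmatrix,
        Matrix.of_apply, Complex.real_smul, mul_one]
      apply Complex.ext <;> simp
    · intro m _ hm; simp [ex, ey, hm.symm]
    · simp
  have h3 : ∀ l, D (A (ex l)) + Complex.I • D (A (ey l)) =
      ∑ m, conj (cmatrix A m l) • (D (ex m) + Complex.I • D (ey m)) := by
    intro l
    rw [h1, h2, map_sum, map_sum, Finset.smul_sum, ← Finset.sum_add_distrib]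
    refine Finset.sum_congr rfl fun m _ => ?_
    have h4 : conj (cmatrix A m l) = (cmatrix A m l).re - Complex.I * (cmatrix A m l).im := by
      apply Complex.ext <;> simp
    rw [h4]
    have hD : ∀ (r : ℝ) (w : Fin n → ℂ), D (r • w) = (r : ℂ) • D w := fun r w => by
      rw [Complex.coe_smul]; exact D.map_smul r w
    simp only [map_add, hD]
    push_cast
    simp only [smul_add, smul_neg, smul_smul, sub_mul, sub_smul, mul_neg, neg_smul]
    have h5 : Complex.I * (cmatrix A m l).im * Complex.I = -((cmatrix A m l).im : ℂ) := by
      linear_combination ((cmatrix A m l).im : ℂ) * Complex.I_mul_I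
    rw [h5, neg_smul, mul_comm (Complex.I) ((cmatrix A m l).re : ℂ)]
    abel
  simp only [dbarOf, map_sum, pullback_wedge, dzbar_comp_eq_sum]
  have h6 : ∀ l, (1 / 2 : ℂ) • (((realCLM (pullback (A.restrictScalars ℝ)).toLinearMap).comp
      (D.comp (A.restrictScalars ℝ))) (ex l) + Complex.I •
      ((realCLM (pullback (A.restrictScalars ℝ)).toLinearMap).comp
      (D.comp (A.restrictScalars ℝ))) (ey l)) = ∑ m, conj (cmatrix A m l) •
        pullback (A.restrictScalars ℝ) ((1 / 2 : ℂ) • (D (ex m) + Complex.I • D (ey m))) := by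
    intro l
    have h7 := congrArg (fun x => pullback (A.restrictScalars ℝ) ((1 / 2 : ℂ) • x)) (h3 l)
    simp only [Finset.smul_sum, map_sum, smul_comm (1 / 2 : ℂ) (conj _)] at h7
    simp only [map_smul (pullback (A.restrictScalars ℝ)) (conj _)] at h7
    rw [← h7, map_smul, map_add, map_smul]
    rfl
  simp only [h6, map_sum, map_smul (wedge _) (conj _)]
  rw [Finset.sum_comm]
  refine Finset.sum_congr rfl fun m _ => ?_
  simp only [LinearMap.mulLeft_apply, map_sum, Finset.sum_mul]
  refine Finset.sum_congr rfl fun l _ => ?_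
  rw [map_smul (ExteriorAlgebra.ι ℂ), smul_mul_assoc]

/-- `∂̄` commutes with holomorphic changes of coordinates. -/
theorem IsHoloAt.localDbar_pullback {f : (Fin n → ℂ) → Ext n} (hf : DifferentiableAt ℝ f (t y)) :
    localDbar (fun y' => pullback (fderiv ℝ t y') (f (t y'))) y =
      pullback (fderiv ℝ t y) (localDbar f (t y)) := by
  obtain ⟨A, hA⟩ := ht.complexLinear.self_of_nhds
  have htd : DifferentiableAt ℝ t y := ht.contDiffAt.differentiableAt (by simp)
  -- Expand f in a basis of constant forms, with scalar coefficients as forms of degree zero.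
  -- Scalars obey the chain rule, pulled back constant forms are ∂̄-closed, and the Leibniz rule
  -- combines the two.
  let h : Fin (Module.finrank ℂ (Ext n)) → (Fin n → ℂ) → Ext n := fun i z =>
    (Module.finBasis ℂ (Ext n)).coord i (f z) • 1
  have hd : ∀ i, DifferentiableAt ℝ (h i) (t y) := fun i =>
    differentiableAt_linear (LinearMap.toSpanSingleton ℂ (Ext n) 1 ∘ₗ
      (Module.finBasis ℂ (Ext n)).coord i) hf
  have hd' : ∀ i, DifferentiableAt ℝ (fun y' => h i (t y')) y := fun i => (hd i).comp y htd
  have e1 : f = fun z => ∑ i, h i z * Module.finBasis ℂ (Ext n) i := by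
    ext1 z
    simp only [h, smul_mul_assoc, one_mul]
    exact form_eq_sum_basis (f z)
  have hp : ∀ i y', pullback (fderiv ℝ t y') (h i (t y')) = h i (t y') := fun i y' => by
    simp only [h, map_smul, map_one]
  have e2 : (fun y' => pullback (fderiv ℝ t y') (f (t y'))) = fun y' => ∑ i, h i (t y') *
      pullback (fderiv ℝ t y') (Module.finBasis ℂ (Ext n) i) := by
    ext1 y'
    rw [e1]
    simp only [map_sum, map_mul, hp]
  have e3 : ∀ i, localDbar (fun y' => h i (t y')) y =
      pullback (fderiv ℝ t y) (localDbar (h i) (t y)) := by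
    intro i
    rw [localDbar_eq (hd' i), localDbar_eq (hd i), ← hA, ← dbarOf_comp]
    congr 1
    ext v
    have h1 : fderiv ℝ (fun y' => h i (t y')) y = (fderiv ℝ (h i) (t y)).comp (fderiv ℝ t y) :=
      fderiv_comp y (hd i) htd
    have h2 : ∀ w, fderiv ℝ (h i) (t y) w = (Module.finBasis ℂ (Ext n)).coord i
        (fderiv ℝ f (t y) w) • 1 := fun w =>
      fderiv_linear (LinearMap.toSpanSingleton ℂ (Ext n) 1 ∘ₗ
        (Module.finBasis ℂ (Ext n)).coord i) hf w
    rw [h1, ← hA]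
    simp [h2]
  have hc := fun i => ht.pullback_const (Module.finBasis ℂ (Ext n) i)
  rw [e2, localDbar_sum]
  · conv_rhs => rw [e1]
    rw [localDbar_sum]
    · rw [map_sum]
      refine Finset.sum_congr rfl fun i _ => ?_
      rw [localDbar_mul (hd' i) ((hc i).1.differentiableAt (by simp)), (hc i).2, mul_zero, add_zero,
        localDbar_mul (hd i) (differentiableAt_const _), localDbar_const, mul_zero, add_zero,
        map_mul, e3]
    · exact fun i _ => (hasFDerivAt_mul (hd i) (differentiableAt_const _)).differentiableAt
  · exact fun i _ => (hasFDerivAt_mul (hd' i)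
      ((hc i).1.differentiableAt (by simp))).differentiableAt

end Local

/-! ### Forms in charts -/

section Charts

set_option linter.unusedSectionVars false

variable {X : Type*} [TopologicalSpace X] [ChartedSpace (Fin n → ℂ) X]

/-- The change of coordinates from the chart at `c` to the chart at `c'`. -/
def transition (c c' : X) (y : Fin n → ℂ) : Fin n → ℂ :=
  chartAt (Fin n → ℂ) c' ((chartAt (Fin n → ℂ) c).symm y)

lemma isSmooth_iff {u : Form n X} : IsSmooth u ↔
    ∀ c, ContDiffOn ℝ ∞ (inChart c u) (chartAt (Fin n → ℂ) c).target :=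
  forall_congr' fun _ => contDiffOn_ext_iff.symm

lemma inChart_mul (c : X) (u v : Form n X) (y : Fin n → ℂ) :
    inChart c (fun x => u x * v x) y = inChart c u y * inChart c v y :=
  map_mul (ExteriorAlgebra.map _) _ _

lemma inChart_add (c : X) (u v : Form n X) (y : Fin n → ℂ) :
    inChart c (u + v) y = inChart c u y + inChart c v y :=
  map_add (ExteriorAlgebra.map _) _ _

lemma inChart_neg (c : X) (u : Form n X) (y : Fin n → ℂ) :
    inChart c (-u) y = -inChart c u y :=
  map_neg (ExteriorAlgebra.map _) _

lemma inChart_sub (c : X) (u v : Form n X) (y : Fin n → ℂ) :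
    inChart c (u - v) y = inChart c u y - inChart c v y :=
  map_sub (ExteriorAlgebra.map _) _ _

lemma inChart_smul (c : X) (a : X → ℂ) (u : Form n X) (y : Fin n → ℂ) :
    inChart c (fun x => a x • u x) y =
      a ((chartAt (Fin n → ℂ) c).symm y) • inChart c u y :=
  map_smul (ExteriorAlgebra.map _) _ _

lemma inChart_eq_zero {c : X} {u : Form n X} {y : Fin n → ℂ}
    (h : u ((chartAt (Fin n → ℂ) c).symm y) = 0) : inChart c u y = 0 := by
  rw [inChart, h, map_zero]

variable [IsManifold 𝓘(ℂ, Fin n → ℂ) ω X]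

lemma contDiffOn_coord_change (e e' : OpenPartialHomeomorph X (Fin n → ℂ))
    (he : e ∈ atlas (Fin n → ℂ) X) (he' : e' ∈ atlas (Fin n → ℂ) X) :
    ContDiffOn ℂ ω (e.symm ≫ₕ e') (e.symm ≫ₕ e').source := by
  have h := (contDiffGroupoid ω 𝓘(ℂ, Fin n → ℂ)).compatible he he'
  have h1 := (mem_groupoid_of_pregroupoid.1 h).1
  simpa [contDiffPregroupoid] using h1

/-- The underlying real manifold. -/
lemma isManifold_real : IsManifold 𝓘(ℝ, Fin n → ℂ) ∞ X := by
  refine isManifold_of_contDiffOn _ _ _ fun e e' he he' => ?_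
  have h := ((contDiffOn_coord_change e e' he he').restrict_scalars ℝ).of_le
    (le_top : (∞ : ℕ∞ω) ≤ ω)
  simpa using h

section Transition

variable {c c' : X} {y : Fin n → ℂ} (hy : y ∈ (chartAt (Fin n → ℂ) c).target)
  (hx : (chartAt (Fin n → ℂ) c).symm y ∈ (chartAt (Fin n → ℂ) c').source)
include hy hx

lemma eventually_mem_overlap : ∀ᶠ y' in nhds y, y' ∈ (chartAt (Fin n → ℂ) c).target ∧
    (chartAt (Fin n → ℂ) c).symm y' ∈ (chartAt (Fin n → ℂ) c').source := by
  have h1 := (chartAt (Fin n → ℂ) c).open_target.mem_nhds hy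
  have h2 := ((chartAt (Fin n → ℂ) c).continuousAt_symm hy).preimage_mem_nhds
    ((chartAt (Fin n → ℂ) c').open_source.mem_nhds hx)
  filter_upwards [h1, h2] with y' h3 h4 using ⟨h3, h4⟩

lemma isHoloAt_transition : IsHoloAt (transition c c') y := by
  refine IsHoloAt.of_contDiffAt ?_
  have h := contDiffOn_coord_change _ _ (chart_mem_atlas (Fin n → ℂ) c)
    (chart_mem_atlas (Fin n → ℂ) c')
  refine h.contDiffAt (((chartAt (Fin n → ℂ) c).symm ≫ₕ
    (chartAt (Fin n → ℂ) c')).open_source.mem_nhds ?_)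
  rw [OpenPartialHomeomorph.trans_source]
  exact ⟨hy, hx⟩

lemma differentiableAt_transition : DifferentiableAt ℝ (transition c c') y :=
  (isHoloAt_transition hy hx).contDiffAt.differentiableAt (by simp)

lemma transition_symm : (chartAt (Fin n → ℂ) c').symm (transition c c' y) =
    (chartAt (Fin n → ℂ) c).symm y :=
  (chartAt (Fin n → ℂ) c').left_inv hx

lemma transition_mem : transition c c' y ∈ (chartAt (Fin n → ℂ) c').target :=
  (chartAt (Fin n → ℂ) c').map_source hx

lemma transition_transition : transition c' c (transition c c' y) = y := by
  rw [transition, transition_symm hy hx, (chartAt (Fin n → ℂ) c).right_inv hy]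

lemma fderiv_transition_comp (c'' : X)
    (hx' : (chartAt (Fin n → ℂ) c).symm y ∈ (chartAt (Fin n → ℂ) c'').source) :
    (fderiv ℝ (transition c' c'') (transition c c' y)).comp (fderiv ℝ (transition c c') y) =
      fderiv ℝ (transition c c'') y := by
  have h1 : DifferentiableAt ℝ (transition c' c'') (transition c c' y) :=
    differentiableAt_transition (transition_mem hy hx) (by rwa [transition_symm hy hx])
  rw [← fderiv_comp y h1 (differentiableAt_transition hy hx)]
  refine Filter.EventuallyEq.fderiv_eq ?_
  filter_upwards [eventually_mem_overlap hy hx] with y' hy'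
  rw [Function.comp_apply, transition, transition_symm hy'.1 hy'.2, transition]

end Transition

lemma isComplexLinear_transition {c c' : X} {y : Fin n → ℂ}
    (hy : y ∈ (chartAt (Fin n → ℂ) c).target)
    (hx : (chartAt (Fin n → ℂ) c).symm y ∈ (chartAt (Fin n → ℂ) c').source) :
    ∃ A : (Fin n → ℂ) →L[ℂ] (Fin n → ℂ), A.restrictScalars ℝ = fderiv ℝ (transition c c') y ∧
      (cmatrix A).det ≠ 0 := by
  obtain ⟨A, hA⟩ := (isHoloAt_transition hy hx).complexLinear.self_of_nhds
  have hx' : (chartAt (Fin n → ℂ) c').symm (transition c c' y) ∈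
      (chartAt (Fin n → ℂ) c).source := by
    rw [transition_symm hy hx]
    exact (chartAt (Fin n → ℂ) c).map_target hy
  have hy' := transition_mem hy hx
  obtain ⟨B, hB⟩ := (isHoloAt_transition hy' hx').complexLinear.self_of_nhds
  refine ⟨A, hA, ?_⟩
  have h1 := fderiv_transition_comp hy' hx' c' (by rw [transition_symm hy hx]; exact hx)
  rw [transition_transition hy hx, ← hA, ← hB] at h1
  have h2 : fderiv ℝ (transition c' c') (transition c c' y) =
      ContinuousLinearMap.id ℝ (Fin n → ℂ) := by
    rw [← fderiv_id (𝕜 := ℝ) (x := transition c c' y)]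
    refine Filter.EventuallyEq.fderiv_eq ?_
    filter_upwards [(chartAt (Fin n → ℂ) c').open_target.mem_nhds hy'] with y' hy''
    exact (chartAt (Fin n → ℂ) c').right_inv hy''
  rw [h2] at h1
  refine det_cmatrix_ne_zero (A' := B) ?_
  ext1 v
  exact congrArg (fun D : (Fin n → ℂ) →L[ℝ] (Fin n → ℂ) => D v) h1

/-- Tangent vectors at x are read through the preferred chart at x, so the manifold derivative of
the inverse chart at c is the derivative of the transition map to that preferred chart. -/
lemma inChart_eq {c : X} {y : Fin n → ℂ} (hy : y ∈ (chartAt (Fin n → ℂ) c).target)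
    (u : Form n X) : inChart c u y =
      pullback (fderiv ℝ (transition c ((chartAt (Fin n → ℂ) c).symm y)) y)
        (u ((chartAt (Fin n → ℂ) c).symm y)) := by
  have hd := differentiableAt_transition hy (mem_chart_source (Fin n → ℂ)
    ((chartAt (Fin n → ℂ) c).symm y))
  have hm : HasMFDerivAt 𝓘(ℝ, Fin n → ℂ) 𝓘(ℝ, Fin n → ℂ) (chartAt (Fin n → ℂ) c).symm y
      (fderiv ℝ (transition c ((chartAt (Fin n → ℂ) c).symm y)) y) := by
    refine ⟨(chartAt (Fin n → ℂ) c).continuousAt_symm hy, ?_⟩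
    have := hd.hasFDerivAt.hasFDerivWithinAt (s := Set.univ)
    simp only [writtenInExtChartAt, mfld_simps, chartAt_self_eq]
    exact this
  change pullback (mfderiv 𝓘(ℝ, Fin n → ℂ) 𝓘(ℝ, Fin n → ℂ) (chartAt (Fin n → ℂ) c).symm y)
    (u ((chartAt (Fin n → ℂ) c).symm y)) = _
  rw [hm.mfderiv]
  rfl

lemma inChart_transition {c c' : X} {y : Fin n → ℂ} (hy : y ∈ (chartAt (Fin n → ℂ) c).target)
    (hx : (chartAt (Fin n → ℂ) c).symm y ∈ (chartAt (Fin n → ℂ) c').source) (u : Form n X) :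
    inChart c u y = pullback (fderiv ℝ (transition c c') y) (inChart c' u (transition c c' y)) := by
  rw [inChart_eq (transition_mem hy hx), pullback_pullback, transition_symm hy hx,
    fderiv_transition_comp hy hx _ (mem_chart_source _ _), inChart_eq hy]

lemma inChart_self (x : X) (u : Form n X) : inChart x u (chartAt (Fin n → ℂ) x x) = u x := by
  have hy := mem_chart_target (Fin n → ℂ) x
  rw [inChart_eq hy, (chartAt (Fin n → ℂ) x).left_inv (mem_chart_source _ _)]
  have h2 : fderiv ℝ (transition x x) (chartAt (Fin n → ℂ) x x) =
      ContinuousLinearMap.id ℝ (Fin n → ℂ) := by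
    rw [← fderiv_id (𝕜 := ℝ) (x := chartAt (Fin n → ℂ) x x)]
    refine Filter.EventuallyEq.fderiv_eq ?_
    filter_upwards [(chartAt (Fin n → ℂ) x).open_target.mem_nhds hy] with y' hy''
    exact (chartAt (Fin n → ℂ) x).right_inv hy''
  rw [h2, pullback_id]

/-- A form in a chart is the pullback of its value under an invertible complex-linear map. -/
lemma exists_inChart_eq {c : X} {y : Fin n → ℂ} (hy : y ∈ (chartAt (Fin n → ℂ) c).target) :
    ∃ A : (Fin n → ℂ) →L[ℂ] (Fin n → ℂ), (cmatrix A).det ≠ 0 ∧ ∀ u : Form n X,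
      inChart c u y = pullback (A.restrictScalars ℝ) (u ((chartAt (Fin n → ℂ) c).symm y)) := by
  obtain ⟨A, hA, hd⟩ := isComplexLinear_transition hy
    (mem_chart_source (Fin n → ℂ) ((chartAt (Fin n → ℂ) c).symm y))
  exact ⟨A, hd, fun u => by rw [inChart_eq hy, hA]⟩

/-! ### Smoothness of the operators -/

lemma IsSmooth.add {u v : Form n X} (hu : IsSmooth u) (hv : IsSmooth v) : IsSmooth (u + v) := by
  rw [isSmooth_iff] at *
  intro c
  exact ((hu c).add (hv c)).congr fun y _ => inChart_add c u v y

lemma IsSmooth.neg {u : Form n X} (hu : IsSmooth u) : IsSmooth (-u) := by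
  rw [isSmooth_iff] at *
  intro c
  exact (hu c).neg.congr fun y _ => inChart_neg c u y

lemma IsSmooth.sub {u v : Form n X} (hu : IsSmooth u) (hv : IsSmooth v) : IsSmooth (u - v) := by
  rw [isSmooth_iff] at *
  intro c
  exact ((hu c).sub (hv c)).congr fun y _ => inChart_sub c u v y

lemma IsSmooth.mul {u v : Form n X} (hu : IsSmooth u) (hv : IsSmooth v) :
    IsSmooth (fun x => u x * v x) := by
  rw [isSmooth_iff] at *
  intro c
  exact (contDiffOn_mul (hu c) (hv c)).congr fun y _ => inChart_mul c u v y

/-- A linear operator on forms that commutes with complex-linear pullbacks. -/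
def IsNaturalOp (φ : Ext n →ₗ[ℂ] Ext n) : Prop :=
  ∀ (A : (Fin n → ℂ) →L[ℂ] (Fin n → ℂ)) (x : Ext n), (cmatrix A).det ≠ 0 →
    pullback (A.restrictScalars ℝ) (φ x) = φ (pullback (A.restrictScalars ℝ) x)

lemma IsNaturalOp.inChart {φ : Ext n →ₗ[ℂ] Ext n} (hφ : IsNaturalOp φ) {c : X} {y : Fin n → ℂ}
    (hy : y ∈ (chartAt (Fin n → ℂ) c).target) (u : Form n X) :
    inChart c (fun x => φ (u x)) y = φ (MinkowskiKahler.inChart c u y) := by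
  obtain ⟨A, hA, h⟩ := exists_inChart_eq hy
  rw [h, h, hφ A _ hA]

lemma IsNaturalOp.isSmooth {φ : Ext n →ₗ[ℂ] Ext n} (hφ : IsNaturalOp φ) {u : Form n X}
    (hu : IsSmooth u) : IsSmooth (fun x => φ (u x)) := by
  rw [isSmooth_iff] at *
  intro c
  exact (contDiffOn_linear φ (hu c)).congr fun y hy => hφ.inChart hy u

lemma isNaturalOp_involution : IsNaturalOp (n := n) involution.toLinearMap :=
  fun A x _ => pullback_involution _ x

lemma isNaturalOp_antiInv : IsNaturalOp (n := n) antiInv :=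
  fun A x _ => pullback_antiInv _ x

lemma isNaturalOp_smul (a : ℂ) : IsNaturalOp (n := n) (LinearMap.lsmul ℂ (Ext n) a) :=
  fun A x _ => map_smul _ _ _

lemma isNaturalOp_numDeg : IsNaturalOp (n := n) numDeg := by
  intro A x hA
  induction x using form_induction_wedge with
  | one => rw [numDeg_one, map_one, numDeg_one, map_zero]
  | add x y hx hy => simp only [map_add, hx, hy]
  | smul c x hx => simp only [map_smul, hx]
  | hw α x hx =>
    rw [numDeg_wedge, map_add, pullback_wedge, pullback_wedge, hx, ← numDeg_wedge]

section Star

variable {η : Form n X} (hη : IsSmooth η) (h0 : ∀ x, IsNondegOneOne (η x))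
include h0

lemma isNondegOneOne_inChart {c : X} {y : Fin n → ℂ}
    (hy : y ∈ (chartAt (Fin n → ℂ) c).target) : IsNondegOneOne (inChart c η y) := by
  obtain ⟨A, hA, h⟩ := exists_inChart_eq hy
  rw [h]
  exact (h0 _).pullback hA

lemma inChart_lam {c : X} {y : Fin n → ℂ} (hy : y ∈ (chartAt (Fin n → ℂ) c).target)
    (u : Form n X) :
    inChart c (fun x => lam (η x) (u x)) y = lam (inChart c η y) (inChart c u y) := by
  obtain ⟨A, hA, h⟩ := exists_inChart_eq hy
  rw [h, h, h, pullback_lam hA (h0 _)]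

lemma inChart_starOp {c : X} {y : Fin n → ℂ} (hy : y ∈ (chartAt (Fin n → ℂ) c).target)
    (u : Form n X) :
    inChart c (fun x => starOp (η x) (u x)) y = starOp (inChart c η y) (inChart c u y) := by
  obtain ⟨A, hA, h⟩ := exists_inChart_eq hy
  rw [h, h, h, pullback_starOp hA (h0 _)]

lemma inChart_hodge {c : X} {y : Fin n → ℂ} (hy : y ∈ (chartAt (Fin n → ℂ) c).target)
    (u : Form n X) :
    inChart c (fun x => hodge (η x) (u x)) y = hodge (inChart c η y) (inChart c u y) := by
  obtain ⟨A, hA, h⟩ := exists_inChart_eq hy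
  rw [h, h, h, pullback_hodge hA (h0 _)]

lemma inChart_hodgeInv {c : X} {y : Fin n → ℂ} (hy : y ∈ (chartAt (Fin n → ℂ) c).target)
    (u : Form n X) :
    inChart c (fun x => hodgeInv (η x) (u x)) y = hodgeInv (inChart c η y) (inChart c u y) := by
  obtain ⟨A, hA, h⟩ := exists_inChart_eq hy
  rw [h, h, h, pullback_hodgeInv hA (h0 _)]

include hη
variable {u : Form n X} (hu : IsSmooth u)
include hu

lemma IsSmooth.lam : IsSmooth (fun x => lam (η x) (u x)) := by
  rw [isSmooth_iff] at *
  intro c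
  exact (contDiffOn_lam (hη c) (hu c) fun y hy => (isNondegOneOne_inChart h0 hy).det_ne_zero).congr
    fun y hy => inChart_lam h0 hy u

lemma IsSmooth.starOp : IsSmooth (fun x => starOp (η x) (u x)) := by
  rw [isSmooth_iff] at *
  intro c
  exact (contDiffOn_starOp (hη c) (fun y hy => isNondegOneOne_inChart h0 hy) (hu c)).congr
    fun y hy => inChart_starOp h0 hy u

lemma IsSmooth.hodge : IsSmooth (fun x => hodge (η x) (u x)) := by
  rw [isSmooth_iff] at *
  intro c
  exact (contDiffOn_hodge (hη c) (fun y hy => isNondegOneOne_inChart h0 hy) (hu c)).congr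
    fun y hy => inChart_hodge h0 hy u

lemma IsSmooth.hodgeInv : IsSmooth (fun x => hodgeInv (η x) (u x)) := by
  rw [isSmooth_iff] at *
  intro c
  exact (contDiffOn_hodgeInv (hη c) (fun y hy => isNondegOneOne_inChart h0 hy) (hu c)).congr
    fun y hy => inChart_hodgeInv h0 hy u

end Star

/-! ### The operator `∂̄` in charts -/

lemma contDiffOn_localDbar {f : (Fin n → ℂ) → Ext n} {s : Set (Fin n → ℂ)} (hs : IsOpen s)
    (hf : ContDiffOn ℝ ∞ f s) : ContDiffOn ℝ ∞ (localDbar f) s := by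
  have h1 : ContDiffOn ℝ ∞ (fderiv ℝ f) s := hf.fderiv_of_isOpen hs (by simp)
  have h2 : ∀ v, ContDiffOn ℝ ∞ (fun y => fderiv ℝ f y v) s := fun v =>
    h1.clm_apply contDiffOn_const
  have h3 : ContDiffOn ℝ ∞ (fun y => dbarOf (fderiv ℝ f y)) s :=
    ContDiffOn.sum fun l _ => contDiffOn_linear (wedge (dzbar l)) (contDiffOn_smul contDiffOn_const
      ((h2 _).add (contDiffOn_smul contDiffOn_const (h2 _))))
  exact h3.congr fun y hy => localDbar_eq
    ((hf.contDiffAt (hs.mem_nhds hy)).differentiableAt (by simp))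

lemma IsSmooth.differentiableAt {u : Form n X} (hu : IsSmooth u) {c : X} {y : Fin n → ℂ}
    (hy : y ∈ (chartAt (Fin n → ℂ) c).target) : DifferentiableAt ℝ (inChart c u) y :=
  ((isSmooth_iff.1 hu c).contDiffAt
    ((chartAt (Fin n → ℂ) c).open_target.mem_nhds hy)).differentiableAt (by simp)

/-- `∂̄` can be computed in any chart. -/
theorem inChart_dbar {u : Form n X} (hu : IsSmooth u) {c : X} {y : Fin n → ℂ}
    (hy : y ∈ (chartAt (Fin n → ℂ) c).target) :
    inChart c (dbar u) y = localDbar (inChart c u) y := by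
  set x := (chartAt (Fin n → ℂ) c).symm y with hxdef
  have hx : x ∈ (chartAt (Fin n → ℂ) x).source := mem_chart_source _ _
  have ht : transition c x y = chartAt (Fin n → ℂ) x x := rfl
  rw [inChart_eq hy]
  change pullback (fderiv ℝ (transition c x) y) (localDbar (inChart x u) (transition c x y)) = _
  rw [← (isHoloAt_transition hy hx).localDbar_pullback
    (hu.differentiableAt (transition_mem hy hx))]
  refine localDbar_congr ?_
  filter_upwards [eventually_mem_overlap hy hx] with y' hy'
  exact (inChart_transition hy'.1 hy'.2 u).symm

lemma IsSmooth.dbar {u : Form n X} (hu : IsSmooth u) : IsSmooth (dbar u) := by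
  rw [isSmooth_iff]
  intro c
  exact (contDiffOn_localDbar (chartAt (Fin n → ℂ) c).open_target (isSmooth_iff.1 hu c)).congr
    fun y hy => inChart_dbar hu hy

lemma dbar_mul {u v : Form n X} (hu : IsSmooth u) (hv : IsSmooth v) (x : X) :
    dbar (fun x => u x * v x) x = dbar u x * v x + involution (u x) * dbar v x := by
  have hy := mem_chart_target (Fin n → ℂ) x
  have h : inChart x (fun x => u x * v x) = fun y => inChart x u y * inChart x v y :=
    funext fun y => inChart_mul x u v y
  rw [dbar, h, localDbar_mul (hu.differentiableAt hy) (hv.differentiableAt hy), inChart_self,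
    inChart_self]
  rfl

lemma dbar_add {u v : Form n X} (hu : IsSmooth u) (hv : IsSmooth v) :
    dbar (u + v) = dbar u + dbar v := by
  ext1 x
  have hy := mem_chart_target (Fin n → ℂ) x
  have h : inChart x (u + v) = fun y => inChart x u y + inChart x v y :=
    funext fun y => inChart_add x u v y
  rw [dbar, h, localDbar_add (hu.differentiableAt hy) (hv.differentiableAt hy)]
  rfl

lemma dbar_const_smul (a : ℂ) {u : Form n X} (hu : IsSmooth u) :
    dbar (a • u) = a • dbar u := by
  ext1 x
  have hy := mem_chart_target (Fin n → ℂ) x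
  have h : inChart x (a • u) = fun y => a • inChart x u y :=
    funext fun y => inChart_smul x (fun _ => a) u y
  rw [dbar, h, localDbar_const_smul a (hu.differentiableAt hy)]
  rfl

lemma localDbar_zero (y : Fin n → ℂ) : localDbar (fun _ => (0 : Ext n)) y = 0 :=
  localDbar_const 0

lemma tsupport_dbar_subset [T2Space X] (u : Form n X) : tsupport (dbar u) ⊆ tsupport u := by
  refine closure_minimal (fun x hx => ?_) (isClosed_tsupport u)
  by_contra hxu
  refine hx ?_
  have hev : ∀ᶠ y in nhds (chartAt (Fin n → ℂ) x x), inChart x u y = 0 := by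
    have h1 : Filter.Tendsto (chartAt (Fin n → ℂ) x).symm (nhds (chartAt (Fin n → ℂ) x x))
        (nhds x) := by
      have := (chartAt (Fin n → ℂ) x).continuousAt_symm (mem_chart_target (Fin n → ℂ) x)
      rwa [ContinuousAt, (chartAt (Fin n → ℂ) x).left_inv (mem_chart_source _ _)] at this
    filter_upwards [h1 ((isClosed_tsupport u).isOpen_compl.mem_nhds hxu)] with y hy
    exact inChart_eq_zero (image_eq_zero_of_notMem_tsupport hy)
  rw [dbar, localDbar_congr (g := fun _ => 0) hev, localDbar_zero]

end Charts

/-! ### The symplectic adjoint of `∂̄` as a commutator -/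

section SymplecticAdjoint

set_option linter.unusedSectionVars false

variable {X : Type*} [TopologicalSpace X] [ChartedSpace (Fin n → ℂ) X]

lemma isSmooth_zero : IsSmooth (0 : Form n X) := by
  rw [isSmooth_iff]
  intro c
  exact (contDiffOn_const (c := (0 : Ext n))).congr fun y _ => inChart_eq_zero rfl

variable [IsManifold 𝓘(ℂ, Fin n → ℂ) ω X]

/-- A natural operator has the same constant coefficients in every chart, so it passes through the
derivative D; commutation of ∂̄ with it becomes an identity for wedges. -/
lemma dbar_linear {φ : Ext n →ₗ[ℂ] Ext n} (hφ : IsNaturalOp φ) {u : Form n X} (hu : IsSmooth u)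
    (x : X) : ∃ D : (Fin n → ℂ) →L[ℝ] Ext n, dbar u x = dbarOf D ∧
      dbar (fun x => φ (u x)) x = dbarOf ((realCLM φ).comp D) := by
  have hy := mem_chart_target (Fin n → ℂ) x
  have hd := hu.differentiableAt hy
  refine ⟨fderiv ℝ (inChart x u) (chartAt (Fin n → ℂ) x x), localDbar_eq hd, ?_⟩
  have h : inChart x (fun x => φ (u x)) =ᶠ[nhds (chartAt (Fin n → ℂ) x x)]
      fun y => φ (inChart x u y) := by
    filter_upwards [(chartAt (Fin n → ℂ) x).open_target.mem_nhds hy] with y hy'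
    exact hφ.inChart hy' u
  rw [dbar, localDbar_congr h, localDbar_eq (differentiableAt_linear φ hd)]
  congr 1
  ext1 v
  exact fderiv_linear φ hd v

lemma numDeg_dbar {u : Form n X} (hu : IsSmooth u) (x : X) :
    numDeg (dbar u x) = dbar u x + dbar (fun x => numDeg (u x)) x := by
  obtain ⟨D, h1, h2⟩ := dbar_linear isNaturalOp_numDeg hu x
  rw [h1, h2]
  simp only [dbarOf, map_sum, numDeg_wedge, ← Finset.sum_add_distrib, map_smul, map_add,
    ContinuousLinearMap.comp_apply, realCLM_apply]
  refine Finset.sum_congr rfl fun l _ => ?_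
  simp only [smul_add]
  abel

lemma antiInv_dbar {u : Form n X} (hu : IsSmooth u) (x : X) :
    antiInv (dbar u x) = -dbar (fun x => antiInv (involution (u x))) x := by
  have hφ : IsNaturalOp (n := n) (antiInv ∘ₗ involution.toLinearMap) := fun A x hA => by
    simp only [LinearMap.comp_apply, AlgHom.toLinearMap_apply, pullback_antiInv,
      pullback_involution]
  obtain ⟨D, h1, h2⟩ := dbar_linear hφ hu x
  have h3 : (fun x => antiInv (involution (u x))) =
    fun x => (antiInv ∘ₗ involution.toLinearMap) (u x) := rfl
  rw [h3, h1, h2]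
  simp only [dbarOf, map_sum, antiInv_wedge, map_smul, map_add,
    ContinuousLinearMap.comp_apply, realCLM_apply, LinearMap.comp_apply,
    AlgHom.toLinearMap_apply, antiInv_involution, smul_neg, ← neg_add, Finset.sum_neg_distrib]

/-- The smooth forms. -/
def smoothForms (n : ℕ) (X : Type*) [TopologicalSpace X] [ChartedSpace (Fin n → ℂ) X]
    [IsManifold 𝓘(ℂ, Fin n → ℂ) ω X] : Submodule ℂ (X → Ext n) where
  carrier := {u | IsSmooth u}
  zero_mem' := isSmooth_zero
  add_mem' hu hv := hu.add hv
  smul_mem' a _ hu := (isNaturalOp_smul a).isSmooth hu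

/-- Exponentials of nilpotent elements need rational scalars; letting these act through ℂ makes them
comparable with the pointwise exponentials. -/
instance : Module ℚ (Module.End ℂ (smoothForms n X)) := Module.compHom _ (algebraMap ℚ ℂ)

instance : SMul ℚ (Module.End ℂ (smoothForms n X)) :=
  (inferInstance : Module ℚ (Module.End ℂ (smoothForms n X))).toSMul

/-- An operator on smooth forms that acts pointwise. -/
def pointwiseOp (φ : X → Module.End ℂ (Ext n))
    (h : ∀ u : Form n X, IsSmooth u → IsSmooth fun x => φ x (u x)) :
    Module.End ℂ (smoothForms n X) where
  toFun u := ⟨fun x => φ x (u.1 x), h u.1 u.2⟩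
  map_add' u v := Subtype.ext (funext fun x => map_add (φ x) _ _)
  map_smul' a u := Subtype.ext (funext fun x => map_smul (φ x) _ _)

/-- The operator `∂̄` on smooth forms. -/
def dbarOp : Module.End ℂ (smoothForms n X) where
  toFun u := ⟨dbar u.1, IsSmooth.dbar u.2⟩
  map_add' u v := Subtype.ext (dbar_add u.2 v.2)
  map_smul' a u := Subtype.ext (dbar_const_smul a u.2)

lemma pointwiseOp_pow (φ : X → Module.End ℂ (Ext n))
    (h : ∀ u : Form n X, IsSmooth u → IsSmooth fun x => φ x (u x)) (k : ℕ)
    (u : smoothForms n X) (x : X) :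
    ((pointwiseOp φ h ^ k) u).1 x = (φ x ^ k) (u.1 x) := by
  induction k generalizing u with
  | zero => rfl
  | succ k ih =>
    rw [pow_succ', pow_succ', Module.End.mul_apply, Module.End.mul_apply, ← ih]
    rfl

lemma pointwiseOp_pow_eq_zero {φ : X → Module.End ℂ (Ext n)}
    {h : ∀ u : Form n X, IsSmooth u → IsSmooth fun x => φ x (u x)} {N : ℕ}
    (hN : ∀ x, φ x ^ N = 0) : pointwiseOp φ h ^ N = 0 :=
  LinearMap.ext fun u => Subtype.ext (funext fun x => by
    rw [pointwiseOp_pow, hN]; rfl)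

lemma pointwiseOp_exp {φ : X → Module.End ℂ (Ext n)}
    {h : ∀ u : Form n X, IsSmooth u → IsSmooth fun x => φ x (u x)} {N : ℕ}
    (hN : ∀ x, φ x ^ N = 0) (u : smoothForms n X) (x : X) :
    (IsNilpotent.exp (pointwiseOp φ h) u).1 x = IsNilpotent.exp (φ x) (u.1 x) := by
  rw [IsNilpotent.exp_eq_sum (pointwiseOp_pow_eq_zero (h := h) hN),
    IsNilpotent.exp_eq_sum (hN x), LinearMap.sum_apply, LinearMap.sum_apply,
    Submodule.coe_sum, Finset.sum_apply]
  refine Finset.sum_congr rfl fun k _ => ?_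
  have h1 : ∀ (q : ℚ) (T : Module.End ℂ (smoothForms n X)),
      (q • T : Module.End ℂ (smoothForms n X)) = (q : ℂ) • T := fun q T => rfl
  rw [h1, ← Rat.cast_smul_eq_qsmul ℂ (_ : ℚ) (φ x ^ k), LinearMap.smul_apply, LinearMap.smul_apply,
    ← pointwiseOp_pow φ h k u x]
  rfl

/-! ### The Lefschetz sl₂ on smooth forms, with ∂̄ as a vector of weight one. -/

section Symplectic

variable {om : Form n X} (hs : IsSmooth om) (h0 : ∀ x, IsNondegOneOne (om x))

/-- The Lefschetz operator on smooth forms. -/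
def lefOp (hs : IsSmooth om) : Module.End ℂ (smoothForms n X) :=
  pointwiseOp (fun x => lef (om x)) fun _ hu => hs.mul hu

/-- The dual Lefschetz operator on smooth forms. -/
def lamOp (hs : IsSmooth om) (h0 : ∀ x, IsNondegOneOne (om x)) :
    Module.End ℂ (smoothForms n X) :=
  pointwiseOp (fun x => lam (om x)) fun _ hu => IsSmooth.lam hs h0 hu

/-- The centered degree operator on smooth forms. -/
def degOp : Module.End ℂ (smoothForms n X) :=
  pointwiseOp (fun _ => weightOp) fun _ hu =>
    (isNaturalOp_numDeg.isSmooth hu).sub ((isNaturalOp_smul (n : ℂ)).isSmooth hu)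

lemma lefOp_mul_lamOp_sub :
    lefOp hs * lamOp hs h0 - lamOp hs h0 * lefOp hs = degOp :=
  LinearMap.ext fun u => Subtype.ext (funext fun x =>
    LinearMap.congr_fun (lef_mul_lam_sub (h0 x)) (u.1 x))

lemma degOp_mul_lamOp_sub :
    degOp * lamOp hs h0 - lamOp hs h0 * degOp = -(2 : ℂ) • lamOp hs h0 :=
  LinearMap.ext fun u => Subtype.ext (funext fun x =>
    LinearMap.congr_fun (weightOp_mul_lam_sub (om x)) (u.1 x))

lemma isNilpotent_lefOp (h0 : ∀ x, IsNondegOneOne (om x)) : IsNilpotent (lefOp hs) :=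
  ⟨n + 1, pointwiseOp_pow_eq_zero fun x => lef_pow_eq_zero (h0 x)⟩

lemma isNilpotent_lamOp : IsNilpotent (lamOp hs h0) :=
  ⟨n + 1, pointwiseOp_pow_eq_zero fun x => lam_pow_eq_zero (om x)⟩

lemma degOp_mul_dbarOp_sub :
    degOp * dbarOp - dbarOp * degOp = (dbarOp : Module.End ℂ (smoothForms n X)) := by
  refine LinearMap.ext fun u => Subtype.ext (funext fun x => ?_)
  have hu : IsSmooth u.1 := u.2
  have h1 := dbar_add (isNaturalOp_numDeg.isSmooth hu)
    ((isNaturalOp_smul (n : ℂ)).isSmooth hu).neg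
  have h2 : (degOp u).1 = (fun x => numDeg (u.1 x)) +
      -(fun x => LinearMap.lsmul ℂ (Ext n) (n : ℂ) (u.1 x)) := by
    ext1 x
    exact sub_eq_add_neg _ _
  have h3 : -(fun x => LinearMap.lsmul ℂ (Ext n) (n : ℂ) (u.1 x)) = (-(n : ℂ)) • u.1 := by
    ext1 x
    exact (neg_smul _ _).symm
  change weightOp (dbar u.1 x) - dbar (degOp u).1 x = dbar u.1 x
  rw [h2, h1, h3, dbar_const_smul _ hu, weightOp_apply, numDeg_dbar hu]
  simp only [Pi.add_apply, Pi.smul_apply, Pi.neg_apply, neg_smul]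
  abel

lemma weylElement_apply (u : smoothForms n X) (x : X) :
    (weylElement (lefOp hs) (lamOp hs h0) u).1 x = weyl (om x) (u.1 x) := by
  have hL := fun v x => pointwiseOp_exp (h := fun u hu => hs.mul hu)
    (fun x => lef_pow_eq_zero (h0 x)) v x
  have hneg : -lamOp hs h0 = pointwiseOp (fun x => -lam (om x))
      (fun u hu => (IsSmooth.lam hs h0 hu).neg) := rfl
  have hΛ := fun v x => pointwiseOp_exp (h := fun u hu => (IsSmooth.lam hs h0 hu).neg)
    (fun x => neg_pow_eq_zero (lam_pow_eq_zero (om x))) v x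
  rw [weylElement, weyl, weylElement, Module.End.mul_apply, Module.End.mul_apply,
    Module.End.mul_apply, Module.End.mul_apply, hneg, ← hL, ← hΛ, ← hL]
  rfl

lemma numZ_delOf {D : (Fin n → ℂ) →L[ℝ] Ext n} (h : ∀ v, numZ (D v) = D v) :
    numZ (delOf D) = (2 : ℂ) • delOf D := by
  simp only [delOf, map_sum, numZ_wedge_dz, map_smul, map_sub, h, two_smul,
    ← Finset.sum_add_distrib]
  refine Finset.sum_congr rfl fun l _ => ?_
  simp only [smul_add, smul_sub]
  abel

lemma numZ_dbarOf {D : (Fin n → ℂ) →L[ℝ] Ext n} (h : ∀ v, numZ (D v) = D v) :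
    numZ (dbarOf D) = dbarOf D := by
  simp only [dbarOf, map_sum, numZ_wedge_dzbar, map_smul, map_add, h]

-- ∂ω has holomorphic degree 2 and ∂̄ω has holomorphic degree 1. Applying the holomorphic degree
-- operator to ∂ω + ∂̄ω = 0 gives 2∂ω + ∂̄ω = 0, so both vanish.
include hs h0 in
lemma dbar_eq_zero_of_extD (hd : extD om = 0) : dbar om = 0 := by
  ext1 x
  have hy := mem_chart_target (Fin n → ℂ) x
  have hdf := hs.differentiableAt hy
  have h1 : (localDel (inChart x om) (chartAt (Fin n → ℂ) x x) +
    localDbar (inChart x om) (chartAt (Fin n → ℂ) x x) : Ext n) = 0 := congrFun hd x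
  have h2 : dbar om x = localDbar (inChart x om) (chartAt (Fin n → ℂ) x x) := rfl
  rw [h2]
  rw [localDel_eq hdf, localDbar_eq hdf] at *
  set D := fderiv ℝ (inChart x om) (chartAt (Fin n → ℂ) x x) with hD
  have h3 : ∀ v, numZ (D v) = D v := by
    intro v
    rw [hD, ← fderiv_linear numZ hdf]
    refine congrArg (fun D : (Fin n → ℂ) →L[ℝ] Ext n => D v) (Filter.EventuallyEq.fderiv_eq ?_)
    filter_upwards [(chartAt (Fin n → ℂ) x).open_target.mem_nhds hy] with y hy'
    have hm : inChart x om y ∈ typeSub n 1 1 :=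
      form_mem_typeSub (isNondegOneOne_inChart h0 hy')
    rw [numZ_of_mem hm]
    simp
  have h4 := congrArg numZ h1
  rw [map_add, map_zero, numZ_delOf h3, numZ_dbarOf h3, two_smul, add_assoc, h1, add_zero] at h4
  rwa [h4, zero_add] at h1

variable (hd : dbar om = 0)
include hs hd h0

/-- The Leibniz rule with ∂̄ω = 0 and ω of even degree. Together with `degOp_mul_dbarOp_sub` it
makes ∂̄ a highest weight vector of weight one. -/
lemma lefOp_mul_dbarOp : lefOp hs * dbarOp = dbarOp * lefOp hs := by
  refine LinearMap.ext fun u => Subtype.ext (funext fun x => ?_)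
  change om x * dbar u.1 x = dbar (fun x => om x * u.1 x) x
  rw [dbar_mul hs u.2, hd, involution_of_mem (form_mem_typeSub (h0 x))]
  simp

/-- `[Λ, [Λ, ∂̄]] = 0`. -/
lemma lamOp_commute : lamOp hs h0 * (lamOp hs h0 * dbarOp - dbarOp * lamOp hs h0) =
    (lamOp hs h0 * dbarOp - dbarOp * lamOp hs h0) * lamOp hs h0 :=
  sub_eq_zero.1 (lie_lie_eq_zero_of_weight_one (L := lefOp hs) (H := degOp)
    (lefOp_mul_lamOp_sub hs h0) (degOp_mul_lamOp_sub hs h0) (isNilpotent_lamOp hs h0)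
    (sub_eq_zero.2 (lefOp_mul_dbarOp hs h0 hd)) degOp_mul_dbarOp_sub)

/-- The star is W after `antiInv`, and the sign (−1)^{k+1} in ∂̄^Λ is just what `antiInv` produces
when it passes ∂̄. So ∂̄^Λ = W ∂̄ W⁻¹, which the two-dimensional representation spanned by ∂̄
evaluates to −[Λ, ∂̄]. -/
theorem dbarLam_eq {u : Form n X} (hu : IsSmooth u) (x : X) :
    dbarLam om u x = dbar (fun x => lam (om x) (u x)) x - lam (om x) (dbar u x) := by
  have hS : ∀ x, symplStar (om x) = starOp (om x) := fun x => (h0 x).symplStar_eq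
  -- This is W⁻¹u: applying W gives the star of the star of u, which is u.
  let w : smoothForms n X := ⟨fun x => antiInv (starOp (om x) (u x)),
    isNaturalOp_antiInv.isSmooth (IsSmooth.starOp hs h0 hu)⟩
  have hw : weylElement (lefOp hs) (lamOp hs h0) w = ⟨u, hu⟩ :=
    Subtype.ext (funext fun x => by
      rw [weylElement_apply]
      exact starOp_starOp (h0 x) (u x))
  have h1 := (weylElement_mul_of_weight_one (R := Module.End ℂ (smoothForms n X)) (lefOp_mul_lamOp_sub hs h0)
    (degOp_mul_lamOp_sub hs h0) (isNilpotent_lefOp hs h0) (isNilpotent_lamOp hs h0)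
    (lefOp_mul_dbarOp hs h0 hd) degOp_mul_dbarOp_sub).1
  have h2 := congrArg (fun v : smoothForms n X => v.1 x) (LinearMap.congr_fun h1 w)
  simp only [Module.End.mul_apply, weylElement_apply] at h2
  rw [LinearMap.neg_apply, LinearMap.sub_apply, Module.End.mul_apply, Module.End.mul_apply, hw] at h2
  have hsm : IsSmooth (fun x => starOp (om x) (involution (u x))) :=
    IsSmooth.starOp hs h0 (isNaturalOp_involution.isSmooth hu)
  have h3 : dbarLam om u x = weyl (om x) (dbar w.1 x) := by
    have h4 : dbarLam om u x =
        -starOp (om x) (dbar (fun x => starOp (om x) (involution (u x))) x) := by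
      have h5 : ∀ v : Form n X, starS om v = fun x => starOp (om x) (v x) := fun v =>
        funext fun x => by rw [starS, hS]
      rw [dbarLam, h5, h5]
      rfl
    have h6 : (fun x => antiInv (involution (starOp (om x) (involution (u x))))) = w.1 :=
      funext fun x => by rw [involution_starOp (h0 x), involution_involution]
    rw [h4, starOp_apply, antiInv_dbar hsm, map_neg, neg_neg, h6]
  rw [h3]
  refine h2.trans ?_
  change -(lam (om x) (dbar u x) - dbar (fun x => lam (om x) (u x)) x) = _
  rw [neg_sub]

/-- `∂̄^Λ` commutes with `Λ`. -/
theorem lam_dbarLam {u : Form n X} (hu : IsSmooth u) (x : X) :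
    lam (om x) (dbarLam om u x) = dbarLam om (fun x => lam (om x) (u x)) x := by
  have h1 := congrArg (fun v : smoothForms n X => v.1 x)
    (LinearMap.congr_fun (lamOp_commute hs h0 hd) ⟨u, hu⟩)
  rw [dbarLam_eq hs h0 hd hu, dbarLam_eq hs h0 hd (IsSmooth.lam hs h0 hu)]
  have h2 : lam (om x) (lam (om x) (dbar u x) - dbar (fun x => lam (om x) (u x)) x) =
    lam (om x) (dbar (fun x => lam (om x) (u x)) x) -
      dbar (fun x => lam (om x) (lam (om x) (u x))) x := h1
  rw [← neg_sub, map_neg, h2, neg_sub]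

-- *L = Λ* and ** = 1 identify *L* with the contraction Λ.
omit hs hd in
lemma dualLefschetz_eq (u : Form n X) :
    dualLefschetz om u = fun x => lam (om x) (u x) := by
  have hS : ∀ x, symplStar (om x) = starOp (om x) := fun x => (h0 x).symplStar_eq
  ext1 x
  simp only [dualLefschetz, starS, lefschetz, hS]
  have h := starOp_lef (h0 x) (starOp (om x) (u x))
  rwa [starOp_starOp (h0 x)] at h

end Symplectic

end SymplecticAdjoint

/-! ### Positivity of the pairing of a Hermitian metric -/

section Positivity

lemma exists_eq_conjTranspose_mul_self {ι : Type*} [Fintype ι] [DecidableEq ι]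
    {G : Matrix ι ι ℂ} (h : G.PosSemidef) : ∃ B : Matrix ι ι ℂ, G = B.conjTranspose * B := by
  open scoped MatrixOrder in
  obtain ⟨X, hX, -, h2⟩ := CFC.exists_sqrt_of_isSelfAdjoint_of_quasispectrumRestricts
    h.isHermitian (QuasispectrumRestricts.nnreal_of_nonneg h.nonneg)
  exact ⟨X, by rw [← h2]; congr 1; exact hX.star_eq.symm⟩

/-- The matrix of the `p`-th tensor power of `B`. -/
def tensorPower (B : Matrix (Fin n) (Fin n) ℂ) (p : ℕ) :
    Matrix (Fin p → Fin n) (Fin p → Fin n) ℂ := Matrix.of fun M J => ∏ a, B (M a) (J a)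

lemma tensorPower_mul (B C : Matrix (Fin n) (Fin n) ℂ) (p : ℕ) :
    tensorPower (B * C) p = tensorPower B p * tensorPower C p := by
  ext M J
  simp only [tensorPower, Matrix.of_apply, Matrix.mul_apply, Fintype.prod_sum,
    Finset.prod_mul_distrib]

lemma tensorPower_conjTranspose (B : Matrix (Fin n) (Fin n) ℂ) (p : ℕ) :
    tensorPower B.conjTranspose p = (tensorPower B p).conjTranspose := by
  ext M J
  simp [tensorPower, Matrix.conjTranspose_apply]

/-- The components of type `(p, q)` of a form, as a matrix. -/
def componentMatrix (φ : Ext n) (p q : ℕ) : Matrix (Fin p → Fin n) (Fin q → Fin n) ℂ :=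
  Matrix.of fun J K => component φ J K

/-- A factorization B*B of the inverse matrix turns the block of type (p, q) into the
Hilbert–Schmidt product of the component matrices, transformed by tensor powers of B. -/
lemma pairing_eq_sum_trace {η : Ext n} {B : Matrix (Fin n) (Fin n) ℂ}
    (hB : (matrixOf η)⁻¹ = B.conjTranspose * B) (φ ψ : Ext n) :
    pairing η φ ψ = ∑ p ∈ Finset.range (n + 1), ∑ q ∈ Finset.range (n + 1),
      (p.factorial * q.factorial : ℂ)⁻¹ *
        ((tensorPower B p * componentMatrix φ p q * (tensorPower B q).conjTranspose) *
          (tensorPower B p * componentMatrix ψ p q *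
            (tensorPower B q).conjTranspose).conjTranspose).trace := by
  refine Finset.sum_congr rfl fun p _ => Finset.sum_congr rfl fun q _ => ?_
  congr 1
  have h : ((tensorPower B p * componentMatrix φ p q * (tensorPower B q).conjTranspose) *
      (tensorPower B p * componentMatrix ψ p q *
        (tensorPower B q).conjTranspose).conjTranspose).trace =
      (tensorPower (matrixOf η)⁻¹ p * componentMatrix φ p q * tensorPower (matrixOf η)⁻¹ q *
        (componentMatrix ψ p q).conjTranspose).trace := by
    rw [hB, tensorPower_mul, tensorPower_mul, tensorPower_conjTranspose,
      tensorPower_conjTranspose, Matrix.conjTranspose_mul, Matrix.conjTranspose_mul,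
      Matrix.conjTranspose_conjTranspose]
    simp only [← Matrix.mul_assoc]
    rw [Matrix.trace_mul_comm]
    simp only [← Matrix.mul_assoc]
  rw [h]
  simp only [Matrix.trace, Matrix.diag_apply, Matrix.mul_apply, Finset.sum_mul]
  rw [Finset.sum_comm]
  refine Finset.sum_congr rfl fun R _ => ?_
  rw [Finset.sum_comm' (t' := Finset.univ) (s' := fun _ => Finset.univ) (by simp)]
  conv_rhs => rw [Finset.sum_comm]
  refine Finset.sum_congr rfl fun K _ => ?_
  rw [Finset.sum_comm]
  refine Finset.sum_congr rfl fun S _ => Finset.sum_congr rfl fun J _ => ?_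
  simp only [tensorPower, componentMatrix, Matrix.of_apply, Matrix.conjTranspose_apply,
    RCLike.star_def]
  ring

/-- Every block is a nonnegative squared norm, so all transformed component matrices of w vanish.
Then w pairs to zero with every form, and nondegeneracy finishes without inverting B. -/
theorem eq_zero_of_pairing_self {g : Ext n} (hg : (matrixOf g).PosDef) {w : Ext n}
    (h : pairing g w w = 0) : w = 0 := by
  obtain ⟨B, hB⟩ := exists_eq_conjTranspose_mul_self hg.inv.posSemidef
  refine eq_zero_of_pairing (η := g) hg.det_pos.ne' fun φ => ?_
  rw [pairing_eq_sum_trace hB] at h ⊢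
  have hpos : ∀ p q : ℕ, (0 : ℂ) < (p.factorial * q.factorial : ℂ)⁻¹ := fun p q => by
    have : (0 : ℝ) < ((p.factorial : ℝ) * q.factorial)⁻¹ := by positivity
    rw [show (p.factorial * q.factorial : ℂ)⁻¹ =
      ((((p.factorial : ℝ) * q.factorial)⁻¹ : ℝ) : ℂ) by push_cast; rfl]
    exact Complex.zero_lt_real.2 this
  have hnn : ∀ p q : ℕ, 0 ≤ (p.factorial * q.factorial : ℂ)⁻¹ *
      ((tensorPower B p * componentMatrix w p q * (tensorPower B q).conjTranspose) *
        (tensorPower B p * componentMatrix w p q *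
          (tensorPower B q).conjTranspose).conjTranspose).trace := fun p q =>
    mul_nonneg (hpos p q).le (Matrix.posSemidef_self_mul_conjTranspose _).trace_nonneg
  refine Finset.sum_eq_zero fun p hp => Finset.sum_eq_zero fun q hq => ?_
  have h1 := (Finset.sum_eq_zero_iff_of_nonneg fun p _ => Finset.sum_nonneg fun q _ =>
    hnn p q).1 h p hp
  have h2 := (Finset.sum_eq_zero_iff_of_nonneg fun q _ => hnn p q).1 h1 q hq
  have h3 := (mul_eq_zero.1 h2).resolve_left (hpos p q).ne'
  rw [Matrix.trace_mul_conjTranspose_self_eq_zero_iff] at h3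
  rw [h3]
  simp

end Positivity

/-! ### Integration of forms -/

section Integration

set_option linter.unusedSectionVars false

open MeasureTheory

variable {X : Type*} [TopologicalSpace X] [ChartedSpace (Fin n → ℂ) X]

/-- Smooth complex-valued functions, in terms of coordinates. -/
def IsSmoothFun (a : X → ℂ) : Prop :=
  ∀ c : X, ContDiffOn ℝ ∞ (fun y => a ((chartAt (Fin n → ℂ) c).symm y))
    (chartAt (Fin n → ℂ) c).target

lemma IsSmoothFun.smul {a : X → ℂ} (ha : IsSmoothFun (n := n) a) {u : Form n X}
    (hu : IsSmooth u) : IsSmooth (fun x => a x • u x) := by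
  rw [isSmooth_iff] at hu ⊢
  intro c
  exact (contDiffOn_smul (ha c) (hu c)).congr fun y _ => inChart_smul c a u y

lemma tsupport_smul_form_subset (a : X → ℂ) (u : Form n X) :
    tsupport (fun x => a x • u x) ⊆ tsupport u :=
  closure_mono fun x hx h => hx (by simp [h])

lemma tsupport_smul_form_subset_left (a : X → ℂ) (u : Form n X) :
    tsupport (fun x => a x • u x) ⊆ tsupport a :=
  closure_mono fun x hx h => hx (by simp [h])

lemma topCoeff_inChart_smul (c : X) (a : X → ℂ) (u : Form n X) (y : Fin n → ℂ) :
    topCoeff (inChart c (fun x => a x • u x) y) =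
      a ((chartAt (Fin n → ℂ) c).symm y) * topCoeff (inChart c u y) := by
  have := inChart_smul c a u y
  rw [this, ← topCoeffₗ_apply, map_smul, topCoeffₗ_apply, smul_eq_mul]

lemma topCoeff_inChart_eq_zero {c : X} {u : Form n X} {y : Fin n → ℂ}
    (h : u ((chartAt (Fin n → ℂ) c).symm y) = 0) : topCoeff (inChart c u y) = 0 := by
  rw [inChart_eq_zero h, ← topCoeffₗ_apply, map_zero]

lemma isCompact_image_chart {b : X} {K : Set X} (hK : IsCompact K)
    (hb : K ⊆ (chartAt (Fin n → ℂ) b).source) : IsCompact (chartAt (Fin n → ℂ) b '' K) :=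
  hK.image_of_continuousOn ((chartAt (Fin n → ℂ) b).continuousOn.mono hb)

lemma image_chart_subset {b : X} {K : Set X} (hb : K ⊆ (chartAt (Fin n → ℂ) b).source) :
    chartAt (Fin n → ℂ) b '' K ⊆ (chartAt (Fin n → ℂ) b).target := by
  rintro _ ⟨x, hx, rfl⟩
  exact (chartAt (Fin n → ℂ) b).map_source (hb hx)

lemma mem_image_chart {b : X} {K : Set X} {y : Fin n → ℂ}
    (hy : y ∈ (chartAt (Fin n → ℂ) b).target) (h : (chartAt (Fin n → ℂ) b).symm y ∈ K) :
    y ∈ chartAt (Fin n → ℂ) b '' K :=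
  ⟨_, h, (chartAt (Fin n → ℂ) b).right_inv hy⟩

lemma measurableSet_target (c : X) : MeasurableSet (chartAt (Fin n → ℂ) c).target :=
  (chartAt (Fin n → ℂ) c).open_target.measurableSet

lemma continuousOn_topCoeff {u : Form n X} (hu : IsSmooth u) (c : X) :
    ContinuousOn (fun y => topCoeff (inChart c u y)) (chartAt (Fin n → ℂ) c).target :=
  (hu c (topCoeffₗ n)).continuousOn

lemma integrableOn_topCoeff {u : Form n X} (hu : IsSmooth u) {b : X} {K : Set X}
    (hK : IsCompact K) (hb : K ⊆ (chartAt (Fin n → ℂ) b).source) (h0 : ∀ x, x ∉ K → u x = 0) :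
    IntegrableOn (fun y => topCoeff (inChart b u y)) (chartAt (Fin n → ℂ) b).target := by
  have h1 := (continuousOn_topCoeff hu b).mono (image_chart_subset hb)
  refine (h1.integrableOn_compact (isCompact_image_chart hK hb)).of_forall_sdiff_eq_zero
    (measurableSet_target b) fun y hy => ?_
  exact topCoeff_inChart_eq_zero (h0 _ fun h => hy.2 (mem_image_chart hy.1 h))

variable [IsManifold 𝓘(ℂ, Fin n → ℂ) ω X]

lemma topCoeff_inChart_transition {c c' : X} {y : Fin n → ℂ}
    (hy : y ∈ (chartAt (Fin n → ℂ) c).target)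
    (hx : (chartAt (Fin n → ℂ) c).symm y ∈ (chartAt (Fin n → ℂ) c').source) (u : Form n X) :
    topCoeff (inChart c u y) = |(fderiv ℝ (transition c c') y).det| •
      topCoeff (inChart c' u (transition c c' y)) := by
  obtain ⟨A, hA, -⟩ := isComplexLinear_transition hy hx
  rw [inChart_transition hy hx u, topCoeff_pullback, ← hA,
    abs_of_nonneg (det_restrictScalars_nonneg A)]

/-- The integral of a form over a coordinate chart does not depend on the chart. -/
theorem integral_target_eq {b c : X} {u : Form n X}
    (hu : ∀ x, u x ≠ 0 → x ∈ (chartAt (Fin n → ℂ) b).source ∧ x ∈ (chartAt (Fin n → ℂ) c).source) :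
    ∫ y in (chartAt (Fin n → ℂ) c).target, topCoeff (inChart c u y) =
      ∫ y in (chartAt (Fin n → ℂ) b).target, topCoeff (inChart b u y) := by
  -- The overlap of the charts in the coordinates of c. Off it the integrand vanishes; between the
  -- two overlaps the transition map is a bijection, and the change of variables formula applies.
  set S : X → X → Set (Fin n → ℂ) := fun c b =>
    (chartAt (Fin n → ℂ) c).target ∩ (chartAt (Fin n → ℂ) c).symm ⁻¹'
      (chartAt (Fin n → ℂ) b).source with hS
  have hres : ∀ b c : X, (∀ x, u x ≠ 0 → x ∈ (chartAt (Fin n → ℂ) b).source) →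
      ∫ y in (chartAt (Fin n → ℂ) c).target, topCoeff (inChart c u y) =
        ∫ y in S c b, topCoeff (inChart c u y) := fun b c h => by
    refine setIntegral_eq_of_subset_of_forall_sdiff_eq_zero (measurableSet_target c)
      Set.inter_subset_left fun y hy => topCoeff_inChart_eq_zero ?_
    by_contra h1
    exact hy.2 ⟨hy.1, h _ h1⟩
  have hopen : IsOpen (S c b) :=
    (chartAt (Fin n → ℂ) c).continuousOn_symm.isOpen_inter_preimage
      (chartAt (Fin n → ℂ) c).open_target (chartAt (Fin n → ℂ) b).open_source
  have himage : transition c b '' S c b = S b c := by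
    apply Set.Subset.antisymm
    · rintro _ ⟨y, ⟨hy, hx⟩, rfl⟩
      refine ⟨transition_mem hy hx, ?_⟩
      rw [Set.mem_preimage, transition_symm hy hx]
      exact (chartAt (Fin n → ℂ) c).map_target hy
    · rintro y ⟨hy, hx⟩
      refine ⟨transition b c y, ⟨transition_mem hy hx, ?_⟩, transition_transition hy hx⟩
      rw [Set.mem_preimage, transition_symm hy hx]
      exact (chartAt (Fin n → ℂ) b).map_target hy
  have hinj : Set.InjOn (transition c b) (S c b) := by
    rintro y ⟨hy, hx⟩ y' ⟨hy', hx'⟩ h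
    rw [← transition_transition hy hx, h, transition_transition hy' hx']
  rw [hres b c fun x hx => (hu x hx).1, hres c b fun x hx => (hu x hx).2, ← himage,
    integral_image_eq_integral_abs_det_fderiv_smul volume hopen.measurableSet
      (fun y hy => (differentiableAt_transition hy.1 hy.2).hasFDerivAt.hasFDerivWithinAt) hinj]
  exact setIntegral_congr_fun hopen.measurableSet fun y hy =>
    topCoeff_inChart_transition hy.1 hy.2 u

variable [T2Space X] [SecondCountableTopology X]

lemma exists_partition : ∃ ρ : SmoothPartitionOfUnity X 𝓘(ℝ, Fin n → ℂ) X Set.univ,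
    ρ.IsSubordinate fun c => (chartAt (Fin n → ℂ) c).source := by
  have := isManifold_real (n := n) (X := X)
  have := ChartedSpace.locallyCompactSpace (Fin n → ℂ) X
  exact SmoothPartitionOfUnity.exists_isSubordinate_chartAt_source 𝓘(ℝ, Fin n → ℂ) X

/-- The partition of unity with which `integralForm` is defined. -/
def partition (n : ℕ) (X : Type*) [TopologicalSpace X] [ChartedSpace (Fin n → ℂ) X]
    [IsManifold 𝓘(ℂ, Fin n → ℂ) ω X] [T2Space X] [SecondCountableTopology X] :
    SmoothPartitionOfUnity X 𝓘(ℝ, Fin n → ℂ) X Set.univ :=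
  (exists_partition (n := n) (X := X)).choose

lemma tsupport_partition_subset (c : X) :
    tsupport (partition n X c) ⊆ (chartAt (Fin n → ℂ) c).source :=
  (exists_partition (n := n) (X := X)).choose_spec c

/-- A function of the partition of unity, as a complex-valued function. -/
def cutoff (n : ℕ) {X : Type*} [TopologicalSpace X] [ChartedSpace (Fin n → ℂ) X]
    [IsManifold 𝓘(ℂ, Fin n → ℂ) ω X] [T2Space X] [SecondCountableTopology X] (c x : X) : ℂ :=
  ((partition n X c x : ℝ) : ℂ)

lemma isSmoothFun_cutoff (c : X) : IsSmoothFun (n := n) (cutoff n c) := fun b => by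
  have := isManifold_real (n := n) (X := X)
  have h := (partition n X c).contMDiff.comp_contMDiffOn
    (contMDiffOn_chart_symm (I := 𝓘(ℝ, Fin n → ℂ)) (n := ∞) (x := b))
  exact Complex.ofRealCLM.contDiff.comp_contDiffOn (contMDiffOn_iff_contDiffOn.1 h)

lemma tsupport_cutoff_subset (c : X) : tsupport (cutoff n c) ⊆ (chartAt (Fin n → ℂ) c).source := by
  have h : Function.support (cutoff n c) ⊆ Function.support (partition n X c) :=
    fun x hx h => hx (by simp [cutoff, h])
  exact (closure_mono h).trans (tsupport_partition_subset c)

lemma integralForm_eq_finsum (u : Form n X) : integralForm u = ∑ᶠ c : X,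
    ∫ y in (chartAt (Fin n → ℂ) c).target,
      topCoeff (inChart c (fun x => cutoff n c x • u x) y) := by
  rw [integralForm, dif_pos (exists_partition (n := n) (X := X))]
  refine finsum_congr fun c => integral_congr_ae (Filter.Eventually.of_forall fun y => ?_)
  exact (topCoeff_inChart_smul c (cutoff n c) u y).symm

/-- By local finiteness only finitely many functions of the partition meet K; the sum over all
charts in the integral becomes a sum over s. -/
lemma exists_finset_cutoff {K : Set X} (hK : IsCompact K) : ∃ s : Finset X,
    (∀ c, c ∉ s → ∀ x ∈ K, cutoff n c x = 0) ∧ ∀ x ∈ K, ∑ c ∈ s, cutoff n c x = 1 := by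
  have hfin := (partition n X).locallyFinite.finite_nonempty_inter_compact hK
  have h0 : ∀ c, c ∉ hfin.toFinset → ∀ x ∈ K, partition n X c x = 0 := fun c hc x hx => by
    by_contra h
    exact hc (hfin.mem_toFinset.2 ⟨x, h, hx⟩)
  refine ⟨hfin.toFinset, fun c hc x hx => by simp [cutoff, h0 c hc x hx], fun x hx => ?_⟩
  have h1 := (partition n X).sum_eq_one (Set.mem_univ x)
  rw [finsum_eq_sum_of_support_subset (s := hfin.toFinset)] at h1
  · simp only [cutoff, ← Complex.ofReal_sum, h1, Complex.ofReal_one]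
  · intro c hc
    by_contra h
    exact hc (h0 c h x hx)

lemma integralForm_eq_sum {K : Set X} {s : Finset X}
    (hs : ∀ c, c ∉ s → ∀ x ∈ K, cutoff n c x = 0) {u : Form n X} (hu : ∀ x, x ∉ K → u x = 0) :
    integralForm u = ∑ c ∈ s, ∫ y in (chartAt (Fin n → ℂ) c).target,
      topCoeff (inChart c (fun x => cutoff n c x • u x) y) := by
  rw [integralForm_eq_finsum, finsum_eq_sum_of_support_subset]
  intro c hc
  by_contra h
  refine hc ((integral_congr_ae (Filter.Eventually.of_forall fun y => ?_)).trans
    (integral_zero _ _))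
  refine topCoeff_inChart_eq_zero ?_
  by_cases hK : (chartAt (Fin n → ℂ) c).symm y ∈ K
  · simp [hs c h _ hK]
  · simp [hu _ hK]

lemma integrableOn_cutoff {u : Form n X} (hu : IsSmooth u) (hc : HasCompactSupport u) (c : X) :
    IntegrableOn (fun y => topCoeff (inChart c (fun x => cutoff n c x • u x) y))
      (chartAt (Fin n → ℂ) c).target := by
  refine integrableOn_topCoeff ((isSmoothFun_cutoff c).smul hu)
    (K := tsupport u ∩ tsupport (cutoff n c)) (hc.isCompact.inter_right (isClosed_tsupport _))
    (Set.inter_subset_right.trans (tsupport_cutoff_subset c)) fun x hx => ?_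
  by_contra h
  have h1 : x ∈ tsupport fun x => cutoff n c x • u x := subset_closure h
  exact hx ⟨tsupport_smul_form_subset _ u h1, tsupport_smul_form_subset_left _ u h1⟩

lemma integralForm_sum {ι : Type*} (t : Finset ι) (u : ι → Form n X)
    (hu : ∀ i ∈ t, IsSmooth (u i)) {K : Set X} (hK : IsCompact K)
    (h0 : ∀ i ∈ t, ∀ x, x ∉ K → u i x = 0) :
    integralForm (fun x => ∑ i ∈ t, u i x) = ∑ i ∈ t, integralForm (u i) := by
  obtain ⟨s, hs, -⟩ := exists_finset_cutoff (n := n) hK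
  rw [integralForm_eq_sum hs fun x hx => Finset.sum_eq_zero fun i hi => h0 i hi x hx,
    Finset.sum_congr rfl fun i hi => integralForm_eq_sum hs (h0 i hi), Finset.sum_comm]
  refine Finset.sum_congr rfl fun c _ => ?_
  rw [← integral_finsetSum]
  · refine integral_congr_ae (Filter.Eventually.of_forall fun y => ?_)
    simp only [topCoeff_inChart_smul]
    rw [← Finset.mul_sum]
    congr 1
    simp only [← topCoeffₗ_apply, ← map_sum]
    congr 1
    simp only [inChart, map_sum]
  · exact fun i hi => integrableOn_cutoff (hu i hi)
      (HasCompactSupport.intro hK fun x hx => h0 i hi x hx) c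

/-- The integral of a form supported in a coordinate chart. -/
theorem integralForm_eq_integral_target {u : Form n X} (hu : IsSmooth u) (hc : HasCompactSupport u)
    {b : X} (hb : tsupport u ⊆ (chartAt (Fin n → ℂ) b).source) :
    integralForm u = ∫ y in (chartAt (Fin n → ℂ) b).target, topCoeff (inChart b u y) := by
  obtain ⟨s, hs, hs1⟩ := exists_finset_cutoff (n := n) hc.isCompact
  rw [integralForm_eq_sum hs fun x hx => image_eq_zero_of_notMem_tsupport hx]
  -- Each piece is supported in both charts, so it can be integrated in the chart at b; there the
  -- cutoffs add up to 1 on the support of u.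
  have h1 : ∀ c ∈ s, ∫ y in (chartAt (Fin n → ℂ) c).target,
      topCoeff (inChart c (fun x => cutoff n c x • u x) y) =
      ∫ y in (chartAt (Fin n → ℂ) b).target,
        topCoeff (inChart b (fun x => cutoff n c x • u x) y) := fun c _ => by
    refine integral_target_eq fun x hx => ?_
    have h1 : x ∈ tsupport fun x => cutoff n c x • u x := subset_closure hx
    exact ⟨hb (tsupport_smul_form_subset _ u h1),
      tsupport_cutoff_subset c (tsupport_smul_form_subset_left _ u h1)⟩
  rw [Finset.sum_congr rfl h1, ← integral_finsetSum]
  · refine setIntegral_congr_fun (measurableSet_target b) fun y hy => ?_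
    simp only [topCoeff_inChart_smul, ← Finset.sum_mul]
    by_cases h : (chartAt (Fin n → ℂ) b).symm y ∈ tsupport u
    · rw [hs1 _ h, one_mul]
    · rw [topCoeff_inChart_eq_zero (image_eq_zero_of_notMem_tsupport h), mul_zero]
  · refine fun c _ => integrableOn_topCoeff ((isSmoothFun_cutoff c).smul hu) hc.isCompact hb
      fun x hx => ?_
    simp [image_eq_zero_of_notMem_tsupport hx]

/-- In every chart the coefficient is the one at the point times a determinant, so components
outside top degree do not matter. -/
lemma integralForm_congr {u v : Form n X}
    (h : ∀ x, topCoeff (u x) = topCoeff (v x)) : integralForm u = integralForm v := by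
  simp only [integralForm_eq_finsum, topCoeff_inChart_smul]
  refine finsum_congr fun c => integral_congr_ae (Filter.Eventually.of_forall fun y => ?_)
  have h1 : ∀ (x : X) (A : (Fin n → ℂ) →L[ℝ] (Fin n → ℂ)),
      topCoeff (pullback A (u x)) = topCoeff (pullback A (v x)) := fun x A => by
    rw [topCoeff_pullback, topCoeff_pullback, h]
  exact congrArg _ (h1 _ _)

lemma integralForm_const_smul (a : ℂ) {u : Form n X} (hc : HasCompactSupport u) :
    integralForm (fun x => a • u x) = a * integralForm u := by
  obtain ⟨s, hs, -⟩ := exists_finset_cutoff (n := n) hc.isCompact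
  rw [integralForm_eq_sum (u := u) hs fun x hx => image_eq_zero_of_notMem_tsupport hx,
    integralForm_eq_sum (u := fun x => a • u x) hs fun x hx => by
      simp [image_eq_zero_of_notMem_tsupport hx], Finset.mul_sum]
  refine Finset.sum_congr rfl fun c _ => ?_
  rw [← integral_const_mul]
  refine integral_congr_ae (Filter.Eventually.of_forall fun y => ?_)
  have h := topCoeff_inChart_smul c (fun _ => a) u y
  simp only [topCoeff_inChart_smul c (cutoff n c)]
  rw [h]
  ring

lemma integralForm_add {u v : Form n X} (hu : IsSmooth u) (hv : IsSmooth v)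
    (hcu : HasCompactSupport u) (hcv : HasCompactSupport v) :
    integralForm (fun x => u x + v x) = integralForm u + integralForm v := by
  have h := integralForm_sum (n := n) Finset.univ ![u, v]
    (fun i _ => by fin_cases i; exacts [hu, hv])
    (hcu.isCompact.union hcv.isCompact) (fun i _ x hx => by
      rw [Set.mem_union, not_or] at hx
      fin_cases i
      exacts [image_eq_zero_of_notMem_tsupport hx.1, image_eq_zero_of_notMem_tsupport hx.2])
  simpa [Fin.sum_univ_two] using h

lemma integralForm_sub {u v : Form n X} (hu : IsSmooth u) (hv : IsSmooth v)
    (hcu : HasCompactSupport u) (hcv : HasCompactSupport v) :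
    integralForm (fun x => u x - v x) = integralForm u - integralForm v := by
  have h1 : HasCompactSupport fun x => (-1 : ℂ) • v x :=
    hcv.mono fun x hx h => hx (by simp [h])
  have h2 : IsSmooth fun x => (-1 : ℂ) • v x := by
    have := hv.neg
    convert this using 1
    ext1 x
    simp
  have h := integralForm_add hu h2 hcu h1
  rw [integralForm_const_smul _ hcv] at h
  simpa [sub_eq_add_neg] using h

end Integration

/-! ### The theorem of Stokes -/

section Stokes

set_option linter.unusedSectionVars false

open MeasureTheory

lemma integral_fderiv_apply_eq_zero {h : (Fin n → ℂ) → ℂ} (hs : ContDiff ℝ 1 h)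
    (hc : HasCompactSupport h) (v : Fin n → ℂ) : ∫ y, fderiv ℝ h y v = 0 := by
  have h1 : Integrable fun y => fderiv ℝ h y v := by
    refine Continuous.integrable_of_hasCompactSupport ?_ (hc.fderiv_apply (𝕜 := ℝ) v)
    exact (hs.continuous_fderiv (by norm_num)).clm_apply continuous_const
  -- Integration by parts against the constant function 1.
  have h2 := integral_bilinear_hasLineDerivAt_right_eq_neg_left_of_integrable
    (μ := (volume : Measure (Fin n → ℂ))) (f := fun _ => (1 : ℂ)) (f' := fun _ => 0) (g := h)
    (g' := fun y => fderiv ℝ h y v) (v := v) (B := ContinuousLinearMap.mul ℝ ℂ)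
    (by simp) (by simpa using h1)
    (by simpa using hs.continuous.integrable_of_hasCompactSupport hc)
    (fun x _ => by simpa using (hasFDerivAt_const (1 : ℂ) x).hasLineDerivAt (𝕜 := ℝ) v)
    (fun x _ => ((hs.differentiable (by norm_num)) x).hasFDerivAt.hasLineDerivAt v)
  simpa using h2

lemma contDiff_indicator {F : Type*} [NormedAddCommGroup F] [NormedSpace ℝ F]
    {f : (Fin n → ℂ) → F} {U K : Set (Fin n → ℂ)} (hU : IsOpen U) (hK : IsCompact K)
    (hKU : K ⊆ U) (hf : ContDiffOn ℝ ∞ f U) (h0 : ∀ y ∈ U, y ∉ K → f y = 0) :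
    ContDiff ℝ ∞ (U.indicator f) := by
  rw [contDiff_iff_contDiffAt]
  intro y
  by_cases hy : y ∈ U
  · refine (hf.contDiffAt (hU.mem_nhds hy)).congr_of_eventuallyEq ?_
    filter_upwards [hU.mem_nhds hy] with z hz using Set.indicator_of_mem hz f
  · refine (contDiffAt_const (c := (0 : F))).congr_of_eventuallyEq ?_
    filter_upwards [hK.isClosed.isOpen_compl.mem_nhds fun h => hy (hKU h)] with z hz
    by_cases hzU : z ∈ U
    · rw [Set.indicator_of_mem hzU, h0 z hzU hz]
    · rw [Set.indicator_of_notMem hzU]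

/-- The top coefficient of ∂̄f is a divergence: a combination, with constant coefficients, of
partial derivatives of compactly supported functions. -/
lemma integral_topCoeff_localDbar_of_compact {f : (Fin n → ℂ) → Ext n} (hf : ContDiff ℝ ∞ f)
    (hc : HasCompactSupport f) : ∫ y, topCoeff (localDbar f y) = 0 := by
  have hd : ∀ y, DifferentiableAt ℝ f y := fun y => hf.differentiable (by simp) y
  let φ : Fin n → Ext n →ₗ[ℂ] ℂ := fun l => topCoeffₗ n ∘ₗ wedge (dzbar l)
  have hs : ∀ l, ContDiff ℝ 1 fun y => φ l (f y) := fun l =>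
    ((realCLM (φ l)).contDiff.comp hf).of_le (by exact_mod_cast le_top)
  have hcl : ∀ l, HasCompactSupport fun y => φ l (f y) := fun l =>
    hc.comp_left (g := φ l) (map_zero _)
  have h1 : ∀ y, topCoeff (localDbar f y) = ∑ l, (1 / 2 : ℂ) *
      (fderiv ℝ (fun y => φ l (f y)) y (ex l) +
        Complex.I * fderiv ℝ (fun y => φ l (f y)) y (ey l)) := fun y => by
    rw [localDbar_eq (hd y), dbarOf, ← topCoeffₗ_apply, map_sum]
    refine Finset.sum_congr rfl fun l _ => ?_
    rw [fderiv_linear _ (hd y), fderiv_linear _ (hd y)]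
    simp only [map_smul, map_add, smul_eq_mul]
    rfl
  have hi : ∀ l v, Integrable fun y => fderiv ℝ (fun y => φ l (f y)) y v := fun l v =>
    Continuous.integrable_of_hasCompactSupport
      (((hs l).continuous_fderiv (by norm_num)).clm_apply continuous_const)
      ((hcl l).fderiv_apply (𝕜 := ℝ) v)
  simp only [h1]
  rw [integral_finsetSum]
  swap
  · exact fun l _ => ((hi l _).add ((hi l _).const_mul _)).const_mul _
  refine Finset.sum_eq_zero fun l _ => ?_
  rw [integral_const_mul, integral_add (hi l _) ((hi l _).const_mul _), integral_const_mul,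
    integral_fderiv_apply_eq_zero (hs l) (hcl l), integral_fderiv_apply_eq_zero (hs l) (hcl l)]
  simp

lemma integral_topCoeff_localDbar {f : (Fin n → ℂ) → Ext n} {U K : Set (Fin n → ℂ)}
    (hU : IsOpen U) (hK : IsCompact K) (hKU : K ⊆ U) (hf : ContDiffOn ℝ ∞ f U)
    (h0 : ∀ y ∈ U, y ∉ K → f y = 0) : ∫ y in U, topCoeff (localDbar f y) = 0 := by
  have hsupp : ∀ y, y ∉ K → U.indicator f y = 0 := fun y hy => by
    by_cases hyU : y ∈ U
    · rw [Set.indicator_of_mem hyU, h0 y hyU hy]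
    · rw [Set.indicator_of_notMem hyU]
  have h1 : ∫ y in U, topCoeff (localDbar f y) =
      ∫ y in U, topCoeff (localDbar (U.indicator f) y) := by
    refine setIntegral_congr_fun hU.measurableSet fun y hy => ?_
    have : f =ᶠ[nhds y] U.indicator f := by
      filter_upwards [hU.mem_nhds hy] with z hz using (Set.indicator_of_mem hz f).symm
    simp only [localDbar_congr this]
  rw [h1, setIntegral_eq_integral_of_forall_compl_eq_zero]
  · exact integral_topCoeff_localDbar_of_compact (contDiff_indicator hU hK hKU hf h0)
      (HasCompactSupport.intro hK hsupp)
  · intro y hy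
    have : U.indicator f =ᶠ[nhds y] fun _ => 0 := by
      filter_upwards [hK.isClosed.isOpen_compl.mem_nhds fun h => hy (hKU h)] with z hz
        using hsupp z hz
    rw [localDbar_congr this, localDbar_zero, ← topCoeffₗ_apply, map_zero]

variable {X : Type*} [TopologicalSpace X] [ChartedSpace (Fin n → ℂ) X]
  [IsManifold 𝓘(ℂ, Fin n → ℂ) ω X]

lemma dbar_sum {ι : Type*} (s : Finset ι) (u : ι → Form n X) (hu : ∀ i ∈ s, IsSmooth (u i))
    (x : X) : dbar (fun x => ∑ i ∈ s, u i x) x = ∑ i ∈ s, dbar (u i) x := by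
  have h : inChart x (fun x => ∑ i ∈ s, u i x) = fun y => ∑ i ∈ s, inChart x (u i) y :=
    funext fun y => by simp only [inChart, map_sum]
  rw [dbar, h, localDbar_sum s _ fun i hi =>
    (hu i hi).differentiableAt (mem_chart_target (Fin n → ℂ) x)]
  rfl

variable [T2Space X] [SecondCountableTopology X]

lemma integralForm_dbar_of_chart {u : Form n X} (hu : IsSmooth u) (hc : HasCompactSupport u)
    {b : X} (hb : tsupport u ⊆ (chartAt (Fin n → ℂ) b).source) : integralForm (dbar u) = 0 := by
  rw [integralForm_eq_integral_target hu.dbar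
    (hc.mono' ((subset_tsupport _).trans (tsupport_dbar_subset u)))
    ((tsupport_dbar_subset u).trans hb),
    setIntegral_congr_fun (measurableSet_target b) fun y hy =>
      congrArg topCoeff (inChart_dbar hu hy)]
  refine integral_topCoeff_localDbar (chartAt (Fin n → ℂ) b).open_target
    (isCompact_image_chart hc.isCompact hb) (image_chart_subset hb) (isSmooth_iff.1 hu b)
    fun y hy hyK => inChart_eq_zero (image_eq_zero_of_notMem_tsupport fun h =>
      hyK (mem_image_chart hy h))

/-- Stokes' theorem for `∂̄`. -/
theorem integralForm_dbar {u : Form n X} (hu : IsSmooth u) (hc : HasCompactSupport u) :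
    integralForm (dbar u) = 0 := by
  obtain ⟨s, -, hs⟩ := exists_finset_cutoff (n := n) hc.isCompact
  have hsm : ∀ c ∈ s, IsSmooth fun x => cutoff n c x • u x := fun c _ =>
    (isSmoothFun_cutoff c).smul hu
  -- The partition of unity splits u into finitely many forms, each supported in one chart.
  have h1 : u = fun x => ∑ c ∈ s, cutoff n c x • u x := by
    ext1 x
    rw [← Finset.sum_smul]
    by_cases hx : x ∈ tsupport u
    · rw [hs x hx, one_smul]
    · rw [image_eq_zero_of_notMem_tsupport hx, smul_zero]
  have h2 : dbar u = fun x => ∑ c ∈ s, dbar (fun x => cutoff n c x • u x) x := by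
    ext1 x
    conv_lhs => rw [h1]
    exact dbar_sum s _ hsm x
  rw [h2, integralForm_sum s _ (fun c hcs => (hsm c hcs).dbar) hc.isCompact]
  · refine Finset.sum_eq_zero fun c hcs => ?_
    exact integralForm_dbar_of_chart (b := c) (hsm c hcs)
      (hc.mono' ((subset_tsupport _).trans (tsupport_smul_form_subset _ u)))
      ((tsupport_smul_form_subset_left _ u).trans (tsupport_cutoff_subset c))
  · intro c _ x hx
    exact image_eq_zero_of_notMem_tsupport fun h => hx
      (tsupport_smul_form_subset _ u (tsupport_dbar_subset _ h))

end Stokes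

/-! ### Formal adjoints -/

section Adjoints

set_option linter.unusedSectionVars false

open MeasureTheory

variable {X : Type*} [TopologicalSpace X] [ChartedSpace (Fin n → ℂ) X]

/-- A compactly supported smooth function in a chart, as a function on the manifold. -/
def extendChart (b : X) (φ : (Fin n → ℂ) → ℝ) (x : X) : ℂ :=
  (chartAt (Fin n → ℂ) b).source.indicator
    (fun x => ((φ (chartAt (Fin n → ℂ) b x) : ℝ) : ℂ)) x

section ExtendChart

variable {b : X} {φ : (Fin n → ℂ) → ℝ} (hs : ContDiff ℝ ∞ φ) (hc : HasCompactSupport φ)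
  (hb : tsupport φ ⊆ (chartAt (Fin n → ℂ) b).target)

lemma extendChart_of_mem {x : X} (hx : x ∈ (chartAt (Fin n → ℂ) b).source) :
    extendChart b φ x = ((φ (chartAt (Fin n → ℂ) b x) : ℝ) : ℂ) :=
  Set.indicator_of_mem hx _

lemma extendChart_eq_zero {x : X} (hx : x ∉ (chartAt (Fin n → ℂ) b).symm '' tsupport φ) :
    extendChart b φ x = 0 := by
  by_cases h : x ∈ (chartAt (Fin n → ℂ) b).source
  · have h2 : φ (chartAt (Fin n → ℂ) b x) = 0 := image_eq_zero_of_notMem_tsupport fun h1 =>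
      hx ⟨_, h1, (chartAt (Fin n → ℂ) b).left_inv h⟩
    rw [extendChart_of_mem h, h2, Complex.ofReal_zero]
  · exact Set.indicator_of_notMem h _

include hb

lemma image_symm_subset :
    (chartAt (Fin n → ℂ) b).symm '' tsupport φ ⊆ (chartAt (Fin n → ℂ) b).source := by
  rintro _ ⟨y, hy, rfl⟩
  exact (chartAt (Fin n → ℂ) b).map_target (hb hy)

include hc

lemma isCompact_image_symm : IsCompact ((chartAt (Fin n → ℂ) b).symm '' tsupport φ) :=
  hc.isCompact.image_of_continuousOn ((chartAt (Fin n → ℂ) b).continuousOn_symm.mono hb)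

variable [T2Space X]

lemma tsupport_extendChart_subset :
    tsupport (extendChart b φ) ⊆ (chartAt (Fin n → ℂ) b).symm '' tsupport φ :=
  closure_minimal (fun x hx => by_contra fun h => hx (extendChart_eq_zero h))
    (isCompact_image_symm hc hb).isClosed

lemma hasCompactSupport_extendChart : HasCompactSupport (extendChart b φ) :=
  HasCompactSupport.intro (isCompact_image_symm hc hb) fun _ hx => extendChart_eq_zero hx

include hs

/-- In a Hausdorff space the compact support is closed, so near every point outside the chart the
extension is identically zero. -/
lemma isSmoothFun_extendChart [IsManifold 𝓘(ℂ, Fin n → ℂ) ω X] :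
    IsSmoothFun (n := n) (extendChart b φ) := by
  intro c y hy
  refine ContDiffAt.contDiffWithinAt ?_
  by_cases hx : (chartAt (Fin n → ℂ) c).symm y ∈ (chartAt (Fin n → ℂ) b).source
  · have h1 : ContDiffAt ℝ ∞ (fun y => ((φ (transition c b y) : ℝ) : ℂ)) y :=
      Complex.ofRealCLM.contDiff.contDiffAt.comp y
        (hs.contDiffAt.comp y (isHoloAt_transition hy hx).contDiffAt)
    refine h1.congr_of_eventuallyEq ?_
    filter_upwards [eventually_mem_overlap hy hx] with z hz using extendChart_of_mem hz.2
  · refine (contDiffAt_const (c := (0 : ℂ))).congr_of_eventuallyEq ?_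
    have h1 := ((chartAt (Fin n → ℂ) c).continuousAt_symm hy).preimage_mem_nhds
      ((isCompact_image_symm hc hb).isClosed.isOpen_compl.mem_nhds
        fun h => hx (image_symm_subset hb h))
    filter_upwards [h1] with z hz using extendChart_eq_zero hz

end ExtendChart

variable [IsManifold 𝓘(ℂ, Fin n → ℂ) ω X] [T2Space X] [SecondCountableTopology X]

lemma IsHermitianMetric.isNondegOneOne {g : Form n X} (hg : IsHermitianMetric g) (x : X) :
    IsNondegOneOne (g x) :=
  (hg.real_one_one x).isNondegOneOne (hg.posDef x).det_pos.ne'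

/-! ### The L² product of a Hermitian metric, and the adjoints of ∂̄, Λ and ∂̄^Λ. -/

section Metric

variable {g : Form n X} (hg : IsHermitianMetric g)

include hg

/-- The integrands have the same top coefficient, since the star of g represents its pairing. In
this form the Leibniz rule and Stokes' theorem apply. -/
lemma l2_eq (u v : Form n X) : l2 g u v = integralForm fun x => u x * hodge (g x) (v x) := by
  refine integralForm_congr fun x => ?_
  have h := topFunctional_mul_hodge (hg.isNondegOneOne x) topCoeffₗ_contract (u x) (v x)
  simp only [← topCoeffₗ_apply, map_smul, smul_eq_mul]
  exact h.symm

lemma isSmooth_hodge {v : Form n X} (hv : IsSmooth v) : IsSmooth fun x => hodge (g x) (v x) :=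
  IsSmooth.hodge hg.smooth hg.isNondegOneOne hv

lemma isSmooth_mul_hodge {u v : Form n X} (hu : IsSmooth u) (hv : IsSmooth v) :
    IsSmooth fun x => u x * hodge (g x) (v x) :=
  hu.mul (isSmooth_hodge hg hv)

omit hg in
lemma HasCompactSupport.mul_form {u : Form n X} (hc : HasCompactSupport u) (v : Form n X) :
    HasCompactSupport fun x => u x * v x :=
  hc.mono fun x hx h => hx (by simp [h])

lemma l2_sub_left {u u' v : Form n X} (hu : IsSmooth u) (hu' : IsSmooth u') (hv : IsSmooth v)
    (hc : HasCompactSupport u) (hc' : HasCompactSupport u') :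
    l2 g (u - u') v = l2 g u v - l2 g u' v := by
  rw [l2_eq hg, l2_eq hg, l2_eq hg, ← integralForm_sub (isSmooth_mul_hodge hg hu hv)
    (isSmooth_mul_hodge hg hu' hv) (HasCompactSupport.mul_form hc _)
    (HasCompactSupport.mul_form hc' _)]
  simp only [Pi.sub_apply, sub_mul]

lemma l2_sub_right {u v v' : Form n X} (hu : IsSmooth u) (hv : IsSmooth v) (hv' : IsSmooth v')
    (hc : HasCompactSupport u) : l2 g u (v - v') = l2 g u v - l2 g u v' := by
  rw [l2_eq hg, l2_eq hg, l2_eq hg, ← integralForm_sub (isSmooth_mul_hodge hg hu hv)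
    (isSmooth_mul_hodge hg hu hv') (HasCompactSupport.mul_form hc _)
    (HasCompactSupport.mul_form hc _)]
  congr 1
  ext1 x
  have h : hodge (g x) ((v - v') x) = hodge (g x) (v x) - hodge (g x) (v' x) := by
    rw [Pi.sub_apply, sub_eq_add_neg, ← neg_one_smul ℂ (v' x), hodge_add, hodge_smul]
    simp [sub_eq_add_neg]
  rw [h, mul_sub]

/-- The `L²` product is nondegenerate on smooth forms. -/
theorem eq_zero_of_l2 {w : Form n X} (hw : IsSmooth w)
    (h : ∀ u : Form n X, IsSmooth u → HasCompactSupport u → l2 g u w = 0) : w = 0 := by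
  ext1 b
  -- Its top coefficient is |w|² times that of the volume form; testing with a bump function times w
  -- integrates it against the bump function.
  let θ : Form n X := fun x => w x * hodge (g x) (w x)
  have hθ : IsSmooth θ := isSmooth_mul_hodge hg hw hw
  have hcont := continuousOn_topCoeff hθ b
  have hopen := (chartAt (Fin n → ℂ) b).open_target
  have h1 : ∀ᵐ y ∂(volume : Measure (Fin n → ℂ)), y ∈ (chartAt (Fin n → ℂ) b).target →
      topCoeff (inChart b θ y) = 0 := by
    refine hopen.ae_eq_zero_of_integral_contDiff_smul_eq_zero
      (hcont.locallyIntegrableOn hopen.measurableSet) fun φ hφ hc hsub => ?_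
    have hsm := isSmoothFun_extendChart hφ hc hsub
    have hu := h _ (hsm.smul hw)
      ((hasCompactSupport_extendChart hc hsub).mono fun x hx h => hx (by simp [h]))
    have hθs : (fun x => (extendChart b φ x • w x) * hodge (g x) (w x)) =
        fun x => extendChart b φ x • θ x := funext fun x => smul_mul_assoc _ _ _
    rw [l2_eq hg, hθs, integralForm_eq_integral_target (hsm.smul hθ)
      ((hasCompactSupport_extendChart hc hsub).mono fun x hx h => hx (by simp [h]))
      ((tsupport_smul_form_subset_left _ θ).trans
        ((tsupport_extendChart_subset hc hsub).trans (image_symm_subset hsub)))] at hu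
    rw [← setIntegral_eq_integral_of_forall_compl_eq_zero
      (s := (chartAt (Fin n → ℂ) b).target), ← hu]
    · refine setIntegral_congr_fun hopen.measurableSet fun y hy => ?_
      simp only [topCoeff_inChart_smul]
      rw [extendChart_of_mem ((chartAt (Fin n → ℂ) b).map_target hy),
        (chartAt (Fin n → ℂ) b).right_inv hy, Complex.real_smul]
    · intro y hy
      rw [image_eq_zero_of_notMem_tsupport fun h => hy (hsub h), zero_smul]
  -- Vanishing almost everywhere becomes vanishing everywhere by continuity, in particular at the
  -- centre b of the chart.
  have h2 := Measure.eqOn_open_of_ae_eq (μ := (volume : Measure (Fin n → ℂ)))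
    (g := fun _ => (0 : ℂ)) ((ae_restrict_iff' hopen.measurableSet).2 h1) hopen hcont
    continuousOn_const (mem_chart_target (Fin n → ℂ) b)
  simp only [inChart_self] at h2
  have h3 := topFunctional_mul_hodge (hg.isNondegOneOne b) topCoeffₗ_contract (w b) (w b)
  rw [topCoeffₗ_apply] at h3
  refine eq_zero_of_pairing_self (hg.posDef b) ?_
  exact (mul_eq_zero.1 (h3.symm.trans h2)).resolve_right
    (topFunctional_volForm_ne_zero (hg.isNondegOneOne b) topCoeffₗ_contract topCoeffₗ_ne_zero)

lemma IsAdjointAt.eq {P : Form n X → Form n X} {v w w' : Form n X} (h : IsAdjointAt g P v w)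
    (h' : IsAdjointAt g P v w') : w' = w := by
  rw [← sub_eq_zero]
  refine eq_zero_of_l2 hg (h'.1.sub h.1) fun u hu hc => ?_
  rw [l2_sub_right hg hu h'.1 h.1 hc, ← h.2 u hu hc, ← h'.2 u hu hc, sub_self]

lemma IsAdjointAt.existsUnique {P : Form n X → Form n X} {v w : Form n X}
    (h : IsAdjointAt g P v w) : ∃! w, IsAdjointAt g P v w :=
  ⟨w, h, fun _ h' => IsAdjointAt.eq hg h h'⟩

lemma IsAdjointAt.formalAdjoint_eq {P : Form n X → Form n X} {v w : Form n X}
    (h : IsAdjointAt g P v w) : formalAdjoint g P v = w := by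
  have h1 : ∃ w, IsAdjointAt g P v w := ⟨w, h⟩
  rw [formalAdjoint, dif_pos h1]
  exact IsAdjointAt.eq hg h h1.choose_spec

omit hg in
/-- The formal adjoint of `∂̄`, in terms of the Hodge star operator. -/
def dbarAdj (g : Form n X) (v : Form n X) : Form n X := fun x =>
  hodgeInv (g x) (-involution (dbar (fun x => hodge (g x) (v x)) x))

lemma isSmooth_dbarAdj {v : Form n X} (hv : IsSmooth v) : IsSmooth (dbarAdj g v) :=
  IsSmooth.hodgeInv hg.smooth hg.isNondegOneOne
    (isNaturalOp_involution.isSmooth (isSmooth_hodge hg hv).dbar).neg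

omit hg in
lemma hasCompactSupport_dbar {u : Form n X} (hc : HasCompactSupport u) :
    HasCompactSupport (dbar u) :=
  hc.mono' ((subset_tsupport _).trans (tsupport_dbar_subset u))

/-- Stokes' theorem for u ∧ *v with the Leibniz rule moves ∂̄ from u to *v. The involution on u
passes to the other factor, as the top coefficient is invariant under it, and the inverse star
brings the result back to an L² product. -/
theorem isAdjointAt_dbar {v : Form n X} (hv : IsSmooth v) : IsAdjointAt g dbar v (dbarAdj g v) := by
  refine ⟨isSmooth_dbarAdj hg hv, fun u hu hc => ?_⟩
  set θ : Form n X := fun x => hodge (g x) (v x) with hθ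
  have hθs : IsSmooth θ := isSmooth_hodge hg hv
  have h1 : dbar (fun x => u x * θ x) =
      fun x => dbar u x * θ x + involution (u x) * dbar θ x :=
    funext fun x => dbar_mul hu hθs x
  have hi : IsSmooth fun x => involution (u x) := isNaturalOp_involution.isSmooth hu
  have hci : HasCompactSupport fun x => involution (u x) :=
    hc.mono fun x hx h => hx (by simp [h])
  have h2 := integralForm_dbar (hu.mul hθs) (HasCompactSupport.mul_form hc θ)
  have h2' : integralForm (fun x => dbar u x * θ x + involution (u x) * dbar θ x) = 0 := by
    rw [← h1]; exact h2
  rw [integralForm_add (hu.dbar.mul hθs) (hi.mul hθs.dbar)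
    (HasCompactSupport.mul_form (hasCompactSupport_dbar hc) _)
    (HasCompactSupport.mul_form hci _)] at h2'
  rw [l2_eq hg, l2_eq hg, eq_neg_of_add_eq_zero_left h2',
    ← neg_one_mul, ← integralForm_const_smul _ (HasCompactSupport.mul_form hci _)]
  refine integralForm_congr fun x => ?_
  rw [dbarAdj, hodge_hodgeInv (hg.isNondegOneOne x), mul_neg, neg_one_smul,
    ← topCoeffₗ_apply, ← topCoeffₗ_apply, map_neg, map_neg,
    ← topFunctional_involution topCoeffₗ_contract (u x * involution (dbar θ x)),
    map_mul involution, involution_involution]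

variable {om : Form n X} (hs : IsSmooth om) (h0 : ∀ x, IsNondegOneOne (om x))
  (hM : ∀ x, (matrixOf (om x)).IsHermitian)
  (hadm : ∀ x, (matrixOf (om x))⁻¹ = (matrixOf (g x))⁻¹ * matrixOf (om x) * (matrixOf (g x))⁻¹)

include h0 hM hadm

lemma l2_lam (u v : Form n X) :
    l2 g (fun x => lam (om x) (u x)) v = l2 g u (fun x => om x * v x) := by
  refine congrArg integralForm (funext fun x => ?_)
  have hgh := (hg.posDef x).isHermitian
  have h := pairing_lef_left (h0 x) (hM x) hgh (hadm x) (u x) (v x)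
  have h2 : pairing (g x) (lam (om x) (u x)) (v x) = pairing (g x) (u x) (lef (om x) (v x)) := by
    rw [← pairing_conj_symm hgh (v x) (lam (om x) (u x)), ← h,
      pairing_conj_symm hgh (lef (om x) (v x)) (u x)]
  exact congrArg (fun c : ℂ => c • volForm (g x)) h2

include hs

theorem isAdjointAt_dualLefschetz {v : Form n X} (hv : IsSmooth v) :
    IsAdjointAt g (dualLefschetz om) v (lefschetz om v) :=
  ⟨hs.mul hv, fun u _ _ => by rw [dualLefschetz_eq h0, l2_lam hg h0 hM hadm]; rfl⟩

omit hg h0 hM hadm in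
lemma isSmooth_lefschetz {v : Form n X} (hv : IsSmooth v) : IsSmooth (lefschetz om v) :=
  hs.mul hv

omit hg h0 hM hadm hs in
lemma hasCompactSupport_lam {u : Form n X} (hc : HasCompactSupport u) :
    HasCompactSupport fun x => lam (om x) (u x) :=
  hc.mono fun x hx h => hx (by simp [h])

variable (hd : dbar om = 0)

include hd

/-- Take adjoints in ∂̄^Λ = ∂̄Λ − Λ∂̄: the order of the factors is reversed, and Λ becomes L. -/
theorem isAdjointAt_dbarLam {v : Form n X} (hv : IsSmooth v) : IsAdjointAt g (dbarLam om) v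
    (lefschetz om (dbarAdj g v) - dbarAdj g (lefschetz om v)) := by
  have hLv := isSmooth_lefschetz hs hv
  have hL := isSmooth_lefschetz hs (isSmooth_dbarAdj hg hv)
  refine ⟨hL.sub (isSmooth_dbarAdj hg hLv), fun u hu hc => ?_⟩
  have hlam := IsSmooth.lam hs h0 hu
  have hclam := hasCompactSupport_lam (om := om) hc
  have h1 : dbarLam om u = dbar (fun x => lam (om x) (u x)) - fun x => lam (om x) (dbar u x) :=
    funext fun x => dbarLam_eq hs h0 hd hu x
  have h2 : l2 g (dbar fun x => lam (om x) (u x)) v = l2 g u (lefschetz om (dbarAdj g v)) :=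
    ((isAdjointAt_dbar hg hv).2 _ hlam hclam).trans (l2_lam hg h0 hM hadm u (dbarAdj g v))
  have h3 : l2 g (fun x => lam (om x) (dbar u x)) v = l2 g u (dbarAdj g (lefschetz om v)) :=
    (l2_lam hg h0 hM hadm (dbar u) v).trans ((isAdjointAt_dbar hg hLv).2 u hu hc)
  rw [h1, l2_sub_left hg hlam.dbar (IsSmooth.lam hs h0 hu.dbar) hv
    (hasCompactSupport_dbar hclam) (hasCompactSupport_lam (hasCompactSupport_dbar hc)),
    l2_sub_right hg hu hL (isSmooth_dbarAdj hg hLv) hc, h2, h3]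

/-- The adjoint of `∂̄^Λ` commutes with `L`, because `∂̄^Λ` commutes with `Λ`. -/
theorem adjoint_dbarLam_lefschetz {v w w' : Form n X}
    (hw : IsAdjointAt g (dbarLam om) v w) (hw' : IsAdjointAt g (dbarLam om) (lefschetz om v) w') :
    w' - lefschetz om w = 0 := by
  have hLw := isSmooth_lefschetz hs hw.1
  refine eq_zero_of_l2 hg (hw'.1.sub hLw) fun u hu hc => ?_
  have hlam := IsSmooth.lam hs h0 hu
  have h1 : (fun x => lam (om x) (dbarLam om u x)) = dbarLam om fun x => lam (om x) (u x) :=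
    funext fun x => lam_dbarLam hs h0 hd hu x
  have h2 : l2 g u w' = l2 g (fun x => lam (om x) (dbarLam om u x)) v := by
    rw [← hw'.2 u hu hc, l2_lam hg h0 hM hadm]
    rfl
  have h3 : l2 g u (lefschetz om w) = l2 g (fun x => lam (om x) (dbarLam om u x)) v := by
    rw [h1, hw.2 _ hlam (hasCompactSupport_lam hc), l2_lam hg h0 hM hadm]
    rfl
  rw [l2_sub_right hg hu hw'.1 hLw hc, h2, h3, sub_self]

end Metric

end Adjoints

end MinkowskiKahler

end

/-! ### The Kähler identity of Minkowski type. -/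

theorem theorem5p3 {n : ℕ} {X : Type*} [TopologicalSpace X] [T2Space X]
    [SecondCountableTopology X] [ChartedSpace (Fin n → ℂ) X]
    [IsManifold 𝓘(ℂ, Fin n → ℂ) ω X]
    (om : Form n X) (omg : Form n X)
    (hom : IsSymplecticOneOne om)
    (homg : IsHermitianMetric omg)
    (hadm : IsAdmissible om omg) :
    -- the formal adjoints of `∂̄`, `∂̄^Λ` and `Λ` exist and are unique
    (∀ v : Form n X, IsSmooth v →
      (∃! w, IsAdjointAt omg dbar v w) ∧
      (∃! w, IsAdjointAt omg (dbarLam om) v w) ∧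
      (∃! w, IsAdjointAt omg (dualLefschetz om) v w)) ∧
    -- `Λ* = L`
    (∀ v : Form n X, IsSmooth v →
      formalAdjoint omg (dualLefschetz om) v =
        lefschetz om v) ∧
    -- `(∂̄^Λ)* = [L, ∂̄*]`
    (∀ v : Form n X, IsSmooth v →
      formalAdjoint omg (dbarLam om) v =
        lefschetz om (formalAdjoint omg dbar v) -
          formalAdjoint omg dbar (lefschetz om v)) ∧
    -- `[(∂̄^Λ)*, L] = 0`
    (∀ v : Form n X, IsSmooth v →
      formalAdjoint omg (dbarLam om) (lefschetz om v) -
        lefschetz om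
          (formalAdjoint omg (dbarLam om) v) = 0) := by
  have h0 : ∀ x, IsNondegOneOne (om x) := fun x =>
    (hom.real_one_one x).isNondegOneOne (hom.nondegenerate x)
  have hd : dbar om = 0 := dbar_eq_zero_of_extD hom.smooth h0 hom.closed
  have hM : ∀ x, (matrixOf (om x)).IsHermitian := fun x => (hom.real_one_one x).2
  -- Admissibility is used only through this identity, which makes Λ the pointwise adjoint of L.
  have hinv : ∀ x, (matrixOf (om x))⁻¹ =
      (matrixOf (omg x))⁻¹ * matrixOf (om x) * (matrixOf (omg x))⁻¹ := fun x =>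
    admissible_inv (admissible_mul_self (hM x) (homg.posDef x) (hadm x))
  have hdbar := fun (v : Form n X) (hv : IsSmooth v) => isAdjointAt_dbar homg hv
  have hlam := fun (v : Form n X) (hv : IsSmooth v) =>
    isAdjointAt_dualLefschetz homg hom.smooth h0 hM hinv hv
  have hdbarLam := fun (v : Form n X) (hv : IsSmooth v) =>
    isAdjointAt_dbarLam homg hom.smooth h0 hM hinv hd hv
  refine ⟨fun v hv => ⟨(hdbar v hv).existsUnique homg, (hdbarLam v hv).existsUnique homg,
    (hlam v hv).existsUnique homg⟩, fun v hv => (hlam v hv).formalAdjoint_eq homg,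
    fun v hv => ?_, fun v hv => ?_⟩
  · have hLv := isSmooth_lefschetz hom.smooth hv
    rw [(hdbarLam v hv).formalAdjoint_eq homg, (hdbar v hv).formalAdjoint_eq homg,
      (hdbar _ hLv).formalAdjoint_eq homg]
  · have hLv := isSmooth_lefschetz hom.smooth hv
    rw [(hdbarLam v hv).formalAdjoint_eq homg, (hdbarLam _ hLv).formalAdjoint_eq homg]
    exact adjoint_dbarLam_lefschetz homg hom.smooth h0 hM hinv hd (hdbarLam v hv)
      (hdbarLam _ hLv)
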